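/- Let $\mathbb F$ be an algebraically closed field of characteristic $0$, and let $R=\mathrm{Mat}_n(\mathbb F)$, $n\ge 1$. All gradings are gradings by abelian groups. An involution is an $\mathbb F$-linear antiautomorphism $\varphi$ with $\varphi^2=\mathrm{id}$; an involution of $R$ is orthogonal (respectively symplectic) if it is the adjoint map of a nondegenerate symmetric (respectively skew-symmetric) bilinear form on $\mathbb F^n$. **Definitions.** A *graded isomorphism* $(A,\Gamma)\to(A',\Gamma')$ of graded algebras (possibly graded by different groups) is an algebra isomorphism that maps every nonzero homogeneous component of $\Gamma$ onto a homogeneous component of $\Gamma'$. For an antiautomorphism $\varphi$ of $R$, a grading $\Gamma: R=\bigoplus_{g\in G}R_g$ is a *$\varphi$-grading* if for every $g\in G$ one has $\varphi(R_g)=R_g$ and $\varphi^2|_{R_g}=\alpha_g\,\mathrm{id}$ for some $0\neq\alpha_g\in\mathbb F$, with $\alpha_0=1$. It is a *fine* $\varphi$-grading if it has no proper refinement among the $\varphi$-gradings of $R$. A *central graded division algebra* is a finite-dimensional central graded $\mathbb F$-algebra $D\neq0$ all of whose nonzero homogeneous elements are invertible; a graded involution of $D$ is an involution that preserves every homogeneous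 component. Consider the pairs $((D,\tau),(d_1,\dots,d_p))$, where $D$ is a central graded division algebra, $\tau$ is a graded involution of $D$, and $(d_1,\dots,d_p)$, $p\ge0$, is a tuple of nonzero homogeneous elements of $D$ such that either $d_i^\tau=d_i$ for all $i$ or $d_i^\tau=-d_i$ for all $i$. Two pairs $((D,\tau),(d_1,\dots,d_p))$ and $((D',\tau'),(d_1',\dots,d_q'))$ are *equivalent* if $p=q$ and there are a nonzero homogeneous $z\in D$, a graded isomorphism $\Phi:D\to D'$ with $\Phi(zx^{\tau}z^{-1})=\Phi(x)^{\tau'}$ for all $x\in D$, and a permutation $\pi\in S_p$ such that $\Phi(zd_i)\in\mathbb F d'_{\pi(i)}$ for all $i$. The equivalence class is denoted by $[(D,\tau),(d_1,\dots,d_p)]$. For an involution $\varphi$ of $R$ and a fine $\varphi$-grading $\Gamma$, the invariant is $$\mathcal I_2(R,\varphi,\Gamma)=[(D,\tau),(d_1,\dots,d_p)],$$ where $D$ is a central graded division algebra with a graded involution $\tau$, $V$ is a graded right $D$-module of finite rank, and $B:V\times V\to D$ is a nondegenerate homogeneous $\tau$-sesquilinear form (that is, $B$ is $\mathbb F$-bilinear,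 $B(xa,y)=a^\tau B(x,y)$, $B(x,ya)=B(x,y)a$, and for some $g$ in the grading group $B(V_{g_1},V_{g_2})\subseteq D_{g_1+g_2+g}$ for all $g_1,g_2$) that is hermitian or skew-hermitian with respect to $\tau$, such that there is a graded isomorphism from $(R,\Gamma)$ onto $\mathrm{End}_D(V)$, with the grading induced by that of $V$, which carries $\varphi$ to the adjoint map of $B$; moreover $V$ has a homogeneous $D$-basis $v_1,\dots,v_{p+2s}$ with $B(v_i,v_i)=d_i$, $d_i^2=1$ for $1\le i\le p$, with $B(v_{p+2j-1},v_{p+2j})=\nu_j$ and $B(v_{p+2j},v_{p+2j-1})=\nu_j^{-1}$ for some $0\ne\nu_j\in\mathbb F$, $1\le j\le s$, and with $B(v_i,v_j)=0$ for all other $i,j$. **Theorem.** Let $\varphi_1$ and $\varphi_2$ be involutions of $R$ and let $\Gamma_i$ be a fine $\varphi_i$-grading of $R$, $i=1,2$. Then $\mathcal I_2(R,\varphi_1,\Gamma_1)$ and $\mathcal I_2(R,\varphi_2,\Gamma_2)$ are well defined (such data exist, and all of them give the same class), and: 1. if there is a graded isomorphism $\Phi:(R,\Gamma_1)\to(R,\Gamma_2)$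 such that $\Phi\varphi_1\Phi^{-1}=\varphi_2$, then $\mathcal I_2(R,\varphi_1,\Gamma_1)=\mathcal I_2(R,\varphi_2,\Gamma_2)$; 2. conversely, if $\mathcal I_2(R,\varphi_1,\Gamma_1)=\mathcal I_2(R,\varphi_2,\Gamma_2)$, and either the tuple in this class is nonempty ($p\ge1$) or $\varphi_1$ and $\varphi_2$ are of the same type (both orthogonal or both symplectic), then there is such a $\Phi$. In particular, if $\varphi_1$ and $\varphi_2$ are of the same type, then $\mathcal I_2(R,\varphi_1,\Gamma_1)=\mathcal I_2(R,\varphi_2,\Gamma_2)$ if and only if there is a graded isomorphism $\Phi:(R,\Gamma_1)\to(R,\Gamma_2)$ with $\Phi\varphi_1\Phi^{-1}=\varphi_2$. -/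

import Mathlib

universe u v w

namespace GradedInvolutions

section Gradings

variable {F : Type u} [Field F] {A : Type v} [Ring A] [Algebra F A]

open Classical in
/-- `𝒜` is a grading of the algebra `A` by the abelian group `G`. -/
def IsGrading {G : Type w} [AddCommGroup G] (𝒜 : G → Submodule F A) : Prop :=
  DirectSum.IsInternal 𝒜 ∧ SetLike.GradedMonoid 𝒜

/-- `𝒜` refines `ℬ`: every homogeneous component of `𝒜` lies in one of `ℬ`. -/
def Refines {G H : Type*} (𝒜 : G → Submodule F A) (ℬ : H → Submodule F A) : Prop :=
  ∀ g, 𝒜 g ≠ ⊥ → ∃ h, 𝒜 g ≤ ℬ h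

/-- A graded isomorphism (equivalence of gradings, possibly over different groups): the
isomorphism `Φ` sends every (nonzero) homogeneous component onto a homogeneous component. -/
def IsGradedIso {A' : Type*} [Ring A'] [Algebra F A'] {G H : Type*}
    (𝒜 : G → Submodule F A) (ℬ : H → Submodule F A') (Φ : A ≃ₐ[F] A') : Prop :=
  ∀ g, 𝒜 g ≠ ⊥ → ∃ h, (𝒜 g).map Φ.toLinearMap = ℬ h

/-- `φ` is an antiautomorphism of the `F`-algebra `A`. -/
structure IsAntiautomorphism (φ : A →ₗ[F] A) : Prop where
  bijective : Function.Bijective φ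
  map_one : φ 1 = 1
  map_mul : ∀ x y, φ (x * y) = φ y * φ x

/-- `φ` is an (`F`-linear) involution of the `F`-algebra `A`. -/
structure IsInvolution (φ : A →ₗ[F] A) : Prop extends IsAntiautomorphism φ where
  invol : ∀ x, φ (φ x) = x

/-- `𝒜` is a `φ`-grading, for an antiautomorphism `φ`. -/
structure IsPhiGrading {G : Type w} [AddCommGroup G]
    (φ : A →ₗ[F] A) (𝒜 : G → Submodule F A) : Prop where
  isGrading : IsGrading 𝒜
  map_eq : ∀ g, (𝒜 g).map φ = 𝒜 g
  sq_scalar : ∀ g, ∃ α : F, α ≠ 0 ∧ ∀ x ∈ 𝒜 g, φ (φ x) = α • x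
  sq_zero : ∀ x ∈ 𝒜 0, φ (φ x) = x

/-- `𝒜` is a fine `φ`-grading: a `φ`-grading with no proper refinement among the `φ`-gradings by
abelian groups. (A finite-dimensional algebra has finite supports, so that groups in `Type`, which
comprise all finitely generated ones up to isomorphism, account for all refinements.) -/
def IsFinePhiGrading {G : Type w} [AddCommGroup G]
    (φ : A →ₗ[F] A) (𝒜 : G → Submodule F A) : Prop :=
  IsPhiGrading φ 𝒜 ∧
    ∀ (H : Type) (_ : AddCommGroup H) (ℬ : H → Submodule F A),
      IsPhiGrading φ ℬ → Refines ℬ 𝒜 → Refines 𝒜 ℬ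

/-- `𝒟` makes `A` a finite-dimensional central graded division algebra. -/
structure IsCentralGradedDivision {G : Type w} [AddCommGroup G]
    (𝒟 : G → Submodule F A) : Prop where
  finiteDimensional : FiniteDimensional F A
  nontrivial : Nontrivial A
  central : Algebra.IsCentral F A
  isGrading : IsGrading 𝒟
  isUnit : ∀ g, ∀ x ∈ 𝒟 g, x ≠ 0 → IsUnit x

end Gradings

section Types

variable {F : Type u} [Field F] {n : ℕ}

/-- `φ` is an orthogonal involution of `Mat_n(F)`: the adjoint with respect to a nondegenerate
symmetric bilinear form. -/
def IsOrthogonal (φ : Matrix (Fin n) (Fin n) F →ₗ[F] Matrix (Fin n) (Fin n) F) : Prop :=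
  ∃ S : Matrix (Fin n) (Fin n) F, IsUnit S ∧ S.transpose = S ∧
    ∀ X, φ X = S⁻¹ * X.transpose * S

/-- `φ` is a symplectic involution of `Mat_n(F)`: the adjoint with respect to a nondegenerate
skew-symmetric bilinear form. -/
def IsSymplectic (φ : Matrix (Fin n) (Fin n) F →ₗ[F] Matrix (Fin n) (Fin n) F) : Prop :=
  ∃ S : Matrix (Fin n) (Fin n) F, IsUnit S ∧ S.transpose = -S ∧
    ∀ X, φ X = S⁻¹ * X.transpose * S

/-- The two involutions are both orthogonal or both symplectic. -/
def SameType (φ₁ φ₂ : Matrix (Fin n) (Fin n) F →ₗ[F] Matrix (Fin n) (Fin n) F) : Prop :=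
  (IsOrthogonal φ₁ ∧ IsOrthogonal φ₂) ∨ (IsSymplectic φ₁ ∧ IsSymplectic φ₂)

end Types

/-- A pair `((D, τ), (d₁, …, d_p))`: a central graded division algebra `D` with a graded
involution `τ` and a `p`-tuple, `p ≥ 0`, of nonzero homogeneous elements of `D` that are either all
`τ`-symmetric or all `τ`-skew. The grading group `G` may be larger than the support of `D`. -/
structure InvPair (F : Type u) [Field F] : Type (u + 1) where
  D : Type u
  G : Type
  [ringD : Ring D]
  [algebraD : Algebra F D]
  [groupG : AddCommGroup G]
  comp : G → Submodule F D
  division : IsCentralGradedDivision comp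
  τ : D →ₗ[F] D
  isInvolution : IsInvolution τ
  graded : ∀ g, (comp g).map τ = comp g
  p : ℕ
  d : Fin p → D
  d_ne_zero : ∀ i, d i ≠ 0
  d_homogeneous : ∀ i, ∃ g, d i ∈ comp g
  d_sign : (∀ i, τ (d i) = d i) ∨ (∀ i, τ (d i) = -d i)

attribute [instance] InvPair.ringD InvPair.algebraD InvPair.groupG

namespace InvPair

variable {F : Type u} [Field F]

/-- Equivalence of pairs: there are a nonzero homogeneous (hence invertible) `z ∈ D`, a graded
isomorphism `Φ : D → D'` with `Φ τ^z = τ' Φ`, where `τ^z(x) = z τ(x) z⁻¹`, and a bijection `π` of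
the index sets (so that `p = p'`) such that `Φ(z dᵢ) ∈ F d'_{π(i)}` for all `i`. -/
def Equivalent (P P' : InvPair F) : Prop :=
  ∃ (z : P.Dˣ) (Φ : P.D ≃ₐ[F] P'.D) (π : Fin P.p ≃ Fin P'.p),
    (∃ g, (z : P.D) ∈ P.comp g) ∧
    IsGradedIso P.comp P'.comp Φ ∧
    (∀ x, Φ (z * P.τ x * (z⁻¹ : P.Dˣ)) = P'.τ (Φ x)) ∧
    ∀ i, ∃ c : F, Φ (z * P.d i) = c • P'.d (π i)

theorem isGradedIso_trans {A B C : Type*} [Ring A] [Algebra F A] [Ring B] [Algebra F B]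
    [Ring C] [Algebra F C] {G H K : Type*} {𝒜 : G → Submodule F A} {ℬ : H → Submodule F B}
    {𝒞 : K → Submodule F C} {Φ : A ≃ₐ[F] B} {Ψ : B ≃ₐ[F] C}
    (h₁ : IsGradedIso 𝒜 ℬ Φ) (h₂ : IsGradedIso ℬ 𝒞 Ψ) : IsGradedIso 𝒜 𝒞 (Φ.trans Ψ) := by
  intro g hg
  obtain ⟨h, hh⟩ := h₁ g hg
  have hne : ℬ h ≠ ⊥ := by
    rw [← hh]
    intro h0
    apply hg
    rw [Submodule.eq_bot_iff] at h0 ⊢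
    intro x hx
    have hx0 := h0 _ (Submodule.mem_map_of_mem hx)
    exact Φ.injective (by rw [map_zero]; exact hx0)
  obtain ⟨k, hk⟩ := h₂ h hne
  refine ⟨k, ?_⟩
  rw [← hk, ← hh, ← Submodule.map_comp]
  rfl

theorem isGradedIso_symm {A B : Type*} [Ring A] [Algebra F A] [Ring B] [Algebra F B]
    {G H : Type*} [AddCommGroup G] [AddCommGroup H] {𝒜 : G → Submodule F A}
    {ℬ : H → Submodule F B} {Φ : A ≃ₐ[F] B} (h𝒜 : IsGrading 𝒜) (hℬ : IsGrading ℬ)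
    (h : IsGradedIso 𝒜 ℬ Φ) : IsGradedIso ℬ 𝒜 Φ.symm := by
  classical
  intro k hk
  by_contra hcon
  push Not at hcon
  have hind := (DirectSum.isInternal_submodule_iff_iSupIndep_and_iSup_eq_top ℬ).1
    (by convert hℬ.1)
  have htop := ((DirectSum.isInternal_submodule_iff_iSupIndep_and_iSup_eq_top 𝒜).1
    (by convert h𝒜.1)).2
  have key : ∀ g, (𝒜 g).map Φ.toLinearMap ≤ ⨆ (j) (_ : j ≠ k), ℬ j := by
    intro g
    by_cases hg : 𝒜 g = ⊥
    · simp [hg]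
    · obtain ⟨j, hj⟩ := h g hg
      have hjk : j ≠ k := by
        rintro rfl
        apply hcon g
        rw [← hj]
        ext x
        constructor
        · rintro ⟨_, ⟨y, hy, rfl⟩, rfl⟩
          simpa using hy
        · intro hx
          exact ⟨Φ x, ⟨x, hx, rfl⟩, by simp⟩
      rw [hj]
      exact le_iSup₂_of_le j hjk le_rfl
  have htop' : (⨆ (j) (_ : j ≠ k), ℬ j) = ⊤ := by
    rw [eq_top_iff]
    have h1 : (⊤ : Submodule F A).map Φ.toLinearMap = ⊤ := by
      rw [Submodule.map_top]
      exact LinearMap.range_eq_top.2 Φ.surjective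
    rw [← h1, ← htop, Submodule.map_iSup]
    exact iSup_le key
  have hd := hind.1 k
  rw [htop'] at hd
  exact hk (disjoint_top.1 hd)

theorem Equivalent.refl (P : InvPair F) : Equivalent P P := by
  refine ⟨1, AlgEquiv.refl, Equiv.refl _, ⟨0, ?_⟩, ?_, ?_, ?_⟩
  · have := P.division.isGrading.2
    exact SetLike.GradedOne.one_mem
  · intro g _
    refine ⟨g, ?_⟩
    ext x
    constructor
    · rintro ⟨y, hy, rfl⟩
      exact hy
    · intro hx
      exact ⟨x, hx, rfl⟩
  · simp
  · intro i
    exact ⟨1, by simp⟩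

theorem exists_mem_comp_of_isGradedIso {A B : Type*} [Ring A] [Algebra F A] [Ring B] [Algebra F B]
    {G H : Type*} {𝒜 : G → Submodule F A} {ℬ : H → Submodule F B} {Φ : A ≃ₐ[F] B}
    (h : IsGradedIso 𝒜 ℬ Φ) {x : A} (hx0 : x ≠ 0) {g : G} (hx : x ∈ 𝒜 g) :
    ∃ k, Φ x ∈ ℬ k := by
  obtain ⟨k, hk⟩ := h g (fun h0 => hx0 (by rw [h0] at hx; exact (Submodule.mem_bot F).1 hx))
  exact ⟨k, hk ▸ Submodule.mem_map_of_mem (f := Φ.toLinearMap) hx⟩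

theorem exists_inv_mem {A : Type*} [Ring A] [Algebra F A] {G : Type*} [AddCommGroup G]
    {𝒜 : G → Submodule F A} (h𝒜 : IsGrading 𝒜) (z : Aˣ) {g : G} (hz : (z : A) ∈ 𝒜 g) :
    ∃ k, ((z⁻¹ : Aˣ) : A) ∈ 𝒜 k := by
  classical
  have h2 := h𝒜.2
  have h1 : DirectSum.IsInternal 𝒜 := by convert h𝒜.1
  let _ := h1.chooseDecomposition
  let _ : GradedRing 𝒜 := {}
  refine ⟨-g, ?_⟩
  have h3 := DirectSum.coe_decompose_mul_add_of_left_mem 𝒜 (j := -g) (b := ((z⁻¹ : Aˣ) : A)) hz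
  rw [Units.mul_inv, add_neg_cancel, DirectSum.decompose_of_mem_same 𝒜 SetLike.GradedOne.one_mem]
    at h3
  rw [← mul_one ((z⁻¹ : Aˣ) : A), (Units.inv_mul_eq_iff_eq_mul z).2 h3]
  exact SetLike.coe_mem _

theorem Equivalent.symm {P P' : InvPair F} (h : Equivalent P P') : Equivalent P' P := by
  obtain ⟨z, Φ, π, ⟨g, hz⟩, hΦ, hτ, hd⟩ := h
  have := P.division.nontrivial
  have hw : ((Units.map (Φ : P.D →* P'.D) z)⁻¹ : P'.Dˣ) =
      Units.map (Φ : P.D →* P'.D) z⁻¹ := (map_inv _ z).symm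
  obtain ⟨k, hk⟩ := exists_inv_mem P.division.isGrading z hz
  refine ⟨Units.map (Φ : P.D →* P'.D) z⁻¹, Φ.symm, π.symm, ?_,
    isGradedIso_symm P.division.isGrading P'.division.isGrading hΦ, ?_, ?_⟩
  · exact exists_mem_comp_of_isGradedIso hΦ (Units.ne_zero _) hk
  · intro x
    obtain ⟨y, rfl⟩ := Φ.surjective x
    rw [← hτ, ← map_inv, inv_inv]
    simp [mul_assoc]
  · intro i
    obtain ⟨i, rfl⟩ := π.surjective i
    obtain ⟨c, hc⟩ := hd i
    have hc0 : c ≠ 0 := by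
      rintro rfl
      rw [zero_smul, map_eq_zero_iff _ Φ.injective, Units.mul_right_eq_zero] at hc
      exact P.d_ne_zero i hc
    refine ⟨c⁻¹, ?_⟩
    have h1 : P'.d (π i) = c⁻¹ • Φ (z * P.d i) := by rw [hc, smul_smul, inv_mul_cancel₀ hc0, one_smul]
    rw [h1]
    simp

theorem Equivalent.trans {P P' P'' : InvPair F} (h₁ : Equivalent P P') (h₂ : Equivalent P' P'') :
    Equivalent P P'' := by
  obtain ⟨z, Φ, π, ⟨g, hz⟩, hΦ, hτ, hd⟩ := h₁
  obtain ⟨z', Φ', π', ⟨g', hz'⟩, hΦ', hτ', hd'⟩ := h₂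
  have := P.division.nontrivial
  have := P'.division.nontrivial
  have := P.division.isGrading.2
  obtain ⟨k, hk⟩ := exists_mem_comp_of_isGradedIso
    (isGradedIso_symm P.division.isGrading P'.division.isGrading hΦ) z'.ne_zero hz'
  refine ⟨Units.map (Φ.symm : P'.D →* P.D) z' * z, Φ.trans Φ', π.trans π',
    ⟨k + g, SetLike.GradedMul.mul_mem hk hz⟩, isGradedIso_trans hΦ hΦ', ?_, ?_⟩
  · intro x
    have h1 := hτ' (Φ x)
    rw [← hτ x] at h1
    rw [AlgEquiv.trans_apply Φ Φ' x, ← h1, mul_inv_rev, ← map_inv]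
    simp [mul_assoc]
  · intro i
    obtain ⟨c, hc⟩ := hd i
    obtain ⟨c', hc'⟩ := hd' (π i)
    refine ⟨c * c', ?_⟩
    have h1 : Φ.symm (z' : P'.D) * z * P.d i = Φ.symm (z' * Φ (z * P.d i)) := by
      simp [mul_assoc]
    have h2 : ((Units.map (Φ.symm : P'.D →* P.D) z' * z : P.Dˣ) : P.D) = Φ.symm (z' : P'.D) * z := by
      simp
    rw [h2, h1, hc, AlgEquiv.trans_apply, AlgEquiv.apply_symm_apply, mul_smul_comm, map_smul, hc',
      smul_smul]
    rfl

/-- Equivalence of pairs is an equivalence relation. -/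
instance setoid (F : Type u) [Field F] : Setoid (InvPair F) :=
  ⟨Equivalent, Equivalent.refl, Equivalent.symm, Equivalent.trans⟩

theorem Equivalent.p_eq {P P' : InvPair F} (h : Equivalent P P') : P.p = P'.p := by
  obtain ⟨_, _, π, _⟩ := h
  simpa using Fintype.card_congr π

end InvPair

/-- The equivalence classes `[(D, τ), (d₁, …, d_p)]`. -/
def PairClass (F : Type u) [Field F] : Type (u + 1) :=
  Quotient (InvPair.setoid F)

/-- The length `p` of the tuple of a class `[(D, τ), (d₁, …, d_p)]`. -/
def PairClass.length {F : Type u} [Field F] : PairClass F → ℕ :=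
  Quotient.lift InvPair.p fun _ _ h => InvPair.Equivalent.p_eq h

section Invariant

variable {F : Type u} [Field F]

open Classical in
/-- `𝒱` makes the right `D`-module `V` a `G`-graded module over the `G`-graded algebra `(D, 𝒟)`. -/
def IsModuleGrading {D : Type*} [Ring D] [Algebra F D] {V : Type*} [AddCommGroup V] [Module F V]
    [Module Dᵐᵒᵖ V] {G : Type*} [AddCommGroup G]
    (𝒟 : G → Submodule F D) (𝒱 : G → Submodule F V) : Prop :=
  DirectSum.IsInternal 𝒱 ∧
    ∀ g h, ∀ x ∈ 𝒱 g, ∀ a ∈ 𝒟 h, MulOpposite.op a • x ∈ 𝒱 (g + h)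

/-- The grading induced on `End_D(V)` by a grading on the right `D`-module `V`. -/
def inducedGrading {D : Type*} [Ring D] [Algebra F D] {V : Type*} [AddCommGroup V] [Module F V]
    [Module Dᵐᵒᵖ V] [IsScalarTower F Dᵐᵒᵖ V] {G : Type*} [AddCommGroup G]
    (𝒱 : G → Submodule F V) (g : G) : Submodule F (Module.End Dᵐᵒᵖ V) where
  carrier := {f | ∀ g', ∀ x ∈ 𝒱 g', f x ∈ 𝒱 (g + g')}
  add_mem' hf hf' g' x hx := add_mem (hf g' x hx) (hf' g' x hx)
  zero_mem' g' _ _ := zero_mem (𝒱 (g + g'))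
  smul_mem' c _ hf g' x hx := Submodule.smul_mem _ c (hf g' x hx)

/-- `B` is a `τ`-sesquilinear nondegenerate form on `V`, homogeneous of some degree `g`. -/
structure IsSesquilinear {D : Type*} [Ring D] [Algebra F D] {V : Type*} [AddCommGroup V]
    [Module F V] [Module Dᵐᵒᵖ V] {G : Type*} [AddCommGroup G]
    (𝒟 : G → Submodule F D) (τ : D →ₗ[F] D) (𝒱 : G → Submodule F V)
    (B : V →ₗ[F] V →ₗ[F] D) : Prop where
  homogeneous : ∃ g, ∀ g₁ g₂, ∀ x ∈ 𝒱 g₁, ∀ y ∈ 𝒱 g₂, B x y ∈ 𝒟 (g₁ + g₂ + g)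
  smul_left : ∀ x y a, B (MulOpposite.op a • x) y = τ a * B x y
  smul_right : ∀ x y a, B x (MulOpposite.op a • y) = B x y * a
  nondegenerate_left : ∀ x, (∀ y, B x y = 0) → x = 0
  nondegenerate_right : ∀ y, (∀ x, B x y = 0) → y = 0

/-- `B` is hermitian or skew-hermitian with respect to `τ`. (In particular it is balanced.) -/
def IsHermitianOrSkew {D : Type*} [Ring D] [Algebra F D] {V : Type*} [AddCommGroup V]
    [Module F V] (τ : D →ₗ[F] D) (B : V →ₗ[F] V →ₗ[F] D) : Prop :=
  (∀ x y, B y x = τ (B x y)) ∨ (∀ x y, B y x = -τ (B x y))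

/-- A realization of an algebra `A` with involution `φ` and grading `𝒜` by the pair
`((D, τ), (d₁, …, d_p))`: an isomorphism of `A` with some `End_D(V)` that turns `𝒜` into the
induced grading and `φ` into the adjoint of a (skew-)hermitian homogeneous form `B` on `V`, with a
homogeneous `D`-basis `v₁, …, v_p, x₁, y₁, …, x_s, y_s` of `V` such that `B(vᵢ, vᵢ) = dᵢ` with
`dᵢ² = 1`, `B(xⱼ, yⱼ) = νⱼ`, `B(yⱼ, xⱼ) = νⱼ⁻¹` for nonzero scalars `νⱼ`, and `B` vanishes on all
other pairs of basis vectors. The vectors `vᵢ`, `xⱼ`, `yⱼ` are indexed by `.inl i`,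
`.inr (.inl j)`, `.inr (.inr j)`. -/
structure Realization {A : Type v} [Ring A] [Algebra F A] {Γ : Type w}
    (φ : A →ₗ[F] A) (𝒜 : Γ → Submodule F A) (P : InvPair F) where
  V : Type u
  [groupV : AddCommGroup V]
  [moduleV : Module F V]
  [rightModuleV : Module P.Dᵐᵒᵖ V]
  [tower : IsScalarTower F P.Dᵐᵒᵖ V]
  grading : P.G → Submodule F V
  isModuleGrading : IsModuleGrading P.comp grading
  B : V →ₗ[F] V →ₗ[F] P.D
  sesquilinear : IsSesquilinear P.comp P.τ grading B
  hermitian : IsHermitianOrSkew P.τ B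
  iso : A ≃ₐ[F] Module.End P.Dᵐᵒᵖ V
  iso_graded : IsGradedIso 𝒜 (inducedGrading grading) iso
  iso_adjoint : ∀ r x y, B (iso r x) y = B x (iso (φ r) y)
  s : ℕ
  basis : Module.Basis (Fin P.p ⊕ (Fin s ⊕ Fin s)) P.Dᵐᵒᵖ V
  basis_homogeneous : ∀ i, ∃ g, basis i ∈ grading g
  ν : Fin s → F
  ν_ne_zero : ∀ j, ν j ≠ 0
  d_sq : ∀ i, P.d i * P.d i = 1
  form_diag : ∀ i, B (basis (.inl i)) (basis (.inl i)) = P.d i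
  form_xy : ∀ j, B (basis (.inr (.inl j))) (basis (.inr (.inr j))) = algebraMap F P.D (ν j)
  form_yx : ∀ j, B (basis (.inr (.inr j))) (basis (.inr (.inl j))) = algebraMap F P.D (ν j)⁻¹
  form_inl_inl : ∀ i i', i ≠ i' → B (basis (.inl i)) (basis (.inl i')) = 0
  form_inl_inr : ∀ i j, B (basis (.inl i)) (basis (.inr j)) = 0
  form_inr_inl : ∀ i j, B (basis (.inr j)) (basis (.inl i)) = 0
  form_xx : ∀ j j', B (basis (.inr (.inl j))) (basis (.inr (.inl j'))) = 0
  form_yy : ∀ j j', B (basis (.inr (.inr j))) (basis (.inr (.inr j'))) = 0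
  form_xy_ne : ∀ j j', j ≠ j' → B (basis (.inr (.inl j))) (basis (.inr (.inr j'))) = 0
  form_yx_ne : ∀ j j', j ≠ j' → B (basis (.inr (.inr j))) (basis (.inr (.inl j'))) = 0

/-- `c` is a value of the invariant `I₂(A, φ, 𝒜)`: the class `[(D, τ), (d₁, …, d_p)]` of a pair
that realizes `(A, φ, 𝒜)`. -/
def invariantValues {A : Type v} [Ring A] [Algebra F A] {Γ : Type w}
    (φ : A →ₗ[F] A) (𝒜 : Γ → Submodule F A) : Set (PairClass F) :=
  {c | ∃ P : InvPair F, Nonempty (Realization φ 𝒜 P) ∧ c = Quotient.mk _ P}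

end Invariant

end GradedInvolutions

set_option linter.unusedSectionVars false

/-! This is Wedderburn theory for graded algebras with involution. Over an algebraically closed
field the components of a graded division algebra `D` have dimension at most one. A graded
involution therefore acts on each by a sign, homogeneous elements commute up to sign, and their
squares are scalars (`exists_mul_self_eq`).

Existence (`exists_realization`). For a minimal idempotent `e` of degree 0, put `D = eAe` and `V =
Ae`. The trace form of the regular representation shows that nonzero homogeneous elements between
minimal idempotents are invertible. An invertible homogeneous `w ∈ eAφ(e)` gives the involution `a ↦
wφ(a)w⁻¹` of `D`, with `w⁻¹` the inverse between the two idempotents, and the form `(x, y) ↦ wφ(x)y`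
on `V`. A homogeneous orthogonal family of maximal length is the required basis
(`exists_orthogonal_basis`).

Uniqueness (`Realization.equivalent`). Two realizations differ by a semilinear bijection `ψ`. It
multiplies the form by a homogeneous factor `z`, since both forms have the same adjoint. The tuples
can be compared only because the grading is fine. Any other grading of `V` making `B` and the basis
homogeneous can be intersected with the given one, and fineness forbids a proper refinement
(`exists_inducedGrading_le`). Hence the only homogeneous vectors are multiples of basis vectors
(`exists_eq_smul_basis`), so `ψ` permutes the lines `vᵢD` among themselves and `Φ(z dᵢ)` is a scalar
multiple of some `d'ⱼ`. Invariance under isomorphism follows, because a realization can be composed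
with a graded isomorphism.

Converse (`exists_isGradedIso_of_equivalent`). An equivalence of pairs gives a bijection of bases,
which rescaling turns into a similitude, except that the form may acquire a sign on the hyperbolic
planes (`exists_similitude`). A vector `vᵢ` fixes this sign. If there is none, a wrong sign would
twist `φ₁` by an element `v` with `v² = 1` and `φ₁(v) = -v`. That reverses the trace of the
involution, which is `n` or `-n` according to its type, so equality of types excludes it. A
similitude preserves the gradings, again by fineness. -/

namespace GradedInvolutions

/-! ### Gradings and graded division algebras with involution -/

section Basic

variable {F : Type*} [Field F]

theorem isInternal_iff {M : Type*} [AddCommGroup M] [Module F M] {G : Type*} [DecidableEq G]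
    {𝒱 : G → Submodule F M} : DirectSum.IsInternal 𝒱 ↔ iSupIndep 𝒱 ∧ iSup 𝒱 = ⊤ :=
  DirectSum.isInternal_submodule_iff_iSupIndep_and_iSup_eq_top 𝒱

theorem isGrading_iff {A : Type*} [Ring A] [Algebra F A] {G : Type*} [AddCommGroup G]
    {𝒜 : G → Submodule F A} :
    IsGrading 𝒜 ↔ (iSupIndep 𝒜 ∧ iSup 𝒜 = ⊤) ∧ SetLike.GradedMonoid 𝒜 := by
  classical
  rw [← isInternal_iff]
  unfold IsGrading
  convert Iff.rfl

theorem isModuleGrading_iff {D : Type*} [Ring D] [Algebra F D] {V : Type*} [AddCommGroup V]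
    [Module F V] [Module Dᵐᵒᵖ V] {G : Type*} [AddCommGroup G]
    {𝒟 : G → Submodule F D} {𝒱 : G → Submodule F V} :
    IsModuleGrading 𝒟 𝒱 ↔ (iSupIndep 𝒱 ∧ iSup 𝒱 = ⊤) ∧
      ∀ g h, ∀ x ∈ 𝒱 g, ∀ a ∈ 𝒟 h, MulOpposite.op a • x ∈ 𝒱 (g + h) := by
  classical
  rw [← isInternal_iff]
  unfold IsModuleGrading
  convert Iff.rfl

section Family

variable {M : Type*} [AddCommGroup M] [Module F M] {G : Type*} {𝒱 : G → Submodule F M}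

theorem eq_of_mem_of_mem (h : iSupIndep 𝒱) {x : M} (hx : x ≠ 0) {g g' : G} (hg : x ∈ 𝒱 g)
    (hg' : x ∈ 𝒱 g') : g = g' := by
  by_contra hne
  exact hx (Submodule.disjoint_def.1 (h.pairwiseDisjoint hne) x hg hg')

theorem iSupIndep_of_proj (π : G → M →ₗ[F] M) (h₁ : ∀ g, ∀ x ∈ 𝒱 g, π g x = x)
    (h₂ : ∀ g g', g ≠ g' → ∀ x ∈ 𝒱 g, π g' x = 0) : iSupIndep 𝒱 := by
  intro g
  rw [Submodule.disjoint_def]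
  intro x hx hx'
  have : (⨆ (j) (_ : j ≠ g), 𝒱 j) ≤ LinearMap.ker (π g) :=
    iSup₂_le fun j hj y hy => h₂ j g hj y hy
  rw [← h₁ g x hx]
  exact this hx'

/-- The common refinement of two families is independent if the families are. -/
theorem iSupIndep_inf {K : Type*} {𝒲 : K → Submodule F M} (h : iSupIndep 𝒱) (h' : iSupIndep 𝒲) :
    iSupIndep fun i : G × K => 𝒱 i.1 ⊓ 𝒲 i.2 := by
  rintro ⟨g, k⟩
  rw [Submodule.disjoint_def]
  rintro x ⟨hx1, hx2⟩ hx'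
  simp only at hx1 hx2
  have hle : (⨆ (j : G × K) (_ : j ≠ (g, k)), 𝒱 j.1 ⊓ 𝒲 j.2) ≤
      (⨆ (j) (_ : j ≠ g), 𝒱 j) ⊔ (𝒱 g ⊓ ⨆ (j) (_ : j ≠ k), 𝒲 j) := by
    refine iSup₂_le ?_
    rintro ⟨g', k'⟩ hne
    by_cases hg : g' = g
    · subst hg
      have hk : k' ≠ k := fun hk => hne (by rw [hk])
      exact le_sup_of_le_right (inf_le_inf le_rfl (le_iSup₂_of_le k' hk le_rfl))
    · exact le_sup_of_le_left (inf_le_left.trans (le_iSup₂_of_le g' hg le_rfl))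
  obtain ⟨y, hy, z, hz, rfl⟩ := Submodule.mem_sup.1 (hle hx')
  have hy0 : y = 0 := by
    refine Submodule.disjoint_def.1 (h g) y ?_ hy
    have := sub_mem hx1 hz.1
    simpa using this
  subst hy0
  rw [zero_add] at hx2 ⊢
  exact Submodule.disjoint_def.1 (h' k) z hx2 hz.2

end Family

section Division

variable {D : Type*} [Ring D] [Algebra F D] {G : Type*} [AddCommGroup G] {𝒟 : G → Submodule F D}

theorem IsGrading.one_mem (h : IsGrading 𝒟) : (1 : D) ∈ 𝒟 0 :=
  have := h.2
  SetLike.GradedOne.one_mem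

theorem IsGrading.mul_mem (h : IsGrading 𝒟) {x y : D} {s t : G} (hx : x ∈ 𝒟 s) (hy : y ∈ 𝒟 t) :
    x * y ∈ 𝒟 (s + t) :=
  have := h.2
  SetLike.GradedMul.mul_mem hx hy

theorem IsGrading.algebraMap_mem (h : IsGrading 𝒟) (c : F) : algebraMap F D c ∈ 𝒟 0 := by
  rw [Algebra.algebraMap_eq_smul_one]
  exact Submodule.smul_mem _ _ h.one_mem

theorem IsGrading.indep (h : IsGrading 𝒟) : iSupIndep 𝒟 := (isGrading_iff.1 h).1.1

theorem IsGrading.iSup_eq (h : IsGrading 𝒟) : iSup 𝒟 = ⊤ := (isGrading_iff.1 h).1.2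

theorem IsGrading.inv_mem [Nontrivial D] (h : IsGrading 𝒟) (z : Dˣ) {t : G} (hz : (z : D) ∈ 𝒟 t) :
    ((z⁻¹ : Dˣ) : D) ∈ 𝒟 (-t) := by
  obtain ⟨k, hk⟩ := InvPair.exists_inv_mem h z hz
  have h1 := h.mul_mem hz hk
  rw [Units.mul_inv] at h1
  have h2 := eq_of_mem_of_mem h.indep one_ne_zero h1 h.one_mem
  rwa [← eq_neg_of_add_eq_zero_right h2]

/-- The common refinement of two gradings is a grading, as soon as it spans. -/
theorem isGrading_inf {K : Type*} [AddCommGroup K] {𝒟' : K → Submodule F D} (h : IsGrading 𝒟)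
    (h' : IsGrading 𝒟') (htop : ⨆ i : G × K, 𝒟 i.1 ⊓ 𝒟' i.2 = ⊤) :
    IsGrading fun i : G × K => 𝒟 i.1 ⊓ 𝒟' i.2 := by
  refine isGrading_iff.2 ⟨⟨iSupIndep_inf h.indep h'.indep, htop⟩, ?_⟩
  exact
    { one_mem := ⟨h.one_mem, h'.one_mem⟩
      mul_mem := fun _ _ _ _ hx hy => ⟨h.mul_mem hx.1 hy.1, h'.mul_mem hx.2 hy.2⟩ }

namespace IsCentralGradedDivision

variable (hD : IsCentralGradedDivision 𝒟)
include hD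

/-- The difference of `x` and one of its eigenvalues is homogeneous and not invertible, hence zero.
-/
theorem exists_algebraMap_eq [IsAlgClosed F] {x : D} (hx : x ∈ 𝒟 0) :
    ∃ c, x = algebraMap F D c := by
  have := hD.finiteDimensional
  have := hD.nontrivial
  obtain ⟨c, hc⟩ := spectrum.nonempty_of_isAlgClosed_of_finiteDimensional F x
  refine ⟨c, ?_⟩
  by_contra hne
  exact hc (hD.isUnit 0 _ (sub_mem (hD.isGrading.algebraMap_mem c) hx) (sub_ne_zero.2 (Ne.symm hne)))

theorem exists_smul_eq [IsAlgClosed F] {x y : D} {t : G} (hx : x ∈ 𝒟 t) (hx0 : x ≠ 0)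
    (hy : y ∈ 𝒟 t) : ∃ c : F, y = c • x := by
  have := hD.nontrivial
  obtain ⟨u, rfl⟩ := hD.isUnit t x hx hx0
  have h1 := hD.isGrading.mul_mem hy (hD.isGrading.inv_mem u hx)
  rw [add_neg_cancel] at h1
  obtain ⟨c, hc⟩ := hD.exists_algebraMap_eq h1
  exact ⟨c, by rw [Algebra.smul_def, ← hc, mul_assoc, Units.inv_mul, mul_one]⟩

variable {τ : D →ₗ[F] D}

theorem map_eq_or_neg [IsAlgClosed F] (hτ : IsInvolution τ) (hgr : ∀ g, (𝒟 g).map τ = 𝒟 g)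
    {x : D} {t : G} (hx : x ∈ 𝒟 t) : τ x = x ∨ τ x = -x := by
  by_cases hx0 : x = 0
  · simp [hx0]
  have hτx : τ x ∈ 𝒟 t := hgr t ▸ Submodule.mem_map_of_mem hx
  obtain ⟨c, hc⟩ := hD.exists_smul_eq hx hx0 hτx
  have h1 := hτ.invol x
  rw [hc, map_smul, hc, smul_smul] at h1
  have h2 : (c * c - 1) • x = 0 := by rw [sub_smul, h1, one_smul, sub_self]
  have h3 : c * c - 1 = 0 := (smul_eq_zero.1 h2).resolve_right hx0
  rcases mul_self_eq_one_iff.1 (sub_eq_zero.1 h3) with h | h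
  · left; rw [hc, h, one_smul]
  · right; rw [hc, h, neg_smul, one_smul]

/-- The elements `x`, `y` and `xy` are eigenvectors of `τ` with eigenvalues `±1`, so the
antimultiplicativity of `τ` becomes a relation between `xy` and `yx`. -/
theorem mul_eq_or_neg [IsAlgClosed F] (hτ : IsInvolution τ) (hgr : ∀ g, (𝒟 g).map τ = 𝒟 g)
    {x y : D} {s t : G} (hx : x ∈ 𝒟 s) (hy : y ∈ 𝒟 t) : x * y = y * x ∨ x * y = -(y * x) := by
  have h := hτ.map_mul x y
  rcases hD.map_eq_or_neg hτ hgr hx with h1 | h1 <;>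
    rcases hD.map_eq_or_neg hτ hgr hy with h2 | h2 <;>
      rcases hD.map_eq_or_neg hτ hgr (hD.isGrading.mul_mem hx hy) with h3 | h3 <;>
        rw [h1, h2, h3] at h
  all_goals
    first
    | (left; simpa using h)
    | (right; simpa using h)
    | (right; rw [← neg_eq_iff_eq_neg]; simpa using h)

/-- Moving `x²` past a homogeneous element produces the same sign twice. Hence `x²` is central, and
the centre consists of scalars. -/
theorem exists_mul_self_eq [IsAlgClosed F] (hτ : IsInvolution τ) (hgr : ∀ g, (𝒟 g).map τ = 𝒟 g)
    {x : D} {s : G} (hx : x ∈ 𝒟 s) (hx0 : x ≠ 0) : ∃ c : F, c ≠ 0 ∧ x * x = algebraMap F D c := by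
  have := hD.nontrivial
  have hcomm : ∀ y, y * (x * x) = x * x * y := by
    intro y
    have hy : y ∈ iSup 𝒟 := by rw [hD.isGrading.iSup_eq]; trivial
    induction hy using Submodule.iSup_induction' with
    | mem t y hy =>
      rcases hD.mul_eq_or_neg hτ hgr hx hy with h | h
      · rw [mul_assoc x x y, h, ← mul_assoc x y x, h, mul_assoc]
      · rw [mul_assoc x x y, h, mul_neg, ← mul_assoc x y x, h, neg_mul, neg_neg, mul_assoc]
    | zero => simp
    | add y z _ _ hy hz => rw [add_mul, mul_add, hy, hz]
  have hmem : x * x ∈ Subalgebra.center F D := Subalgebra.mem_center_iff.2 hcomm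
  obtain ⟨c, hc⟩ := Algebra.mem_bot.1 (hD.central.out hmem)
  refine ⟨c, ?_, hc.symm⟩
  rintro rfl
  obtain ⟨u, rfl⟩ := hD.isUnit s x hx hx0
  rw [map_zero] at hc
  exact (u * u).ne_zero (by rw [Units.val_mul, ← hc])

end IsCentralGradedDivision

end Division

end Basic

open MulOpposite

/-! ### Transport of gradings along isomorphisms -/

section Transport

variable {F : Type*} [Field F] {A A' : Type*} [Ring A] [Algebra F A] [Ring A'] [Algebra F A']
  {G : Type*} [AddCommGroup G]

theorem iSupIndep_comap {M M' : Type*} [AddCommGroup M] [Module F M] [AddCommGroup M']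
    [Module F M'] {ι : Type*} {𝒱 : ι → Submodule F M'} (h : iSupIndep 𝒱 ∧ iSup 𝒱 = ⊤)
    (e : M ≃ₗ[F] M') : iSupIndep (fun i => (𝒱 i).comap e.toLinearMap) ∧
      ⨆ i, (𝒱 i).comap e.toLinearMap = ⊤ := by
  have h1 : ∀ i, (𝒱 i).comap e.toLinearMap = (Submodule.orderIsoMapComap e).symm (𝒱 i) :=
    fun i => rfl
  simp only [h1]
  refine ⟨h.1.map_orderIso _, ?_⟩
  rw [← OrderIso.map_iSup, h.2, OrderIso.map_top]

theorem IsGrading.comap {𝒜 : G → Submodule F A'} (h : IsGrading 𝒜) (e : A ≃ₐ[F] A') :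
    IsGrading fun g => (𝒜 g).comap e.toLinearMap := by
  refine isGrading_iff.2 ⟨iSupIndep_comap (isGrading_iff.1 h).1 e.toLinearEquiv, ?_⟩
  exact
    { one_mem := by simpa using h.one_mem
      mul_mem := fun _ _ x y hx hy => by
        have := h.mul_mem hx hy
        simpa using this }

/-- Inclusions in both directions suffice: a nonzero element of a component returns to a component
that it shares with the original one, and components are independent. -/
theorem isGradedIso_of_le {G' : Type*} [AddCommGroup G'] {𝒜 : G → Submodule F A}
    {ℬ : G' → Submodule F A'} (h𝒜 : IsGrading 𝒜) {e : A ≃ₐ[F] A'}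
    (h : ∀ g, 𝒜 g ≠ ⊥ → ∃ k, ∀ x ∈ 𝒜 g, e x ∈ ℬ k)
    (h' : ∀ k, ℬ k ≠ ⊥ → ∃ g, ∀ x ∈ ℬ k, e.symm x ∈ 𝒜 g) : IsGradedIso 𝒜 ℬ e := by
  intro g hg
  obtain ⟨k, hk⟩ := h g hg
  obtain ⟨x, hx, hx0⟩ := Submodule.exists_mem_ne_zero_of_ne_bot hg
  have hex0 : e x ≠ 0 := fun h => hx0 (e.injective (by rw [h, map_zero]))
  obtain ⟨g', hg'⟩ := h' k (fun hb => hex0 ((Submodule.eq_bot_iff _).1 hb _ (hk x hx)))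
  have hgg' : g = g' := eq_of_mem_of_mem h𝒜.indep hx0 hx (by simpa using hg' _ (hk x hx))
  subst hgg'
  refine ⟨k, le_antisymm ?_ ?_⟩
  · rintro _ ⟨y, hy, rfl⟩
    exact hk y hy
  · intro y hy
    exact ⟨e.symm y, hg' y hy, by simp⟩

end Transport

/-! ### Rank one operators, dual families and induced gradings -/

section Forms

variable {F : Type*} [Field F] {D : Type*} [Ring D] [Algebra F D] {V : Type*} [AddCommGroup V]
  [Module F V] [Module Dᵐᵒᵖ V] [IsScalarTower F Dᵐᵒᵖ V] {G : Type*} [AddCommGroup G]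
  {𝒟 : G → Submodule F D} {τ : D →ₗ[F] D} {𝒱 : G → Submodule F V} {B : V →ₗ[F] V →ₗ[F] D}

theorem op_algebraMap_smul (c : F) (x : V) : op (algebraMap F D c) • x = c • x := by
  rw [Algebra.algebraMap_eq_smul_one, op_smul, op_one, smul_assoc, one_smul]

/-- The operator `v ↦ x B(y, v)` of rank one. -/
def rankOne (hB : ∀ x y a, B x (op a • y) = B x y * a) (x y : V) : Module.End Dᵐᵒᵖ V where
  toFun v := op (B y v) • x
  map_add' v w := by rw [map_add, op_add, add_smul]
  map_smul' a v := by
    rw [← op_unop a, hB, op_mul, mul_smul]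
    rfl

theorem rankOne_apply (hB : ∀ x y a, B x (op a • y) = B x y * a) (x y v : V) :
    rankOne hB x y v = op (B y v) • x := rfl

theorem rankOne_add_left (hB : ∀ x y a, B x (op a • y) = B x y * a) (x x' y : V) :
    rankOne hB (x + x') y = rankOne hB x y + rankOne hB x' y := by
  ext v
  simp [rankOne_apply]

theorem rankOne_smul_left (hB : ∀ x y a, B x (op a • y) = B x y * a) (c : F) (x y : V) :
    rankOne hB (c • x) y = c • rankOne hB x y := by
  have := IsScalarTower.to_smulCommClass' (R := F) (A := Dᵐᵒᵖ) (M := V)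
  ext v
  simp only [rankOne_apply, LinearMap.smul_apply]
  rw [smul_comm]

theorem mul_rankOne (hB : ∀ x y a, B x (op a • y) = B x y * a) (f : Module.End Dᵐᵒᵖ V) (x y : V) :
    f * rankOne hB x y = rankOne hB (f x) y := by
  ext v
  simp [rankOne_apply]

theorem IsSesquilinear.exists_degree (hB : IsSesquilinear 𝒟 τ 𝒱 B) :
    ∃ γ, ∀ g₁ g₂, ∀ x ∈ 𝒱 g₁, ∀ y ∈ 𝒱 g₂, B x y ∈ 𝒟 (g₁ + g₂ + γ) := hB.homogeneous

theorem IsModuleGrading.smul_mem (h : IsModuleGrading 𝒟 𝒱) {g t : G} {x : V} {a : D}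
    (hx : x ∈ 𝒱 g) (ha : a ∈ 𝒟 t) : op a • x ∈ 𝒱 (g + t) := h.2 g t x hx a ha

theorem IsModuleGrading.indep (h : IsModuleGrading 𝒟 𝒱) : iSupIndep 𝒱 :=
  (isModuleGrading_iff.1 h).1.1

theorem IsModuleGrading.iSup_eq (h : IsModuleGrading 𝒟 𝒱) : iSup 𝒱 = ⊤ :=
  (isModuleGrading_iff.1 h).1.2

theorem rankOne_mem_of_degree (hB : ∀ x y a, B x (op a • y) = B x y * a)
    (h𝒱 : IsModuleGrading 𝒟 𝒱) {γ : G}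
    (hγ : ∀ g₁ g₂, ∀ x ∈ 𝒱 g₁, ∀ y ∈ 𝒱 g₂, B x y ∈ 𝒟 (g₁ + g₂ + γ)) {x y : V} {g h : G}
    (hx : x ∈ 𝒱 g) (hy : y ∈ 𝒱 h) :
    rankOne hB x y ∈ inducedGrading (D := D) 𝒱 (g + h + γ) := by
  intro g' v hv
  have h1 := h𝒱.smul_mem hx (hγ _ _ _ hy _ hv)
  rwa [show g + (h + g' + γ) = g + h + γ + g' by abel] at h1

theorem rankOne_mem (hB : IsSesquilinear 𝒟 τ 𝒱 B) (h𝒱 : IsModuleGrading 𝒟 𝒱) {x y : V} {g h : G}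
    (hx : x ∈ 𝒱 g) (hy : y ∈ 𝒱 h) :
    ∃ k, rankOne hB.smul_right x y ∈ inducedGrading (D := D) 𝒱 k := by
  obtain ⟨γ, hγ⟩ := hB.exists_degree
  exact ⟨g + h + γ, rankOne_mem_of_degree hB.smul_right h𝒱 hγ hx hy⟩

theorem iSupIndep_inducedGrading (h𝒱 : iSupIndep 𝒱 ∧ iSup 𝒱 = ⊤) :
    iSupIndep (inducedGrading (D := D) 𝒱) := by
  have := IsScalarTower.to_smulCommClass' (R := F) (A := Dᵐᵒᵖ) (M := V)
  intro h
  rw [Submodule.disjoint_def]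
  intro f hf hf'
  have hzero : ∀ g, ∀ x ∈ 𝒱 g, f x = 0 := by
    intro g x hx
    refine Submodule.disjoint_def.1 (h𝒱.1 (h + g)) _ (hf g x hx) ?_
    let ev : Module.End Dᵐᵒᵖ V →ₗ[F] V :=
      { toFun := fun f => f x
        map_add' := fun _ _ => rfl
        map_smul' := fun _ _ => rfl }
    have hle : (⨆ (j) (_ : j ≠ h), inducedGrading (D := D) 𝒱 j) ≤
        (⨆ (j) (_ : j ≠ h + g), 𝒱 j).comap ev := by
      refine iSup₂_le fun j hj f' hf' => ?_
      exact Submodule.mem_iSup_of_mem (j + g)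
        (Submodule.mem_iSup_of_mem (fun hh => hj (add_right_cancel hh)) (hf' g x hx))
    exact hle hf'
  ext x
  have hx : x ∈ iSup 𝒱 := by rw [h𝒱.2]; trivial
  induction hx using Submodule.iSup_induction' with
  | mem g x hx => exact hzero g x hx
  | zero => simp
  | add x y _ _ hx hy => rw [map_add, hx, hy, map_add]

variable {ι : Type*} [Fintype ι]

/-- `b` and `b'` are dual families of `V` with respect to `B`, and the vectors of `b'` are
homogeneous multiples of vectors of `b`. -/
structure IsFrame (𝒟 : G → Submodule F D) (B : V →ₗ[F] V →ₗ[F] D) (b b' : ι → V) : Prop where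
  expand : ∀ x, ∑ i, op (B (b' i) x) • b i = x
  form_one : ∀ i, B (b' i) (b i) = 1
  dual : ∀ i, ∃ j t, ∃ a ∈ 𝒟 t, b' i = op a • b j

variable {b b' : ι → V}

theorem IsFrame.sum_rankOne (hf : IsFrame 𝒟 B b b') (hB : ∀ x y a, B x (op a • y) = B x y * a)
    (f : Module.End Dᵐᵒᵖ V) : f = ∑ i, rankOne hB (f (b i)) (b' i) := by
  ext v
  rw [LinearMap.sum_apply]
  conv_lhs => rw [← hf.expand v, map_sum]
  simp [rankOne_apply]

/-- The degree of `b' i` is forced by `B (b' i) (b i) = 1`, an element of degree 0. -/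
theorem IsFrame.degree [Nontrivial D] (hf : IsFrame 𝒟 B b b') (h𝒟 : IsGrading 𝒟)
    (h𝒱 : IsModuleGrading 𝒟 𝒱) {γ : G}
    (hγ : ∀ g₁ g₂, ∀ x ∈ 𝒱 g₁, ∀ y ∈ 𝒱 g₂, B x y ∈ 𝒟 (g₁ + g₂ + γ))
    (hb : ∀ i, ∃ g, b i ∈ 𝒱 g) (i : ι) : ∃ g, b i ∈ 𝒱 g ∧ b' i ∈ 𝒱 (-g - γ) := by
  obtain ⟨g, hg⟩ := hb i
  obtain ⟨j, t, a, ha, hab⟩ := hf.dual i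
  obtain ⟨g', hg'⟩ := hb j
  have h1 := h𝒱.smul_mem hg' ha
  rw [← hab] at h1
  have h2 := hγ _ _ _ h1 _ hg
  rw [hf.form_one i] at h2
  have h3 := eq_of_mem_of_mem h𝒟.indep one_ne_zero h2 h𝒟.one_mem
  refine ⟨g, hg, ?_⟩
  have h4 : g' + t = -g - γ := by
    rw [eq_sub_iff_add_eq, eq_neg_iff_add_eq_zero, ← h3]
    abel
  rwa [← h4]

theorem IsFrame.mem_inducedGrading {K : Type*} [AddCommGroup K] {𝒟' : K → Submodule F D}
    {𝒱' : K → Submodule F V} (hf : IsFrame 𝒟 B b b') (h𝒱 : IsModuleGrading 𝒟' 𝒱') {γ : K}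
    (hγ : ∀ g₁ g₂, ∀ x ∈ 𝒱' g₁, ∀ y ∈ 𝒱' g₂, B x y ∈ 𝒟' (g₁ + g₂ + γ))
    {f : Module.End Dᵐᵒᵖ V} {k : K}
    (h : ∀ i, ∃ g, b i ∈ 𝒱' g ∧ b' i ∈ 𝒱' (-g - γ) ∧ f (b i) ∈ 𝒱' (k + g)) :
    f ∈ inducedGrading (D := D) 𝒱' k := by
  intro g x hx
  have hfx : f x = ∑ i, op (B (b' i) x) • f (b i) := by
    conv_lhs => rw [← hf.expand x]
    simp
  rw [hfx]
  refine sum_mem fun i _ => ?_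
  obtain ⟨m, -, hm', hm⟩ := h i
  have h1 := h𝒱.smul_mem hm (hγ _ _ _ hm' _ hx)
  rwa [show k + m + (-m - γ + g + γ) = k + g by abel] at h1

theorem isGrading_induced (hf : IsFrame 𝒟 B b b') (hB : IsSesquilinear 𝒟 τ 𝒱 B)
    (h𝒱 : IsModuleGrading 𝒟 𝒱) (hb' : ∀ i, ∃ g, b' i ∈ 𝒱 g) :
    IsGrading (inducedGrading (D := D) 𝒱) := by
  refine isGrading_iff.2 ⟨⟨iSupIndep_inducedGrading (isModuleGrading_iff.1 h𝒱).1, ?_⟩, ?_⟩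
  · rw [eq_top_iff]
    rintro f -
    rw [hf.sum_rankOne hB.smul_right f]
    refine sum_mem fun i _ => ?_
    obtain ⟨g, hg⟩ := hb' i
    have hx : f (b i) ∈ iSup 𝒱 := by rw [h𝒱.iSup_eq]; trivial
    generalize f (b i) = x at hx
    induction hx using Submodule.iSup_induction' with
    | mem g' x hx =>
      obtain ⟨k, hk⟩ := rankOne_mem hB h𝒱 hx hg
      exact Submodule.mem_iSup_of_mem k hk
    | zero =>
      convert! Submodule.zero_mem _
      ext v
      simp [rankOne_apply]
    | add x y _ _ hx hy =>
      rw [rankOne_add_left]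
      exact add_mem hx hy
  · exact
      { one_mem := fun g' x hx => by simpa using hx
        mul_mem := fun k l f f' hf hf' g' x hx => by
          have := hf _ _ (hf' _ _ hx)
          rw [Module.End.mul_apply]
          rwa [add_assoc] }

/-- The coordinates of `φ(r)y` are `B(b'ᵢ, φ(r)y) = B(r b'ᵢ, y)`, so their degrees are determined by
that of `r`. Thus `φ` preserves the induced components. -/
theorem isPhiGrading_induced [Nontrivial D] {A : Type*} [Ring A] [Algebra F A] {φ : A →ₗ[F] A}
    (hφ : IsInvolution φ)
    {iso : A ≃ₐ[F] Module.End Dᵐᵒᵖ V} (hadj : ∀ r x y, B (iso r x) y = B x (iso (φ r) y))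
    (hf : IsFrame 𝒟 B b b') (hB : IsSesquilinear 𝒟 τ 𝒱 B) (h𝒟 : IsGrading 𝒟)
    (h𝒱 : IsModuleGrading 𝒟 𝒱) (hb : ∀ i, ∃ g, b i ∈ 𝒱 g) :
    IsPhiGrading φ fun g => (inducedGrading (D := D) 𝒱 g).comap iso.toLinearMap := by
  obtain ⟨γ, hγ⟩ := hB.exists_degree
  have hdeg := hf.degree h𝒟 h𝒱 hγ hb
  have hφmem : ∀ g r, iso r ∈ inducedGrading (D := D) 𝒱 g →
      iso (φ r) ∈ inducedGrading (D := D) 𝒱 g := by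
    intro g r hr g' y hy
    rw [← hf.expand (iso (φ r) y)]
    refine sum_mem fun i _ => ?_
    rw [← hadj]
    obtain ⟨k, hk, hk'⟩ := hdeg i
    have h1 := h𝒱.smul_mem hk (hγ _ _ _ (hr _ _ hk') _ hy)
    rwa [show k + (g + (-k - γ) + g' + γ) = g + g' by abel] at h1
  refine ⟨(isGrading_induced hf hB h𝒱 fun i => ?_).comap iso, fun g => ?_, fun g => ?_, ?_⟩
  · obtain ⟨k, -, hk⟩ := hdeg i
    exact ⟨_, hk⟩
  · refine le_antisymm ?_ ?_
    · rintro _ ⟨r, hr, rfl⟩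
      exact hφmem g r hr
    · intro r hr
      exact ⟨φ r, hφmem g r hr, hφ.invol r⟩
  · exact ⟨1, one_ne_zero, fun x _ => by rw [hφ.invol, one_smul]⟩
  · exact fun x _ => hφ.invol x

/-- A grading of `End_D(V)` that is induced from `V` and fine is a refinement of any grading induced
from `V` for which `B` and the vectors of the frame are homogeneous. -/
theorem exists_inducedGrading_le {A : Type*} [Ring A] [Algebra F A] {φ : A →ₗ[F] A}
    (hφ : IsInvolution φ) {Γ : Type*} [AddCommGroup Γ] {𝒜 : Γ → Submodule F A}
    (hfine : IsFinePhiGrading φ 𝒜)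
    {G K : Type} [AddCommGroup G] [AddCommGroup K]
    {𝒟 : G → Submodule F D} {𝒱 : G → Submodule F V} {𝒟' : K → Submodule F D}
    {𝒱' : K → Submodule F V} {iso : A ≃ₐ[F] Module.End Dᵐᵒᵖ V}
    (hiso : IsGradedIso 𝒜 (inducedGrading (D := D) 𝒱) iso)
    (hadj : ∀ r x y, B (iso r x) y = B x (iso (φ r) y)) [Nontrivial D]
    (hf : IsFrame 𝒟 B b b') (hB : IsSesquilinear 𝒟 τ 𝒱 B) (h𝒟 : IsGrading 𝒟)
    (h𝒱 : IsModuleGrading 𝒟 𝒱) (hb : ∀ i, ∃ g, b i ∈ 𝒱 g)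
    (hB' : IsSesquilinear 𝒟' τ 𝒱' B) (h𝒟' : IsGrading 𝒟')
    (h𝒱' : IsModuleGrading 𝒟' 𝒱') (hb' : ∀ i, ∃ k, b i ∈ 𝒱' k)
    (hle : ∀ t, ∃ k, 𝒟 t ≤ 𝒟' k) {g : G} (hg : inducedGrading (D := D) 𝒱 g ≠ ⊥) :
    ∃ k, inducedGrading (D := D) 𝒱 g ≤ inducedGrading (D := D) 𝒱' k := by
  obtain ⟨γ, hγ⟩ := hB.exists_degree
  obtain ⟨γ', hγ'⟩ := hB'.exists_degree
  have hdual : ∀ i, ∃ g, b' i ∈ 𝒱 g := fun i => by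
    obtain ⟨g, -, hg⟩ := hf.degree h𝒟 h𝒱 hγ hb i
    exact ⟨_, hg⟩
  -- The common refinements of the two gradings of `D` and of `V`, both graded by the product group.
  -- They satisfy the same hypotheses, so they induce a `φ`-grading of `A`.
  let 𝒟'' : G × K → Submodule F D := fun i => 𝒟 i.1 ⊓ 𝒟' i.2
  let 𝒱'' : G × K → Submodule F V := fun i => 𝒱 i.1 ⊓ 𝒱' i.2
  have hD'' : ∀ t, ∃ i, 𝒟 t ≤ 𝒟'' i := fun t => by
    obtain ⟨k, hk⟩ := hle t
    exact ⟨(t, k), le_inf le_rfl hk⟩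
  have h𝒟'' : IsGrading 𝒟'' := by
    refine isGrading_inf h𝒟 h𝒟' ?_
    rw [eq_top_iff, ← h𝒟.iSup_eq]
    refine iSup_le fun t => ?_
    obtain ⟨i, hi⟩ := hD'' t
    exact hi.trans (le_iSup 𝒟'' i)
  have hb'' : ∀ i, ∃ j, b i ∈ 𝒱'' j := fun i => by
    obtain ⟨g, hg⟩ := hb i
    obtain ⟨k, hk⟩ := hb' i
    exact ⟨(g, k), hg, hk⟩
  have hsmul : ∀ i j, ∀ x ∈ 𝒱'' i, ∀ a ∈ 𝒟'' j, op a • x ∈ 𝒱'' (i + j) :=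
    fun i j x hx a ha => ⟨h𝒱.smul_mem hx.1 ha.1, h𝒱'.smul_mem hx.2 ha.2⟩
  have h𝒱'' : IsModuleGrading 𝒟'' 𝒱'' := by
    refine isModuleGrading_iff.2 ⟨⟨iSupIndep_inf h𝒱.indep h𝒱'.indep, ?_⟩, hsmul⟩
    rw [eq_top_iff]
    rintro x -
    rw [← hf.expand x]
    refine sum_mem fun i _ => ?_
    obtain ⟨j, hj⟩ := hb'' i
    have hx : B (b' i) x ∈ iSup 𝒟'' := by rw [h𝒟''.iSup_eq]; trivial
    generalize B (b' i) x = a at hx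
    induction hx using Submodule.iSup_induction' with
    | mem t a ha => exact Submodule.mem_iSup_of_mem _ (hsmul _ _ _ hj _ ha)
    | zero => simp
    | add x y _ _ hx hy =>
      rw [op_add, add_smul]
      exact add_mem hx hy
  have hB'' : IsSesquilinear 𝒟'' τ 𝒱'' B :=
    { hB with
      homogeneous := ⟨(γ, γ'), fun i j x hx y hy =>
        ⟨hγ _ _ _ hx.1 _ hy.1, hγ' _ _ _ hx.2 _ hy.2⟩⟩ }
  have hf'' : IsFrame 𝒟'' B b b' :=
    { hf with
      dual := fun i => by
        obtain ⟨j, t, a, ha, hab⟩ := hf.dual i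
        obtain ⟨t', ht'⟩ := hD'' t
        exact ⟨j, t', a, ht' ha, hab⟩ }
  have hphi := isPhiGrading_induced hφ hadj hf'' hB'' h𝒟'' h𝒱'' hb''
  have hdeg' : ∀ i, ∃ k, b i ∈ 𝒱'' k ∧ b' i ∈ 𝒱'' (-k - (γ, γ')) := by
    refine hf''.degree h𝒟'' h𝒱'' ?_ hb''
    exact fun i j x hx y hy => ⟨hγ _ _ _ hx.1 _ hy.1, hγ' _ _ _ hx.2 _ hy.2⟩
  have hmono : ∀ i : G × K, inducedGrading (D := D) 𝒱'' i ≤ inducedGrading (D := D) 𝒱' i.2 := by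
    intro i f hfi
    refine hf.mem_inducedGrading h𝒱' hγ' fun l => ?_
    obtain ⟨m, hm, hm'⟩ := hdeg' l
    exact ⟨m.2, hm.2, hm'.2, (hfi _ _ hm).2⟩
  have hmono₁ : ∀ i : G × K, inducedGrading (D := D) 𝒱'' i ≤ inducedGrading (D := D) 𝒱 i.1 := by
    intro i f hfi
    refine hf.mem_inducedGrading h𝒱 hγ fun l => ?_
    obtain ⟨m, hm, hm'⟩ := hdeg' l
    exact ⟨m.1, hm.1, hm'.1, (hfi _ _ hm).1⟩
  have hind := isGrading_induced hf hB h𝒱 hdual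
  have hsymm := InvPair.isGradedIso_symm hfine.1.isGrading hind hiso
  -- This grading refines `𝒜`, so by fineness `𝒜` refines it in turn; the second coordinate of the
  -- degree is then the required `k`.
  have href := hfine.2 _ _ _ hphi (by
    intro i hi
    obtain ⟨r, hr, hr0⟩ := Submodule.exists_mem_ne_zero_of_ne_bot hi
    have h0 : inducedGrading (D := D) 𝒱 i.1 ≠ ⊥ := by
      intro h0
      have := (Submodule.eq_bot_iff _).1 h0 _ (hmono₁ i hr)
      exact hr0 (iso.injective (by rw [map_zero]; exact this))
    obtain ⟨k, hk⟩ := hsymm _ h0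
    refine ⟨k, fun r' hr' => ?_⟩
    rw [← hk]
    exact ⟨iso r', hmono₁ i hr', by simp⟩)
  obtain ⟨k, hk⟩ := hsymm g hg
  have hk0 : 𝒜 k ≠ ⊥ := by
    rw [← hk]
    obtain ⟨r, hr, hr0⟩ := Submodule.exists_mem_ne_zero_of_ne_bot hg
    intro h0
    have := (Submodule.eq_bot_iff _).1 h0 _ (Submodule.mem_map_of_mem hr)
    exact hr0 (iso.symm.injective (by rw [map_zero]; exact this))
  obtain ⟨i, hi⟩ := href k hk0
  refine ⟨i.2, fun f hfg => hmono i ?_⟩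
  have h1 : iso.symm f ∈ 𝒜 k := by
    rw [← hk]
    exact ⟨f, hfg, rfl⟩
  simpa using hi h1

end Forms

attribute [instance] Realization.groupV Realization.moduleV Realization.rightModuleV
  Realization.tower

/-! ### What fineness says about the distinguished basis -/

section Weights

/-- The weights are degrees of basis vectors for which a form pairing `l` with `σ l` is homogeneous
of degree 0. A fixed point of `σ` must have a weight of order at most 2, hence `ZMod 2` in that
case. Otherwise opposite integers on `i` and `σ i` separate `i` from every other index. -/
theorem exists_weight {ι : Type*} {σ : ι → ι} (hσ : ∀ i, σ (σ i) = i) {i j : ι} (hij : i ≠ j) :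
    ∃ (K : Type) (_ : AddCommGroup K) (k : ι → K), (∀ l, k l + k (σ l) = 0) ∧ k i ≠ k j := by
  classical
  have hinv : ∀ l, σ l = i ↔ l = σ i := fun l => ⟨fun h => by rw [← h, hσ], fun h => by rw [h, hσ]⟩
  by_cases hi : σ i = i
  · refine ⟨ZMod 2, inferInstance, fun l => if l = i then 1 else 0, fun l => ?_, ?_⟩
    · simp only [hinv, hi]
      split_ifs
      · decide
      · simp
    · simp [hij.symm]
  · refine ⟨ℤ, inferInstance, fun l => if l = i then 1 else if l = σ i then -1 else 0,
      fun l => ?_, ?_⟩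
    · have hinv' : σ l = σ i ↔ l = i := ⟨fun h => by rw [← hσ l, h, hσ], fun h => by rw [h]⟩
      simp only [hinv, hinv']
      split_ifs with h1 h2
      · exact absurd (h2.symm.trans h1) hi
      · simp
      · simp
      · simp
    · simp only [if_true, hij.symm, if_false]
      split_ifs <;> simp

end Weights

namespace Realization

variable {F : Type u} [Field F] {A : Type v} [Ring A] [Algebra F A] {Γ : Type w}
  {φ : A →ₗ[F] A} {𝒜 : Γ → Submodule F A} {P : InvPair F} (R : Realization φ 𝒜 P)

/-- The index set of the distinguished basis. -/
abbrev Index : Type := Fin P.p ⊕ (Fin R.s ⊕ Fin R.s)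

/-- The involution of the index set that matches the basis vectors that are not orthogonal. -/
def partner : R.Index → R.Index := Sum.map id Sum.swap

theorem partner_partner (i : R.Index) : R.partner (R.partner i) = i := by
  rcases i with i | i | i <;> rfl

theorem form_eq_zero {i j : R.Index} (h : i ≠ R.partner j) : R.B (R.basis i) (R.basis j) = 0 := by
  rcases i with i | i | i <;> rcases j with j | j | j <;>
    simp only [partner, Sum.map_inl, Sum.map_inr, Sum.swap_inl, Sum.swap_inr, id, ne_eq,
      Sum.inl.injEq, Sum.inr.injEq, reduceCtorEq, not_false_eq_true] at h
  · exact R.form_inl_inl i j h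
  · exact R.form_inl_inr _ _
  · exact R.form_inl_inr _ _
  · exact R.form_inr_inl _ _
  · exact R.form_xx _ _
  · exact R.form_xy_ne _ _ h
  · exact R.form_inr_inl _ _
  · exact R.form_yx_ne _ _ h
  · exact R.form_yy _ _

theorem isUnit_form (i : R.Index) : IsUnit (R.B (R.basis (R.partner i)) (R.basis i)) := by
  rcases i with i | i | i
  · simp only [partner, Sum.map_inl, id, R.form_diag]
    exact ⟨⟨_, _, R.d_sq i, R.d_sq i⟩, rfl⟩
  · simp only [partner, Sum.map_inr, Sum.swap_inl, R.form_yx]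
    exact (IsUnit.mk0 _ (inv_ne_zero (R.ν_ne_zero i))).map _
  · simp only [partner, Sum.map_inr, Sum.swap_inr, R.form_xy]
    exact (IsUnit.mk0 _ (R.ν_ne_zero i)).map _

theorem sum_repr (x : R.V) : ∑ i, op (unop (R.basis.repr x i)) • R.basis i = x :=
  R.basis.sum_repr x

/-- The matrix of `B` in the distinguished basis is monomial with invertible entries. The dual
vectors are therefore homogeneous multiples of the partners. -/
theorem exists_frame : ∃ b' : R.Index → R.V, IsFrame P.comp R.B R.basis b' ∧
    (∀ i x, R.B (b' i) x = unop (R.basis.repr x i)) ∧ ∀ i, ∃ u : P.Dˣ,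
      (u : P.D) = R.B (R.basis (R.partner i)) (R.basis i) ∧
      b' i = op (P.τ (u⁻¹ : P.Dˣ)) • R.basis (R.partner i) := by
  have := P.division.nontrivial
  obtain ⟨γ, hγ⟩ := R.sesquilinear.exists_degree
  choose u hu using R.isUnit_form
  have hrepr : ∀ i x, R.B (R.basis (R.partner i)) x = u i * unop (R.basis.repr x i) := by
    intro i x
    conv_lhs => rw [← R.sum_repr x, map_sum]
    rw [Finset.sum_eq_single i]
    · rw [R.sesquilinear.smul_right, hu]
    · intro j _ hj
      rw [R.sesquilinear.smul_right, R.form_eq_zero, zero_mul]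
      exact fun h => hj (by rw [← R.partner_partner i, h, R.partner_partner])
    · simp
  have hform : ∀ i x, R.B (op (P.τ ((u i)⁻¹ : P.Dˣ)) • R.basis (R.partner i)) x =
      unop (R.basis.repr x i) := by
    intro i x
    rw [R.sesquilinear.smul_left, P.isInvolution.invol, hrepr, ← mul_assoc, Units.inv_mul, one_mul]
  refine ⟨fun i => op (P.τ ((u i)⁻¹ : P.Dˣ)) • R.basis (R.partner i), ⟨?_, ?_, ?_⟩, hform,
    fun i => ⟨u i, hu i, rfl⟩⟩
  · intro x
    simp only [hform]
    exact R.sum_repr x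
  · intro i
    simp [hform]
  · intro i
    obtain ⟨g, hg⟩ := R.basis_homogeneous i
    obtain ⟨g', hg'⟩ := R.basis_homogeneous (R.partner i)
    have h1 := hγ _ _ _ hg' _ hg
    rw [← hu] at h1
    have h2 := P.division.isGrading.inv_mem (u i) h1
    exact ⟨R.partner i, _, _, P.graded _ ▸ Submodule.mem_map_of_mem h2, rfl⟩

theorem isGrading_induced : IsGrading (inducedGrading (D := P.D) R.grading) := by
  have := P.division.nontrivial
  obtain ⟨γ, hγ⟩ := R.sesquilinear.exists_degree
  obtain ⟨b', hf, -⟩ := R.exists_frame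
  refine GradedInvolutions.isGrading_induced hf R.sesquilinear R.isModuleGrading fun i => ?_
  obtain ⟨g, -, hg⟩ := hf.degree P.division.isGrading R.isModuleGrading hγ R.basis_homogeneous i
  exact ⟨_, hg⟩

section Weight

variable {K : Type} [AddCommGroup K] (k : R.Index → K)

/-- The grading of `V` that gives the basis vectors the degrees `k`, and degree `0` to `D`. -/
def weightGrading (g : K) : Submodule F R.V where
  carrier := {x | ∀ i, R.basis.repr x i ≠ 0 → k i = g}
  add_mem' {x y} hx hy i hi := by
    by_cases h : R.basis.repr x i = 0
    · refine hy i fun h' => hi ?_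
      rw [map_add, Finsupp.add_apply, h, h', add_zero]
    · exact hx i h
  zero_mem' i hi := by simp at hi
  smul_mem' c x hx i hi := by
    refine hx i fun h => hi ?_
    rw [← op_algebraMap_smul (D := P.D), map_smul, Finsupp.smul_apply, h, smul_zero]

open Classical in
/-- The grading of `D` that is concentrated in degree `0`. -/
noncomputable def trivialGrading (F D K : Type*) [Field F] [Ring D] [Algebra F D] [AddCommGroup K] (g : K) :
    Submodule F D := if g = 0 then ⊤ else ⊥

theorem isGrading_trivialGrading (D : Type*) [Ring D] [Algebra F D] :
    IsGrading (trivialGrading F D K) := by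
  refine isGrading_iff.2 ⟨⟨?_, ?_⟩, ?_⟩
  · intro g
    rw [Submodule.disjoint_def]
    intro x hx hx'
    by_cases hg : g = 0
    · have : (⨆ (j) (_ : j ≠ g), trivialGrading F D K j) ≤ ⊥ :=
        iSup₂_le fun j hj => by rw [trivialGrading, if_neg (by rwa [hg] at hj)]
      exact (Submodule.mem_bot F).1 (this hx')
    · rw [trivialGrading, if_neg hg] at hx
      exact (Submodule.mem_bot F).1 hx
  · rw [eq_top_iff]
    exact le_iSup_of_le 0 (by rw [trivialGrading, if_pos rfl])
  · exact
      { one_mem := by rw [trivialGrading, if_pos rfl]; trivial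
        mul_mem := fun i j x y hx hy => by
          by_cases hi : i = 0
          · by_cases hj : j = 0
            · rw [trivialGrading, if_pos (by rw [hi, hj, add_zero])]
              trivial
            · rw [trivialGrading, if_neg hj, Submodule.mem_bot] at hy
              rw [hy, mul_zero]
              exact zero_mem _
          · rw [trivialGrading, if_neg hi, Submodule.mem_bot] at hx
            rw [hx, zero_mul]
            exact zero_mem _ }

theorem basis_mem_weightGrading (i : R.Index) : R.basis i ∈ R.weightGrading k (k i) := by
  intro j hj
  rw [R.basis.repr_self, Finsupp.single_apply_ne_zero] at hj
  rw [hj.1]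

theorem smul_mem_weightGrading (a : P.Dᵐᵒᵖ) {x : R.V} {g : K} (hx : x ∈ R.weightGrading k g) :
    a • x ∈ R.weightGrading k g := by
  intro i hi
  refine hx i fun h => hi ?_
  rw [map_smul, Finsupp.smul_apply, h, smul_zero]

theorem isModuleGrading_weightGrading :
    IsModuleGrading (trivialGrading F P.D K) (R.weightGrading k) := by
  classical
  refine isModuleGrading_iff.2 ⟨⟨?_, ?_⟩, ?_⟩
  · refine iSupIndep_of_proj (fun g =>
      (R.basis.constr ℕ (fun i => if k i = g then R.basis i else 0)).restrictScalars F) ?_ ?_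
    · intro g x hx
      rw [LinearMap.restrictScalars_apply, Module.Basis.constr_apply_fintype]
      conv_rhs => rw [← R.basis.sum_repr x]
      refine Finset.sum_congr rfl fun i _ => ?_
      by_cases hi : R.basis.repr x i = 0
      · simp [hi]
      · simp [hx i hi]
    · intro g g' hne x hx
      rw [LinearMap.restrictScalars_apply, Module.Basis.constr_apply_fintype]
      refine Finset.sum_eq_zero fun i _ => ?_
      by_cases hi : R.basis.repr x i = 0
      · simp [hi]
      · simp [hx i hi, hne]
  · rw [eq_top_iff]
    rintro x -
    rw [← R.basis.sum_repr x]
    exact sum_mem fun i _ => Submodule.mem_iSup_of_mem (k i)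
      (R.smul_mem_weightGrading k _ (R.basis_mem_weightGrading k i))
  · intro g h x hx a ha
    by_cases hh : h = 0
    · rw [hh, add_zero]
      exact R.smul_mem_weightGrading k _ hx
    · rw [trivialGrading, if_neg hh, Submodule.mem_bot] at ha
      rw [ha, op_zero, zero_smul]
      exact zero_mem _

theorem isSesquilinear_weightGrading (hk : ∀ i, k i + k (R.partner i) = 0) :
    IsSesquilinear (trivialGrading F P.D K) P.τ (R.weightGrading k) R.B :=
  { R.sesquilinear with
    homogeneous := by
      refine ⟨0, fun g g' x hx y hy => ?_⟩
      by_cases hg : g + g' = 0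
      · rw [trivialGrading, if_pos (by rw [hg, add_zero])]
        trivial
      · have h0 : R.B x y = 0 := by
          rw [← R.sum_repr x, ← R.sum_repr y, map_sum]
          refine Finset.sum_eq_zero fun j _ => ?_
          rw [map_sum, LinearMap.sum_apply]
          refine Finset.sum_eq_zero fun i _ => ?_
          rw [R.sesquilinear.smul_right, R.sesquilinear.smul_left]
          by_cases hi : R.basis.repr x i = 0
          · simp [hi]
          by_cases hj : R.basis.repr y j = 0
          · simp [hj]
          rw [R.form_eq_zero, mul_zero, zero_mul]
          rintro rfl
          rw [← hx _ hi, ← hy _ hj, add_comm, hk] at hg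
          exact hg rfl
        rw [h0]
        exact zero_mem _ }

end Weight

variable [AddCommGroup Γ] (hφ : IsInvolution φ) (hfine : IsFinePhiGrading φ 𝒜)
include hφ hfine

/-- In a fine grading, distinct basis vectors lie in graded subspaces of degrees that are distinct
modulo the support of `D`. -/
theorem eq_of_mem_inducedGrading_zero {f : Module.End P.Dᵐᵒᵖ R.V}
    (hf : f ∈ inducedGrading (D := P.D) R.grading 0) {i j : R.Index} {a : P.D} (ha : a ≠ 0)
    (hfi : f (R.basis i) = op a • R.basis j) : i = j := by
  have := P.division.nontrivial
  by_contra hij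
  obtain ⟨K, _, k, hk, hkij⟩ := exists_weight R.partner_partner hij
  obtain ⟨b', hfr, -⟩ := R.exists_frame
  have h1 := R.isGrading_induced.one_mem
  have : Nontrivial R.V := ⟨R.basis i, 0, R.basis.ne_zero i⟩
  obtain ⟨g, hg⟩ := exists_inducedGrading_le hφ hfine R.iso_graded R.iso_adjoint hfr R.sesquilinear
    P.division.isGrading R.isModuleGrading R.basis_homogeneous
    (R.isSesquilinear_weightGrading k hk) (isGrading_trivialGrading (K := K) P.D)
    (R.isModuleGrading_weightGrading k) (fun i => ⟨_, R.basis_mem_weightGrading k i⟩)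
    (fun t => ⟨0, by rw [trivialGrading, if_pos rfl]; exact le_top⟩)
    (fun h0 => one_ne_zero ((Submodule.eq_bot_iff _).1 h0 _ h1))
  -- The identity and `f` have degree 0, so they lie in one component of the weight grading, of
  -- degree `g` say. The identity gives `k i = g + k i` and `f` gives `k j = g + k i`.
  have h2 := hg h1 _ _ (R.basis_mem_weightGrading k i) i
  have h3 := hg hf _ _ (R.basis_mem_weightGrading k i) j
  rw [hfi, map_smul, Finsupp.smul_apply] at h3
  simp only [Module.End.one_apply, Module.Basis.repr_self, Finsupp.single_eq_same] at h2 h3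
  have h4 := h2 one_ne_zero
  have h5 := h3 (by simpa using ha)
  exact hkij (h4.trans h5.symm)

/-- If a homogeneous vector had two nonzero coordinates, their quotient would define an operator of
degree 0 that carries one basis vector to a nonzero multiple of another, against
`eq_of_mem_inducedGrading_zero`. -/
theorem exists_eq_smul_basis {g : P.G} {x : R.V} (hx : x ∈ R.grading g) (hx0 : x ≠ 0) :
    ∃ i t, ∃ a ∈ P.comp t, a ≠ 0 ∧ x = op a • R.basis i := by
  have := P.division.nontrivial
  obtain ⟨γ, hγ⟩ := R.sesquilinear.exists_degree
  obtain ⟨b', hfr, hrepr, -⟩ := R.exists_frame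
  have hdeg := hfr.degree P.division.isGrading R.isModuleGrading hγ R.basis_homogeneous
  have hmem : ∀ i, ∃ h, R.basis i ∈ R.grading h ∧ b' i ∈ R.grading (-h - γ) ∧
      unop (R.basis.repr x i) ∈ P.comp (g - h) := fun i => by
    obtain ⟨h, h1, h2⟩ := hdeg i
    refine ⟨h, h1, h2, ?_⟩
    have h3 := hγ _ _ _ h2 _ hx
    rw [hrepr, show -h - γ + g + γ = g - h by abel] at h3
    exact h3
  obtain ⟨i, hi⟩ : ∃ i, R.basis.repr x i ≠ 0 := by
    by_contra hcon
    push Not at hcon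
    exact hx0 (R.basis.repr.injective (by ext i; simp [hcon i]))
  obtain ⟨h, h1, h2, h3⟩ := hmem i
  have hi' : unop (R.basis.repr x i) ≠ 0 := by simpa using hi
  refine ⟨i, _, _, h3, hi', ?_⟩
  obtain ⟨u, hu⟩ := P.division.isUnit _ _ h3 hi'
  have hinv := P.division.isGrading.inv_mem u (hu ▸ h3)
  conv_lhs => rw [← R.sum_repr x]
  refine Finset.sum_eq_single i (fun j _ hji => ?_) (by simp)
  by_contra hj
  have hj' : unop (R.basis.repr x j) ≠ 0 := fun h0 => hj (by rw [h0, op_zero, zero_smul])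
  obtain ⟨l, l1, -, l3⟩ := hmem j
  -- With `u` the `i`-th coordinate of `x`, these are the two vectors of a rank one operator sending
  -- `bᵢ` to `bⱼ` times `xⱼu⁻¹`. Its degree is 0 because `bᵢu` and `bⱼxⱼ` both have the degree of
  -- `x`.
  have hy := R.isModuleGrading.smul_mem h2 (P.graded _ ▸ Submodule.mem_map_of_mem hinv)
  have hz := R.isModuleGrading.smul_mem l1 l3
  have hf := rankOne_mem_of_degree R.sesquilinear.smul_right R.isModuleGrading hγ hz hy
  rw [show l + (g - l) + (-h - γ + -(g - h)) + γ = 0 by abel] at hf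
  refine hji (R.eq_of_mem_inducedGrading_zero hφ hfine hf (a := unop (R.basis.repr x j) * ↑u⁻¹)
    ?_ ?_).symm
  · exact fun h0 => hj' ((Units.mul_left_eq_zero u⁻¹).1 h0)
  · rw [rankOne_apply, R.sesquilinear.smul_left, P.isInvolution.invol, hfr.form_one, mul_one,
      smul_smul, ← op_mul]

end Realization

/-! ### Comparison of two realizations of the same data -/

section

variable {F : Type*} [Field F] {D D' : Type*} [Ring D] [Algebra F D] [Ring D'] [Algebra F D']
  {G G' : Type*} [AddCommGroup G] [AddCommGroup G'] {𝒟 : G → Submodule F D}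
  {𝒟' : G' → Submodule F D'}

/-- Nonzero components are lines, so the image of one nonzero element of each component decides
everything. -/
theorem IsCentralGradedDivision.isGradedIso [IsAlgClosed F]
    (hD' : IsCentralGradedDivision 𝒟') {Φ : D ≃ₐ[F] D'}
    (h : ∀ t, ∀ a ∈ 𝒟 t, a ≠ 0 → ∃ t', Φ a ∈ 𝒟' t') (hD : IsCentralGradedDivision 𝒟) :
    IsGradedIso 𝒟 𝒟' Φ := by
  intro t ht
  obtain ⟨a, ha, ha0⟩ := Submodule.exists_mem_ne_zero_of_ne_bot ht
  obtain ⟨t', ht'⟩ := h t a ha ha0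
  have hΦa : Φ a ≠ 0 := fun h0 => ha0 (Φ.injective (by rw [h0, map_zero]))
  refine ⟨t', le_antisymm ?_ ?_⟩
  · rintro _ ⟨b, hb, rfl⟩
    obtain ⟨c, rfl⟩ := hD.exists_smul_eq ha ha0 hb
    simpa using Submodule.smul_mem _ c ht'
  · intro y hy
    obtain ⟨c, rfl⟩ := hD'.exists_smul_eq ht' hΦa hy
    exact ⟨c • a, Submodule.smul_mem _ c ha, by simp⟩

end

section

variable {F : Type*} [Field F] {D : Type*} [Ring D] [Algebra F D] {V : Type*} [AddCommGroup V]
  [Module F V] {τ : D →ₗ[F] D} {B : V →ₗ[F] V →ₗ[F] D}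

theorem IsHermitianOrSkew.exists_sign (h : IsHermitianOrSkew τ B) :
    ∃ ε : F, ε * ε = 1 ∧ ∀ x y, B y x = ε • τ (B x y) := by
  rcases h with h | h
  · exact ⟨1, by simp, fun x y => by rw [h, one_smul]⟩
  · exact ⟨-1, by simp, fun x y => by rw [h, neg_smul, one_smul]⟩

end

namespace Realization

variable {F : Type u} [Field F] {A : Type v} [Ring A] [Algebra F A] {Γ : Type w}
  {φ : A →ₗ[F] A} {𝒜 : Γ → Submodule F A} {P P' : InvPair F}

instance : Module.Finite F P.D := P.division.finiteDimensional

instance (R : Realization φ 𝒜 P) : Module.Finite F R.V :=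
  have : Module.Finite F P.Dᵐᵒᵖ := Module.Finite.equiv (opLinearEquiv F)
  have : Module.Finite P.Dᵐᵒᵖ R.V := Module.Finite.of_basis R.basis
  Module.Finite.trans P.Dᵐᵒᵖ R.V

theorem nontrivial_V [Nontrivial A] (R : Realization φ 𝒜 P) : Nontrivial R.V := by
  by_contra h
  rw [not_nontrivial_iff_subsingleton] at h
  have : Subsingleton (Module.End P.Dᵐᵒᵖ R.V) := ⟨fun f g => by ext x; exact Subsingleton.elim _ _⟩
  have : Subsingleton A := R.iso.toEquiv.subsingleton
  exact not_subsingleton A this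

theorem nonempty_index [Nontrivial A] (R : Realization φ 𝒜 P) : Nonempty R.Index := by
  have := R.nontrivial_V
  exact R.basis.index_nonempty

theorem smul_basis_injective (R : Realization φ 𝒜 P) (i : R.Index) {a a' : P.D}
    (h : op a • R.basis i = op a' • R.basis i) : a = a' := by
  have h1 := congrArg (fun x => R.basis.repr x i) h
  simpa using h1

/-- An operator that commutes with `End_D(V)` is the multiplication by an element of `D`. -/
theorem exists_eq_smul_of_commute [Nontrivial A] (R : Realization φ 𝒜 P) (S : R.V →ₗ[F] R.V)
    (hS : ∀ r x, S (R.iso r x) = R.iso r (S x)) : ∃ a : P.D, ∀ x, S x = op a • x := by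
  obtain ⟨b', hfr, -⟩ := R.exists_frame
  obtain ⟨i⟩ := R.nonempty_index
  refine ⟨R.B (b' i) (S (R.basis i)), fun x => ?_⟩
  have h1 := hS (R.iso.symm (rankOne R.sesquilinear.smul_right x (b' i))) (R.basis i)
  rw [AlgEquiv.apply_symm_apply, rankOne_apply, rankOne_apply, hfr.form_one, op_one, one_smul] at h1
  exact h1

theorem exists_form_isUnit (R : Realization φ 𝒜 P) {x : R.V} {g : P.G} (hx : x ∈ R.grading g)
    (hx0 : x ≠ 0) : ∃ (y : R.V) (h t : P.G) (u : P.Dˣ), y ∈ R.grading h ∧ (u : P.D) ∈ P.comp t ∧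
      R.B y x = u := by
  have := P.division.nontrivial
  obtain ⟨γ, hγ⟩ := R.sesquilinear.exists_degree
  obtain ⟨b', hfr, -⟩ := R.exists_frame
  have hdeg := hfr.degree P.division.isGrading R.isModuleGrading hγ R.basis_homogeneous
  obtain ⟨i, hi⟩ : ∃ i, R.B (b' i) x ≠ 0 := by
    by_contra hcon
    push Not at hcon
    apply hx0
    rw [← hfr.expand x]
    simp [hcon]
  obtain ⟨h, -, h2⟩ := hdeg i
  have h3 := hγ _ _ _ h2 _ hx
  obtain ⟨u, hu⟩ := P.division.isUnit _ _ h3 hi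
  exact ⟨b' i, _, _, u, h2, hu ▸ h3, hu.symm⟩

variable [AddCommGroup Γ]

theorem isGradedIso_symm_trans {A' : Type*} [Ring A'] [Algebra F A'] {Γ' : Type*} [AddCommGroup Γ']
    {φ' : A' →ₗ[F] A'} {𝒜' : Γ' → Submodule F A'}
    (h𝒜 : IsGrading 𝒜) (R : Realization φ 𝒜 P) (R' : Realization φ' 𝒜' P') {Ψ : A ≃ₐ[F] A'}
    (hΨ : IsGradedIso 𝒜 𝒜' Ψ) :
    IsGradedIso (inducedGrading (D := P.D) R.grading) (inducedGrading (D := P'.D) R'.grading)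
      ((R.iso.symm.trans Ψ).trans R'.iso) :=
  InvPair.isGradedIso_trans (InvPair.isGradedIso_trans
    (InvPair.isGradedIso_symm h𝒜 R.isGrading_induced R.iso_graded) hΨ) R'.iso_graded

theorem isGradedIso_refl : IsGradedIso 𝒜 𝒜 (AlgEquiv.refl : A ≃ₐ[F] A) := fun g _ =>
  ⟨g, by ext x; exact ⟨fun ⟨y, hy, h⟩ => h ▸ hy, fun hx => ⟨x, hx, rfl⟩⟩⟩

/-- The rank one operators `x B(b'ᵢ, ·)` embed `V` as a left ideal of `A`. Letting this ideal act on
a basis vector of the other module gives an `A`-linear map. -/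
theorem exists_surjective_intertwiner [Nontrivial A] (h𝒜 : IsGrading 𝒜) (R : Realization φ 𝒜 P)
    (R' : Realization φ 𝒜 P') : ∃ ψ : R.V →ₗ[F] R'.V, Function.Surjective ψ ∧
      (∀ r x, ψ (R.iso r x) = R'.iso r (ψ x)) ∧
      ∀ g, ∀ x ∈ R.grading g, ∃ g', ψ x ∈ R'.grading g' := by
  have := P.division.nontrivial
  obtain ⟨γ, hγ⟩ := R.sesquilinear.exists_degree
  obtain ⟨b', hfr, -⟩ := R.exists_frame
  have hdeg := hfr.degree P.division.isGrading R.isModuleGrading hγ R.basis_homogeneous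
  obtain ⟨i⟩ := R.nonempty_index
  obtain ⟨h, hi, hi'⟩ := hdeg i
  let T : R.V → Module.End P.Dᵐᵒᵖ R.V := fun x => rankOne R.sesquilinear.smul_right x (b' i)
  have hT : T (R.basis i) ≠ 0 := by
    intro h0
    have h1 := LinearMap.congr_fun h0 (R.basis i)
    rw [rankOne_apply, hfr.form_one, op_one, one_smul, LinearMap.zero_apply] at h1
    exact R.basis.ne_zero i h1
  obtain ⟨j, hj⟩ : ∃ j, R'.iso (R.iso.symm (T (R.basis i))) (R'.basis j) ≠ 0 := by
    by_contra hcon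
    push Not at hcon
    have h1 : R'.iso (R.iso.symm (T (R.basis i))) = 0 := R'.basis.ext (by simpa using hcon)
    rw [map_eq_zero_iff _ R'.iso.injective, map_eq_zero_iff _ R.iso.symm.injective] at h1
    exact hT h1
  let ψ : R.V →ₗ[F] R'.V :=
    { toFun := fun x => R'.iso (R.iso.symm (T x)) (R'.basis j)
      map_add' := fun x y => by simp [T, rankOne_add_left]
      map_smul' := fun c x => by simp [T, rankOne_smul_left] }
  have hψ : ∀ r x, ψ (R.iso r x) = R'.iso r (ψ x) := by
    intro r x
    change R'.iso (R.iso.symm (T (R.iso r x))) (R'.basis j) =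
      R'.iso r (R'.iso (R.iso.symm (T x)) (R'.basis j))
    have h1 : T (R.iso r x) = R.iso r * T x := (mul_rankOne _ _ _ _).symm
    rw [h1, map_mul, map_mul, AlgEquiv.symm_apply_apply, Module.End.mul_apply]
  have hhom : ∀ g, ∀ x ∈ R.grading g, ∃ g', ψ x ∈ R'.grading g' := by
    intro g x hx
    by_cases hx0 : T x = 0
    · refine ⟨0, ?_⟩
      have : ψ x = 0 := by
        change R'.iso (R.iso.symm (T x)) (R'.basis j) = 0
        rw [hx0, map_zero, map_zero, LinearMap.zero_apply]
      rw [this]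
      exact zero_mem _
    have h1 := rankOne_mem_of_degree R.sesquilinear.smul_right R.isModuleGrading hγ hx hi'
    obtain ⟨k, hk⟩ := isGradedIso_symm_trans h𝒜 R R' isGradedIso_refl _
      (fun hb => hx0 ((Submodule.eq_bot_iff _).1 hb _ h1))
    obtain ⟨l, hl⟩ := R'.basis_homogeneous j
    have h2 : R'.iso (R.iso.symm (T x)) ∈ inducedGrading (D := P'.D) R'.grading k := by
      rw [← hk]
      exact ⟨_, h1, rfl⟩
    exact ⟨k + l, h2 _ _ hl⟩
  refine ⟨ψ, fun y => ?_, hψ, hhom⟩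
  -- The vector `ψ(bᵢ)` is nonzero and homogeneous, so it pairs to a unit `w` with some `y'`. Rank
  -- one operators then move it to any prescribed `y`, and they all come from `A`.
  obtain ⟨g', hg'⟩ := hhom _ _ hi
  obtain ⟨y', -, -, w, -, -, hw⟩ := R'.exists_form_isUnit hg' hj
  have hw' : R'.B y' (ψ (R.basis i)) = w := hw
  refine ⟨R.iso (R'.iso.symm (rankOne R'.sesquilinear.smul_right
    (op ((w⁻¹ : P'.Dˣ) : P'.D) • y) y')) (R.basis i), ?_⟩
  rw [hψ, AlgEquiv.apply_symm_apply, rankOne_apply, hw', smul_smul, ← op_mul, Units.inv_mul, op_one,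
    one_smul]

/-- Surjective intertwiners exist in both directions, so dimensions agree and either one is
bijective. It identifies the commutants of `A`, which are the algebras `D` and `D'` acting on the
right. -/
theorem exists_semilinear_equiv [IsAlgClosed F] [Nontrivial A] (h𝒜 : IsGrading 𝒜)
    (R : Realization φ 𝒜 P) (R' : Realization φ 𝒜 P') :
    ∃ (Φ : P.D ≃ₐ[F] P'.D) (ψ : R.V ≃ₗ[F] R'.V), (∀ a x, ψ (op a • x) = op (Φ a) • ψ x) ∧
      (∀ r x, ψ (R.iso r x) = R'.iso r (ψ x)) ∧ IsGradedIso P.comp P'.comp Φ ∧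
      ∀ g, ∀ x ∈ R.grading g, ∃ g', ψ x ∈ R'.grading g' := by
  have := IsScalarTower.to_smulCommClass' (R := F) (A := P.Dᵐᵒᵖ) (M := R.V)
  have := IsScalarTower.to_smulCommClass' (R := F) (A := P'.Dᵐᵒᵖ) (M := R'.V)
  obtain ⟨ψ, hsurj, hψ, hhom⟩ := exists_surjective_intertwiner h𝒜 R R'
  obtain ⟨ψ', hsurj', -⟩ := exists_surjective_intertwiner h𝒜 R' R
  have hfr : Module.finrank F R.V = Module.finrank F R'.V :=
    le_antisymm (LinearMap.finrank_le_finrank_of_surjective hsurj')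
      (LinearMap.finrank_le_finrank_of_surjective hsurj)
  have hinj : Function.Injective ψ :=
    (LinearMap.injective_iff_surjective_of_finrank_eq_finrank hfr).2 hsurj
  let e : R.V ≃ₗ[F] R'.V := LinearEquiv.ofBijective ψ ⟨hinj, hsurj⟩
  have he : ∀ r x, e (R.iso r x) = R'.iso r (e x) := hψ
  have he' : ∀ r y, e.symm (R'.iso r y) = R.iso r (e.symm y) := fun r y => by
    rw [LinearEquiv.symm_apply_eq, he, LinearEquiv.apply_symm_apply]
  have hex : ∀ a : P.D, ∃ a' : P'.D, ∀ x, e (op a • x) = op a' • e x := by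
    intro a
    obtain ⟨a', ha'⟩ := R'.exists_eq_smul_of_commute
      (e.toLinearMap ∘ₗ Module.toModuleEnd F (S := P.Dᵐᵒᵖ) R.V (op a) ∘ₗ e.symm.toLinearMap)
      (fun r x => by simp [he', ← he])
    refine ⟨a', fun x => ?_⟩
    have h1 := ha' (e x)
    simpa using h1
  have hex' : ∀ a' : P'.D, ∃ a : P.D, ∀ x, e (op a • x) = op a' • e x := by
    intro a'
    obtain ⟨a, ha⟩ := R.exists_eq_smul_of_commute
      (e.symm.toLinearMap ∘ₗ Module.toModuleEnd F (S := P'.Dᵐᵒᵖ) R'.V (op a') ∘ₗ e.toLinearMap)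
      (fun r x => by simp [he, ← he'])
    refine ⟨a, fun x => ?_⟩
    rw [← ha x]
    simp
  choose f hf using hex
  choose f' hf' using hex'
  obtain ⟨i⟩ := R.nonempty_index
  obtain ⟨j⟩ := R'.nonempty_index
  have huniq : ∀ a b : P'.D, (∀ x, op a • e x = op b • e x) → a = b := fun a b h =>
    R'.smul_basis_injective j (by simpa using h (e.symm (R'.basis j)))
  have huniq' : ∀ a b : P.D, (∀ x, e (op a • x) = e (op b • x)) → a = b := fun a b h =>
    R.smul_basis_injective i (e.injective (h _))
  let Φ : P.D ≃ₐ[F] P'.D :=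
    { toFun := f
      invFun := f'
      left_inv := fun a => huniq' _ _ fun x => by rw [hf', hf]
      right_inv := fun a => huniq _ _ fun x => by rw [← hf, hf']
      map_mul' := fun a b => huniq _ _ fun x => by
        rw [← hf, op_mul, mul_smul, hf, hf, smul_smul, op_mul]
      map_add' := fun a b => huniq _ _ fun x => by
        rw [← hf, op_add, add_smul, map_add, hf, hf, ← add_smul, op_add]
      commutes' := fun c => huniq _ _ fun x => by
        rw [← hf, op_algebraMap_smul, op_algebraMap_smul, map_smul] }
  refine ⟨Φ, e, hf, he, P'.division.isGradedIso (fun t a ha ha0 => ?_) P.division, hhom⟩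
  obtain ⟨g, hg⟩ := R.basis_homogeneous i
  have := P.division.nontrivial
  have := P'.division.nontrivial
  obtain ⟨γ', hγ'⟩ := R'.sesquilinear.exists_degree
  obtain ⟨g', hg'⟩ := hhom _ _ hg
  obtain ⟨k, hk⟩ := hhom _ _ (R.isModuleGrading.smul_mem hg ha)
  obtain ⟨y, h, s, w, hy, hws, hw⟩ := R'.exists_form_isUnit hg'
    (fun h0 => R.basis.ne_zero i (e.injective (h0.trans (map_zero e).symm)))
  have h1 : e (op a • R.basis i) = op (Φ a) • e (R.basis i) := hf a _
  change e (op a • R.basis i) ∈ _ at hk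
  rw [h1] at hk
  have h2 := hγ' _ _ _ hy _ hk
  have hw' : R'.B y (e (R.basis i)) = w := hw
  rw [R'.sesquilinear.smul_right, hw'] at h2
  have h3 := P'.division.isGrading.mul_mem (P'.division.isGrading.inv_mem w hws) h2
  rw [← mul_assoc, Units.inv_mul, one_mul] at h3
  exact ⟨_, h3⟩

/-- The adjoint of an operator of rank one. -/
theorem iso_map_rankOne (R : Realization φ 𝒜 P) {ε : F}
    (hε : ε * ε = 1) (hR : ∀ x y, R.B y x = ε • P.τ (R.B x y)) (x y : R.V) :
    R.iso (φ (R.iso.symm (rankOne R.sesquilinear.smul_right x y))) =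
      ε • rankOne R.sesquilinear.smul_right y x := by
  have := IsScalarTower.to_smulCommClass' (R := F) (A := P.Dᵐᵒᵖ) (M := R.V)
  ext u
  rw [← sub_eq_zero]
  refine R.sesquilinear.nondegenerate_right _ fun v => ?_
  rw [map_sub, ← R.iso_adjoint, AlgEquiv.apply_symm_apply, LinearMap.smul_apply, rankOne_apply,
    rankOne_apply, R.sesquilinear.smul_left, map_smul, R.sesquilinear.smul_right, hR y v,
    smul_mul_assoc, smul_smul, hε, one_smul, sub_self]

/-- Adjoints of rank one operators determine the form up to a left factor, which supplies `z`. The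
permutation comes from `exists_eq_smul_basis`; only injectivity is proved here, since the roles of
the realizations can be exchanged. -/
theorem exists_comparison [IsAlgClosed F] [Nontrivial A] (hφ : IsInvolution φ)
    (hfine : IsFinePhiGrading φ 𝒜) (R : Realization φ 𝒜 P) (R' : Realization φ 𝒜 P') :
    ∃ (z : P.Dˣ) (Φ : P.D ≃ₐ[F] P'.D) (π : Fin P.p → Fin P'.p), Function.Injective π ∧
      (∃ g, (z : P.D) ∈ P.comp g) ∧ IsGradedIso P.comp P'.comp Φ ∧
      (∀ x, Φ (z * P.τ x * (z⁻¹ : P.Dˣ)) = P'.τ (Φ x)) ∧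
      ∀ i, ∃ c : F, Φ (z * P.d i) = c • P'.d (π i) := by
  have h𝒜 := hfine.1.isGrading
  have := P.division.nontrivial
  have := P'.division.nontrivial
  have := R'.nontrivial_V
  obtain ⟨Φ, ψ, hΦ, hψ, hΦgr, hhom⟩ := exists_semilinear_equiv h𝒜 R R'
  obtain ⟨ε, hε, hR⟩ := R.hermitian.exists_sign
  obtain ⟨γ, hγ⟩ := R.sesquilinear.exists_degree
  obtain ⟨γ', hγ'⟩ := R'.sesquilinear.exists_degree
  obtain ⟨b', hfr, -⟩ := R.exists_frame
  have hdeg := hfr.degree P.division.isGrading R.isModuleGrading hγ R.basis_homogeneous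
  obtain ⟨i⟩ := R.nonempty_index
  -- The adjoint relation of the second form is applied to the rank one operator `x B(b'ᵢ, ·)`,
  -- whose adjoint is `ε b'ᵢ B(x, ·)`. Evaluation at `ψ(bᵢ)` isolates `B'(ψx, ψy)`.
  have hform₀ : ∀ x y, R'.B (ψ x) (ψ y) =
      (ε • R'.B (ψ (R.basis i)) (ψ (b' i))) * Φ (R.B x y) := by
    intro x u
    have h1 := R'.iso_adjoint (R.iso.symm (rankOne R.sesquilinear.smul_right x (b' i)))
      (ψ (R.basis i)) (ψ u)
    rw [← hψ, ← hψ, R.iso_map_rankOne hε hR, AlgEquiv.apply_symm_apply, LinearMap.smul_apply,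
      rankOne_apply, rankOne_apply, hfr.form_one, op_one, one_smul, map_smul, map_smul, hΦ,
      R'.sesquilinear.smul_right, ← smul_mul_assoc] at h1
    exact h1
  obtain ⟨z₀, hz₀⟩ : ∃ z₀, Φ z₀ = ε • R'.B (ψ (R.basis i)) (ψ (b' i)) :=
    ⟨Φ.symm _, Φ.apply_symm_apply _⟩
  rw [← hz₀] at hform₀
  have hz₀0 : z₀ ≠ 0 := by
    rintro rfl
    obtain ⟨y, hy⟩ := exists_ne (0 : R'.V)
    refine hy (R'.sesquilinear.nondegenerate_left _ fun y' => ?_)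
    rw [← ψ.apply_symm_apply y, ← ψ.apply_symm_apply y', hform₀, map_zero, zero_mul]
  obtain ⟨s, hs⟩ : ∃ s, z₀ ∈ P.comp s := by
    obtain ⟨h, h1, h2⟩ := hdeg i
    obtain ⟨k, hk⟩ := hhom _ _ h1
    obtain ⟨l, hl⟩ := hhom _ _ h2
    have h3 : Φ z₀ ∈ P'.comp (k + l + γ') := by
      rw [hz₀]
      exact Submodule.smul_mem _ _ (hγ' _ _ _ hk _ hl)
    obtain ⟨s, hs⟩ := InvPair.exists_mem_comp_of_isGradedIso
      (InvPair.isGradedIso_symm P.division.isGrading P'.division.isGrading hΦgr)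
      (fun h0 => hz₀0 (Φ.injective (h0.trans (map_zero Φ).symm))) h3
    exact ⟨s, by simpa using hs⟩
  obtain ⟨z, rfl⟩ := P.division.isUnit _ _ hs hz₀0
  have hform : ∀ x y, R'.B (ψ x) (ψ y) = Φ (z * R.B x y) := fun x y => by rw [hform₀, map_mul]
  have hτ : ∀ a, Φ (z * P.τ a * (z⁻¹ : P.Dˣ)) = P'.τ (Φ a) := by
    intro a
    -- Since `B(b'ᵢ, bᵢ) = 1`, this pair isolates `τ(a)` on one side and `τ'(Φ(a))` on the other.
    have h1 := hform (op a • b' i) (R.basis i)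
    rw [hΦ, R'.sesquilinear.smul_left, hform, R.sesquilinear.smul_left, hfr.form_one, mul_one,
      mul_one] at h1
    rw [map_mul, ← h1, mul_assoc, ← map_mul, Units.mul_inv, map_one, mul_one]
  have hd : ∀ i, ∃ j t, ∃ a ∈ P'.comp t, a ≠ 0 ∧ ψ (R.basis (.inl i)) = op a • R'.basis (.inl j) ∧
      ∃ c : F, Φ (z * P.d i) = c • P'.d j := by
    intro i
    obtain ⟨g, hg⟩ := R.basis_homogeneous (.inl i)
    obtain ⟨g', hg'⟩ := hhom _ _ hg
    obtain ⟨j, t, a, ha, ha0, hja⟩ := R'.exists_eq_smul_basis hφ hfine hg'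
      (fun h0 => R.basis.ne_zero _ (ψ.injective (h0.trans (map_zero ψ).symm)))
    have h1 := hform (R.basis (.inl i)) (R.basis (.inl i))
    rw [R.form_diag, hja, R'.sesquilinear.smul_left, R'.sesquilinear.smul_right] at h1
    have h2 : Φ (z * P.d i) ≠ 0 := by
      rw [map_ne_zero_iff _ Φ.injective]
      exact fun h0 => P.d_ne_zero i ((Units.mul_right_eq_zero z).1 h0)
    -- The image of `vᵢ` is not isotropic, so it cannot be a multiple of a vector of a hyperbolic
    -- pair.
    have h3 : j = R'.partner j := by
      by_contra hne
      rw [R'.form_eq_zero hne, zero_mul, mul_zero] at h1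
      exact h2 h1.symm
    rcases j with j | j | j
    · refine ⟨j, t, a, ha, ha0, hja, ?_⟩
      -- With `a² = c`, the element `τ'(a) d'ⱼ a` is `±c d'ⱼ`, because `τ'(a) = ±a` and `a` commutes
      -- with `d'ⱼ` up to sign.
      obtain ⟨c, -, hc⟩ := P'.division.exists_mul_self_eq P'.isInvolution P'.graded ha ha0
      obtain ⟨t', ht'⟩ := P'.d_homogeneous j
      rw [← h1, R'.form_diag]
      have h4 : P'.τ a * (P'.d j * a) = P'.τ a * (a * P'.d j) ∨
          P'.τ a * (P'.d j * a) = -(P'.τ a * (a * P'.d j)) := by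
        rcases P'.division.mul_eq_or_neg P'.isInvolution P'.graded ht' ha with h | h
        · left; rw [h]
        · right; rw [h, mul_neg]
      have h5 : P'.τ a * (a * P'.d j) = c • P'.d j ∨ P'.τ a * (a * P'.d j) = -(c • P'.d j) := by
        rcases P'.division.map_eq_or_neg P'.isInvolution P'.graded ha with h | h
        · left; rw [h, ← mul_assoc, hc, Algebra.smul_def]
        · right; rw [h, neg_mul, ← mul_assoc, hc, Algebra.smul_def]
      rcases h4 with h4 | h4 <;> rcases h5 with h5 | h5 <;> rw [h4, h5]
      · exact ⟨c, rfl⟩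
      · exact ⟨-c, by rw [neg_smul]⟩
      · exact ⟨-c, by rw [neg_smul]⟩
      · exact ⟨c, by rw [neg_neg]⟩
    · simp [partner] at h3
    · simp [partner] at h3
  choose π t a ha ha0 hψπ hdπ using hd
  refine ⟨z, Φ, π, fun i i' hii => ?_, ⟨s, hs⟩, hΦgr, hτ, hdπ⟩
  by_contra hne
  obtain ⟨u, hu⟩ := P'.division.isUnit _ _ (ha i) (ha0 i)
  -- If two indices had the same image, the corresponding basis vectors would be proportional over
  -- `D`.
  have h1 : ψ (R.basis (.inl i')) =
      ψ (op (Φ.symm ((u⁻¹ : P'.Dˣ) * a i')) • R.basis (.inl i)) := by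
    rw [hΦ, AlgEquiv.apply_symm_apply, hψπ, hψπ, ← hu, smul_smul, ← op_mul, ← mul_assoc,
      Units.mul_inv, one_mul, hii]
  have h2 := congrArg (fun x => R.basis.repr x (.inl i')) (ψ.injective h1)
  simp [Ne.symm hne] at h2

theorem equivalent [IsAlgClosed F] [Nontrivial A] (hφ : IsInvolution φ)
    (hfine : IsFinePhiGrading φ 𝒜) (R : Realization φ 𝒜 P) (R' : Realization φ 𝒜 P') :
    InvPair.Equivalent P P' := by
  obtain ⟨z, Φ, π, hπ, h1, h2, h3, h4⟩ := exists_comparison hφ hfine R R'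
  obtain ⟨-, -, π', hπ', -⟩ := exists_comparison hφ hfine R' R
  have hcard : Fintype.card (Fin P.p) = Fintype.card (Fin P'.p) :=
    le_antisymm (Fintype.card_le_of_injective _ hπ) (Fintype.card_le_of_injective _ hπ')
  exact ⟨z, Φ, Equiv.ofBijective π ((Fintype.bijective_iff_injective_and_card π).2 ⟨hπ, hcard⟩),
    h1, h2, h3, h4⟩

end Realization

/-! ### Similitudes from equivalences of pairs -/

section Semilinear

variable {F : Type*} [Field F] {D D' : Type*} [Ring D] [Algebra F D] [Ring D'] [Algebra F D']
  {V V' : Type*} [AddCommGroup V] [Module F V] [Module Dᵐᵒᵖ V] [IsScalarTower F Dᵐᵒᵖ V]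
  [AddCommGroup V'] [Module F V'] [Module D'ᵐᵒᵖ V'] [IsScalarTower F D'ᵐᵒᵖ V']
  {ι : Type*} [Fintype ι]

/-- The `Φ`-semilinear map with prescribed values on a basis. -/
noncomputable def semilinearLift (b : Module.Basis ι Dᵐᵒᵖ V) (Φ : D ≃ₐ[F] D') (w : ι → V') :
    V →ₗ[F] V' where
  toFun x := ∑ i, op (Φ (unop (b.repr x i))) • w i
  map_add' x y := by simp [add_smul, Finset.sum_add_distrib]
  map_smul' c x := by
    rw [RingHom.id_apply, Finset.smul_sum]
    refine Finset.sum_congr rfl fun i _ => ?_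
    rw [← op_algebraMap_smul (D := D) c x, map_smul, Finsupp.smul_apply, smul_eq_mul, unop_mul,
      unop_op, map_mul, AlgEquiv.commutes, op_mul, mul_smul, op_algebraMap_smul]

theorem semilinearLift_smul (b : Module.Basis ι Dᵐᵒᵖ V) (Φ : D ≃ₐ[F] D') (w : ι → V') (a : D)
    (x : V) : semilinearLift b Φ w (op a • x) = op (Φ a) • semilinearLift b Φ w x := by
  change ∑ i, _ = _ • ∑ i, _
  rw [Finset.smul_sum]
  refine Finset.sum_congr rfl fun i _ => ?_
  rw [map_smul, Finsupp.smul_apply, smul_eq_mul, unop_mul, unop_op, map_mul, op_mul, mul_smul]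

theorem semilinearLift_basis (b : Module.Basis ι Dᵐᵒᵖ V) (Φ : D ≃ₐ[F] D') (w : ι → V') (i : ι) :
    semilinearLift b Φ w (b i) = w i := by
  change ∑ j, _ = _
  rw [Finset.sum_eq_single i]
  · simp
  · intro j _ hj
    simp [hj]
  · simp

/-- The isomorphism of endomorphism rings given by conjugation with a semilinear isomorphism. -/
def semilinearConj (Φ : D ≃ₐ[F] D') (ψ : V ≃ₗ[F] V') (hψ : ∀ a x, ψ (op a • x) = op (Φ a) • ψ x) :
    Module.End Dᵐᵒᵖ V ≃ₐ[F] Module.End D'ᵐᵒᵖ V' :=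
  have hψ' : ∀ a y, ψ.symm (op a • y) = op (Φ.symm a) • ψ.symm y := fun a y => by
    rw [LinearEquiv.symm_apply_eq, hψ, AlgEquiv.apply_symm_apply, LinearEquiv.apply_symm_apply]
  { toFun := fun f =>
      { toFun := fun y => ψ (f (ψ.symm y))
        map_add' := fun y y' => by simp
        map_smul' := fun a y => by
          rw [← op_unop a, hψ', map_smul, hψ, AlgEquiv.apply_symm_apply]
          rfl }
    invFun := fun f =>
      { toFun := fun x => ψ.symm (f (ψ x))
        map_add' := fun y y' => by simp
        map_smul' := fun a x => by
          rw [← op_unop a, hψ, map_smul, hψ', AlgEquiv.symm_apply_apply]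
          rfl }
    left_inv := fun f => by ext x; simp
    right_inv := fun f => by ext x; simp
    map_mul' := fun f g => by ext x; simp
    map_add' := fun f g => by ext x; simp
    commutes' := fun c => by ext x; simp [Module.algebraMap_end_apply] }

theorem semilinearConj_apply (Φ : D ≃ₐ[F] D') (ψ : V ≃ₗ[F] V')
    (hψ : ∀ a x, ψ (op a • x) = op (Φ a) • ψ x) (f : Module.End Dᵐᵒᵖ V) (y : V') :
    semilinearConj Φ ψ hψ f y = ψ (f (ψ.symm y)) := rfl

/-- Two sesquilinear maps that agree on a basis are equal. -/
theorem sesquilinear_ext (b : Module.Basis ι Dᵐᵒᵖ V) {C C' : V →ₗ[F] V →ₗ[F] D'} {σ ρ : D → D'}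
    (hC₁ : ∀ x y a, C (op a • x) y = σ a * C x y) (hC₂ : ∀ x y a, C x (op a • y) = C x y * ρ a)
    (hC₁' : ∀ x y a, C' (op a • x) y = σ a * C' x y)
    (hC₂' : ∀ x y a, C' x (op a • y) = C' x y * ρ a)
    (h : ∀ i j, C (b i) (b j) = C' (b i) (b j)) (x y : V) : C x y = C' x y := by
  have h1 : ∀ x, ∑ i, op (unop (b.repr x i)) • b i = x := b.sum_repr
  rw [← h1 x, ← h1 y]
  simp only [map_sum, LinearMap.sum_apply]
  refine Finset.sum_congr rfl fun j _ => Finset.sum_congr rfl fun i _ => ?_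
  rw [hC₂, hC₂', hC₁, hC₁', h]

end Semilinear

namespace Realization

variable {F : Type u} [Field F] {A A' : Type*} [Ring A] [Algebra F A] [Ring A'] [Algebra F A']
  {Γ Γ' : Type*} {φ : A →ₗ[F] A} {φ' : A' →ₗ[F] A'} {𝒜 : Γ → Submodule F A}
  {𝒜' : Γ' → Submodule F A'} {P P' : InvPair F}

theorem finrank_V (R : Realization φ 𝒜 P) :
    Module.finrank F R.V = Fintype.card R.Index * Module.finrank F P.D := by
  have : Module.Finite F P.Dᵐᵒᵖ := Module.Finite.equiv (opLinearEquiv F)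
  rw [(R.basis.equivFun.restrictScalars F).finrank_eq, Module.finrank_pi_fintype]
  simp [(opLinearEquiv F (M := P.D)).finrank_eq]

theorem finrank_eq (R : Realization φ 𝒜 P) :
    Module.finrank F A = Fintype.card R.Index * Module.finrank F R.V := by
  have := IsScalarTower.to_smulCommClass' (R := F) (A := P.Dᵐᵒᵖ) (M := R.V)
  rw [R.iso.toLinearEquiv.finrank_eq, ← (R.basis.constr F (M' := R.V)).finrank_eq,
    Module.finrank_pi_fintype]
  simp

theorem card_index_eq (R : Realization φ 𝒜 P) (R' : Realization φ' 𝒜' P')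
    (Φ : P.D ≃ₐ[F] P'.D) (h : Module.finrank F A = Module.finrank F A') :
    Fintype.card R.Index = Fintype.card R'.Index := by
  have := P.division.nontrivial
  rw [R.finrank_eq, R'.finrank_eq, R.finrank_V, R'.finrank_V, ← Φ.toLinearEquiv.finrank_eq,
    ← mul_assoc, ← mul_assoc] at h
  have h1 := Nat.eq_of_mul_eq_mul_right Module.finrank_pos h
  exact Nat.mul_self_inj.1 h1

theorem basis_smul_unit_mem (R : Realization φ 𝒜 P) {i : R.Index} {a : P.D} {t : P.G}
    (ha : a ∈ P.comp t) : ∃ g, op a • R.basis i ∈ R.grading g := by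
  obtain ⟨g, hg⟩ := R.basis_homogeneous i
  exact ⟨_, R.isModuleGrading.smul_mem hg ha⟩

/-- Equality of dimensions gives the same number of hyperbolic pairs, so the bases correspond.
Scaling the images matches the values on the `vᵢ` and the values `B(xⱼ, yⱼ)`. The remaining values
`B(yⱼ, xⱼ)` are then determined by the symmetry of the two forms and agree up to one global sign.
The operator `U` records it: it is `1` on the `vᵢ` and `xⱼ`, and this sign on the `yⱼ`. -/
theorem exists_similitude [IsAlgClosed F] [CharZero F] (R : Realization φ 𝒜 P)
    (R' : Realization φ' 𝒜' P') (hfin : Module.finrank F A = Module.finrank F A')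
    (h : InvPair.Equivalent P P') :
    ∃ (z : P.Dˣ) (Φ : P.D ≃ₐ[F] P'.D) (ψ : R.V ≃ₗ[F] R'.V) (U : Module.End P.Dᵐᵒᵖ R.V),
      (∃ g, (z : P.D) ∈ P.comp g) ∧ IsGradedIso P.comp P'.comp Φ ∧
      (∀ a x, ψ (op a • x) = op (Φ a) • ψ x) ∧
      (∀ x y, R'.B (ψ x) (ψ y) = Φ (z * R.B (U x) y)) ∧ U * U = 1 ∧
      (U = 1 ∨ P.p = 0 ∧ ∀ x y, R.B (U x) y = -R.B x (U y)) ∧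
      (∀ i, ∃ k, ψ (R.basis i) ∈ R'.grading k) ∧
      ∀ i, ∃ g, ψ.symm (R'.basis i) ∈ R.grading g := by
  classical
  obtain ⟨z, Φ, π, ⟨s, hs⟩, hΦ, hτ, hd⟩ := h
  have := P.division.nontrivial
  have := P'.division.nontrivial
  have hcard := card_index_eq R R' Φ hfin
  have hss : R.s = R'.s := by
    have h1 : P.p = P'.p := by simpa using Fintype.card_congr π
    simp only [Fintype.card_sum, Fintype.card_fin, h1] at hcard
    omega
  let κ : Fin R.s ≃ Fin R'.s := finCongr hss
  let e : R.Index ≃ R'.Index := Equiv.sumCongr π (Equiv.sumCongr κ κ)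
  obtain ⟨ε, hε, hR⟩ := R.hermitian.exists_sign
  obtain ⟨ε', hε', hR'⟩ := R'.hermitian.exists_sign
  obtain ⟨δ, hδ, hz⟩ : ∃ δ : F, δ * δ = 1 ∧ P.τ z = δ • (z : P.D) := by
    rcases P.division.map_eq_or_neg P.isInvolution P.graded hs with h | h
    · exact ⟨1, by simp, by rw [h, one_smul]⟩
    · exact ⟨-1, by simp, by rw [h, neg_smul, one_smul]⟩
  have hflip : ∀ x y, P'.τ (Φ (z * R.B x y)) = (δ * ε) • Φ (z * R.B y x) := by
    intro x y
    have h1 : P.τ (R.B x y) = ε • R.B y x := by rw [hR x y, smul_smul, hε, one_smul]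
    rw [← hτ, P.isInvolution.map_mul, hz, h1, ← map_smul]
    simp [mul_assoc, smul_smul, mul_comm]
  -- The form `Φ(zB)` has sign `δε` with respect to `τ'`, and `B'` has sign `ε'`; `η₀` is their
  -- ratio.
  let η₀ : F := ε' * (δ * ε)
  have hη₀ : η₀ * η₀ = 1 := by
    linear_combination (δ * δ * ε * ε) * hε' + (ε * ε) * hδ + hε
  choose c hc using hd
  have hc0 : ∀ i, c i ≠ 0 := by
    intro i h0
    have h1 := hc i
    rw [h0, zero_smul, map_eq_zero_iff _ Φ.injective] at h1
    exact P.d_ne_zero i ((Units.mul_right_eq_zero z).1 h1)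
  have hη : P.p = 0 ∨ η₀ = 1 := by
    rcases Nat.eq_zero_or_pos P.p with h0 | h0
    · exact .inl h0
    right
    -- The nonzero elements `Φ(z dᵢ)` and `d'_{π(i)}` are proportional, so they have the same
    -- symmetry under `τ'`.
    let i : Fin P.p := ⟨0, h0⟩
    have h1 := hflip (R.basis (.inl i)) (R.basis (.inl i))
    have h2 := hR' (R'.basis (.inl (π i))) (R'.basis (.inl (π i)))
    rw [R.form_diag, hc, map_smul, smul_smul] at h1
    rw [R'.form_diag] at h2
    have h3 : (c i) • P'.d (π i) = (ε' * (δ * ε) * c i) • P'.d (π i) := by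
      conv_lhs => rw [h2, smul_smul, mul_comm, mul_smul, h1, smul_smul, ← mul_assoc]
    rw [← sub_eq_zero, ← sub_smul] at h3
    have h4 := (smul_eq_zero.1 h3).resolve_right (P'.d_ne_zero _)
    have h5 : (1 - η₀) * c i = 0 := by linear_combination h4
    exact (sub_eq_zero.1 ((mul_eq_zero.1 h5).resolve_right (hc0 i))).symm
  -- Scaling a basis vector by the scalar `r` multiplies its diagonal value by `r²`, which must be
  -- `c`.
  choose r hr using fun i => IsAlgClosed.exists_pow_nat_eq (c i) (n := 2) (by norm_num)
  have hr0 : ∀ i, r i ≠ 0 := fun i h0 => hc0 i (by rw [← hr, h0]; simp)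
  -- the scaling factors of the images of the basis vectors
  let a : R.Index → P'.Dˣ := Sum.elim (fun i => Units.map (algebraMap F P'.D) (Units.mk0 _ (hr0 i)))
    (Sum.elim (fun _ => 1) fun j =>
      Units.map (algebraMap F P'.D) (Units.mk0 ((R'.ν (κ j))⁻¹ * R.ν j)
        (mul_ne_zero (inv_ne_zero (R'.ν_ne_zero _)) (R.ν_ne_zero _))) *
      Units.map (Φ : P.D →* P'.D) z)
  have hΦz : ∃ t, Φ z ∈ P'.comp t := InvPair.exists_mem_comp_of_isGradedIso hΦ z.ne_zero hs
  have ha : ∀ i, ∃ t, (a i : P'.D) ∈ P'.comp t := by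
    rintro (i | j | j)
    · exact ⟨0, P'.division.isGrading.algebraMap_mem _⟩
    · exact ⟨0, P'.division.isGrading.one_mem⟩
    · obtain ⟨t, ht⟩ := hΦz
      exact ⟨0 + t, P'.division.isGrading.mul_mem (P'.division.isGrading.algebraMap_mem _) ht⟩
  let w : R.Index → R'.V := fun i => op (a i : P'.D) • R'.basis (e i)
  let η : R.Index → F := Sum.elim (fun _ => 1) (Sum.elim (fun _ => 1) fun _ => η₀)
  have hw : ∀ i j, R'.B (w i) (w j) = η i • Φ (z * R.B (R.basis i) (R.basis j)) := by
    have hzero : ∀ i j, i ≠ R.partner j →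
        R'.B (w i) (w j) = η i • Φ (z * R.B (R.basis i) (R.basis j)) := by
      intro i j hij
      have hij' : e i ≠ R'.partner (e j) := by
        have h1 : R'.partner (e j) = e (R.partner j) := by rcases j with j | j | j <;> rfl
        rw [h1]
        exact fun h => hij (e.injective h)
      rw [R'.sesquilinear.smul_left, R'.sesquilinear.smul_right, R'.form_eq_zero hij',
        R.form_eq_zero hij]
      simp
    have hxy : ∀ j, R'.B (w (.inr (.inl j))) (w (.inr (.inr j))) =
        Φ (z * R.B (R.basis (.inr (.inl j))) (R.basis (.inr (.inr j)))) := by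
      intro j
      rw [R'.sesquilinear.smul_left, R'.sesquilinear.smul_right]
      have h1 := R'.form_xy (κ j)
      change P'.τ 1 * (R'.B (R'.basis (.inr (.inl (κ j)))) (R'.basis (.inr (.inr (κ j)))) *
        (algebraMap F P'.D ((R'.ν (κ j))⁻¹ * R.ν j) * Φ z)) = _
      rw [h1, R.form_xy, P'.isInvolution.map_one, one_mul, ← mul_assoc, ← map_mul,
        mul_inv_cancel_left₀ (R'.ν_ne_zero _), map_mul, AlgEquiv.commutes, Algebra.commutes]
    intro i j
    by_cases hij : i = R.partner j
    · subst hij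
      rcases j with j | j | j
      · change R'.B (w (.inl j)) (w (.inl j)) = (1 : F) •
          Φ (z * R.B (R.basis (.inl j)) (R.basis (.inl j)))
        rw [R'.sesquilinear.smul_left, R'.sesquilinear.smul_right, R.form_diag, hc, one_smul]
        change P'.τ (algebraMap F P'.D (r j)) * (R'.B (R'.basis (.inl (π j)))
          (R'.basis (.inl (π j))) * algebraMap F P'.D (r j)) = _
        rw [R'.form_diag, ← Algebra.commutes, Algebra.algebraMap_eq_smul_one, map_smul,
          P'.isInvolution.map_one, ← hr]
        simp [smul_smul, pow_two]
      · change R'.B (w (.inr (.inr j))) (w (.inr (.inl j))) = η₀ •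
          Φ (z * R.B (R.basis (.inr (.inr j))) (R.basis (.inr (.inl j))))
        rw [hR' (w (.inr (.inl j))), hxy, hflip, smul_smul]
      · change R'.B (w (.inr (.inl j))) (w (.inr (.inr j))) = (1 : F) •
          Φ (z * R.B (R.basis (.inr (.inl j))) (R.basis (.inr (.inr j))))
        rw [hxy, one_smul]
    · exact hzero i j hij
  have hηη : ∀ i, η i * η i = 1 := by
    rintro (i | j | j) <;> simp [η, hη₀]
  let U : Module.End P.Dᵐᵒᵖ R.V := R.basis.constr ℕ fun i => η i • R.basis i
  have hU : ∀ i, U (R.basis i) = η i • R.basis i := fun i => R.basis.constr_basis ℕ _ i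
  have hUF : ∀ (t : F) (x : R.V), U (t • x) = t • U x := fun t x => LinearMap.map_smul_of_tower U t x
  have hUU : U * U = 1 := R.basis.ext fun i => by
    rw [Module.End.mul_apply, hU, hUF, hU, smul_smul, hηη, one_smul, Module.End.one_apply]
  let ψ₀ := semilinearLift R.basis Φ w
  have hψ₀ : ∀ i, ψ₀ (R.basis i) = w i := semilinearLift_basis R.basis Φ w
  have hψs : ∀ a x, ψ₀ (op a • x) = op (Φ a) • ψ₀ x := semilinearLift_smul R.basis Φ w
  let UF : R.V →ₗ[F] R.V := U.restrictScalars F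
  let C' : R.V →ₗ[F] R.V →ₗ[F] P'.D := (R.B.compl₁₂ UF LinearMap.id).compr₂
    (Φ.toLinearMap ∘ₗ LinearMap.mulLeft F (z : P.D))
  have hform : ∀ x y, R'.B (ψ₀ x) (ψ₀ y) = Φ (z * R.B (U x) y) := by
    intro x y
    refine sesquilinear_ext R.basis (C := R'.B.compl₁₂ ψ₀ ψ₀) (C' := C') (σ := fun a => P'.τ (Φ a))
      (ρ := Φ) ?_ ?_ ?_ ?_ ?_ x y
    · intro x y a
      simp only [LinearMap.compl₁₂_apply]
      rw [hψs, R'.sesquilinear.smul_left]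
    · intro x y a
      simp only [LinearMap.compl₁₂_apply]
      rw [hψs, R'.sesquilinear.smul_right]
    · intro x y a
      change Φ (z * R.B (U (op a • x)) y) = P'.τ (Φ a) * Φ (z * R.B (U x) y)
      rw [map_smul, R.sesquilinear.smul_left, ← hτ, ← map_mul]
      simp [mul_assoc]
    · intro x y a
      change Φ (z * R.B (U x) (op a • y)) = Φ (z * R.B (U x) y) * Φ a
      rw [R.sesquilinear.smul_right, ← mul_assoc, map_mul]
    · intro i j
      change R'.B (ψ₀ (R.basis i)) (ψ₀ (R.basis j)) = Φ (z * R.B (U (R.basis i)) (R.basis j))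
      rw [hψ₀, hψ₀, hw, hU]
      simp
  have hinj : Function.Injective ψ₀ := by
    rw [injective_iff_map_eq_zero]
    intro y hy
    refine R.sesquilinear.nondegenerate_right y fun x => ?_
    have h1 := hform (U x) y
    rw [hy, map_zero, ← Module.End.mul_apply, hUU, Module.End.one_apply, eq_comm,
      map_eq_zero_iff _ Φ.injective] at h1
    exact (Units.mul_right_eq_zero z).1 h1
  have hfr : Module.finrank F R.V = Module.finrank F R'.V := by
    rw [R.finrank_V, R'.finrank_V, hcard, Φ.toLinearEquiv.finrank_eq]
  let ψ : R.V ≃ₗ[F] R'.V := LinearEquiv.ofBijective ψ₀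
    ⟨hinj, (LinearMap.injective_iff_surjective_of_finrank_eq_finrank hfr).1 hinj⟩
  refine ⟨z, Φ, ψ, U, ⟨s, hs⟩, hΦ, hψs, hform, hUU, ?_, ?_, ?_⟩
  · by_cases h1 : η₀ = 1
    · left
      refine R.basis.ext fun i => ?_
      rw [hU, Module.End.one_apply]
      rcases i with i | i | i <;> simp [η, h1]
    · right
      have hp := hη.resolve_right h1
      have hη1 : η₀ = -1 := (mul_self_eq_one_iff.1 hη₀).resolve_left h1
      refine ⟨hp, fun x y => ?_⟩
      refine sesquilinear_ext R.basis (C := R.B.compl₁₂ UF LinearMap.id)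
        (C' := -R.B.compl₁₂ LinearMap.id UF) (σ := P.τ) (ρ := id) ?_ ?_ ?_ ?_ ?_ x y
      · intro x y a
        change R.B (U (op a • x)) y = P.τ a * R.B (U x) y
        rw [map_smul, R.sesquilinear.smul_left]
      · intro x y a
        exact R.sesquilinear.smul_right _ _ _
      · intro x y a
        change -R.B (op a • x) (U y) = P.τ a * -R.B x (U y)
        rw [R.sesquilinear.smul_left, mul_neg]
      · intro x y a
        change -R.B x (U (op a • y)) = -R.B x (U y) * a
        rw [map_smul, R.sesquilinear.smul_right, neg_mul]
      · intro i j
        change R.B (U (R.basis i)) (R.basis j) = -R.B (R.basis i) (U (R.basis j))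
        rw [hU, hU, map_smul, map_smul, LinearMap.smul_apply]
        by_cases hij : i = R.partner j
        · have h2 : η i = -η j := by
            subst hij
            rcases j with j | j | j
            · exact (Fin.cast hp j).elim0
            · exact hη1
            · change (1 : F) = -η₀
              rw [hη1, neg_neg]
          rw [h2, neg_smul]
        · rw [R.form_eq_zero hij]
          simp
  · intro i
    obtain ⟨t, ht⟩ := ha i
    have h1 : ψ (R.basis i) = w i := hψ₀ i
    rw [h1]
    exact R'.basis_smul_unit_mem ht
  · intro i
    obtain ⟨t, ht⟩ := ha (e.symm i)
    have h1 : ψ.symm (R'.basis i) =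
        op (Φ.symm ((a (e.symm i))⁻¹ : P'.Dˣ)) • R.basis (e.symm i) := by
      rw [LinearEquiv.symm_apply_eq]
      have h2 : ψ (op (Φ.symm ((a (e.symm i))⁻¹ : P'.Dˣ)) • R.basis (e.symm i)) = _ := hψs _ _
      rw [h2, hψ₀, AlgEquiv.apply_symm_apply]
      change _ = _ • (_ • _)
      rw [smul_smul, ← op_mul, Units.mul_inv, op_one, one_smul, Equiv.apply_symm_apply]
    rw [h1]
    obtain ⟨t', ht'⟩ := InvPair.exists_mem_comp_of_isGradedIso
      (InvPair.isGradedIso_symm P.division.isGrading P'.division.isGrading hΦ)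
      ((a (e.symm i))⁻¹ : P'.Dˣ).ne_zero (P'.division.isGrading.inv_mem _ ht)
    exact R.basis_smul_unit_mem ht'

end Realization

/-! ### The type of an involution and its trace -/

section Trace

variable {F : Type*} [Field F] {n : ℕ}

/-- The `(i, j)` entry of the image of the matrix unit `Eᵢⱼ` is `SᵢⱼTᵢⱼ`. -/
theorem trace_mul_transpose_mul (S T : Matrix (Fin n) (Fin n) F)
    (f : Matrix (Fin n) (Fin n) F →ₗ[F] Matrix (Fin n) (Fin n) F)
    (hf : ∀ X, f X = S * X.transpose * T) :
    LinearMap.trace F _ f = (S.transpose * T).trace := by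
  classical
  rw [LinearMap.trace_eq_matrix_trace F (Matrix.stdBasis F (Fin n) (Fin n)), Matrix.trace]
  simp only [Matrix.diag_apply, LinearMap.toMatrix_apply, hf]
  rw [Fintype.sum_prod_type, Matrix.trace, Finset.sum_comm]
  refine Finset.sum_congr rfl fun j _ => ?_
  rw [Matrix.diag_apply, Matrix.mul_apply]
  refine Finset.sum_congr rfl fun i _ => ?_
  rw [Matrix.stdBasis_eq_single, Matrix.transpose_single]
  have h1 : ∀ M : Matrix (Fin n) (Fin n) F,
      (Matrix.stdBasis F (Fin n) (Fin n)).repr M (i, j) = M i j := fun M => rfl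
  rw [h1, Matrix.mul_apply, Finset.sum_eq_single i]
  · rw [Matrix.mul_single_apply_same, Matrix.transpose_apply, mul_one]
  · intro k _ hk
    rw [Matrix.mul_single_apply_of_ne _ _ _ _ _ hk, zero_mul]
  · simp

/-- The trace of an involution `φ` that is the adjoint with respect to a bilinear form of sign `ε`,
twisted by an element `v` of square `1`, `φ(v) = -v`, is the opposite of the trace of `φ`. -/
theorem trace_twist {S v : Matrix (Fin n) (Fin n) F} {ε : F} (hS : IsUnit S)
    (hε : S.transpose = ε • S) (hε0 : ε * ε = 1)
    {φ f : Matrix (Fin n) (Fin n) F →ₗ[F] Matrix (Fin n) (Fin n) F}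
    (hφ : ∀ X, φ X = S⁻¹ * X.transpose * S) :
    LinearMap.trace F _ φ = ε * n ∧ (v * v = 1 → φ v = -v → (∀ X, f X = v * φ X * v) →
      LinearMap.trace F _ f = -(ε * n)) := by
  have hdet : IsUnit S.det := (Matrix.isUnit_iff_isUnit_det S).1 hS
  have hinv : S⁻¹.transpose = ε • S⁻¹ := by
    rw [Matrix.transpose_nonsing_inv, hε]
    refine Matrix.inv_eq_left_inv ?_
    rw [smul_mul_smul_comm, hε0, Matrix.nonsing_inv_mul _ hdet, one_smul]
  refine ⟨?_, fun hv hφv hf => ?_⟩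
  · rw [trace_mul_transpose_mul _ _ _ hφ, hinv, smul_mul_assoc, Matrix.nonsing_inv_mul _ hdet]
    simp
  · rw [trace_mul_transpose_mul (v * S⁻¹) (S * v) f
      (fun X => by rw [hf, hφ]; simp only [Matrix.mul_assoc]), Matrix.transpose_mul, hinv,
      show ε • S⁻¹ * v.transpose * (S * v) = ε • (φ v * v) by
        rw [hφ]; simp only [Matrix.mul_assoc, smul_mul_assoc], hφv, neg_mul, hv]
    simp

theorem SameType.exists_sign {φ φ' : Matrix (Fin n) (Fin n) F →ₗ[F] Matrix (Fin n) (Fin n) F}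
    (h : SameType φ φ') : ∃ ε : F, ε * ε = 1 ∧
      (∃ S : Matrix (Fin n) (Fin n) F, IsUnit S ∧ S.transpose = ε • S ∧
        ∀ X, φ X = S⁻¹ * X.transpose * S) ∧
      ∃ S : Matrix (Fin n) (Fin n) F, IsUnit S ∧ S.transpose = ε • S ∧
        ∀ X, φ' X = S⁻¹ * X.transpose * S := by
  rcases h with ⟨⟨S, h1, h2, h3⟩, S', h1', h2', h3'⟩ | ⟨⟨S, h1, h2, h3⟩, S', h1', h2', h3'⟩
  · exact ⟨1, one_mul 1, ⟨S, h1, by rw [h2, one_smul], h3⟩, S', h1', by rw [h2', one_smul], h3'⟩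
  · exact ⟨-1, by simp, ⟨S, h1, by rw [h2, neg_smul, one_smul], h3⟩, S', h1',
      by rw [h2', neg_smul, one_smul], h3'⟩

end Trace

/-! ### From similitudes to graded isomorphisms -/

namespace Realization

variable {F : Type u} [Field F] {A A' : Type*} [Ring A] [Algebra F A] [Ring A'] [Algebra F A']
  {Γ Γ' : Type*} {φ : A →ₗ[F] A} {φ' : A' →ₗ[F] A'} {𝒜 : Γ → Submodule F A}
  {𝒜' : Γ' → Submodule F A'} {P P' : InvPair F}

/-- The grading of `V'` pulled back along `ψ` makes `B` and the basis homogeneous. By fineness, each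
induced component lies in a component of the pulled back grading of the endomorphisms; `ψ` need not
be known to preserve the gradings of the modules. -/
theorem exists_forall_semilinearConj_mem [AddCommGroup Γ] (hφ : IsInvolution φ)
    (hfine : IsFinePhiGrading φ 𝒜) (R : Realization φ 𝒜 P) (R' : Realization φ' 𝒜' P') {z : P.Dˣ}
    {Φ : P.D ≃ₐ[F] P'.D} {ψ : R.V ≃ₗ[F] R'.V} (hz : ∃ g, (z : P.D) ∈ P.comp g)
    (hΦ : IsGradedIso P.comp P'.comp Φ) (hψ : ∀ a x, ψ (op a • x) = op (Φ a) • ψ x)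
    (hform : ∀ x y, R'.B (ψ x) (ψ y) = Φ (z * R.B x y))
    (hb : ∀ i, ∃ k, ψ (R.basis i) ∈ R'.grading k) (g : P.G)
    (hg : inducedGrading (D := P.D) R.grading g ≠ ⊥) :
    ∃ k, ∀ f ∈ inducedGrading (D := P.D) R.grading g,
      semilinearConj Φ ψ hψ f ∈ inducedGrading (D := P'.D) R'.grading k := by
  have := P.division.nontrivial
  obtain ⟨γ', hγ'⟩ := R'.sesquilinear.exists_degree
  obtain ⟨b', hfr, -⟩ := R.exists_frame
  obtain ⟨s, hs⟩ := hz
  obtain ⟨t, ht⟩ := InvPair.exists_mem_comp_of_isGradedIso hΦ (z⁻¹).ne_zero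
    (P.division.isGrading.inv_mem z hs)
  have h𝒱' : IsModuleGrading (fun k => (P'.comp k).comap Φ.toLinearMap)
      (fun k => (R'.grading k).comap ψ.toLinearMap) := by
    refine isModuleGrading_iff.2
      ⟨iSupIndep_comap (isModuleGrading_iff.1 R'.isModuleGrading).1 ψ, ?_⟩
    intro k l x hx a ha
    change ψ (op a • x) ∈ R'.grading (k + l)
    rw [hψ]
    exact R'.isModuleGrading.smul_mem hx ha
  have hB' : IsSesquilinear (fun k => (P'.comp k).comap Φ.toLinearMap) P.τ
      (fun k => (R'.grading k).comap ψ.toLinearMap) R.B :=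
    { R.sesquilinear with
      homogeneous := by
        -- By the similitude relation `Φ(B(x, y)) = Φ(z⁻¹)B'(ψx, ψy)`, so the degree `t` of `Φ(z⁻¹)`
        -- is added to that of `B'`.
        refine ⟨γ' + t, fun k l x hx y hy => ?_⟩
        change Φ (R.B x y) ∈ P'.comp _
        have h1 : Φ (R.B x y) = Φ (z⁻¹ : P.Dˣ) * R'.B (ψ x) (ψ y) := by
          rw [hform, ← map_mul, ← mul_assoc, Units.inv_mul, one_mul]
        rw [h1, show k + l + (γ' + t) = t + (k + l + γ') by abel]
        exact P'.division.isGrading.mul_mem ht (hγ' _ _ _ hx _ hy) }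
  obtain ⟨k, hk⟩ := exists_inducedGrading_le hφ hfine R.iso_graded R.iso_adjoint hfr
    R.sesquilinear P.division.isGrading R.isModuleGrading R.basis_homogeneous hB'
    (P'.division.isGrading.comap Φ) h𝒱' hb (fun t => by
      by_cases ht : P.comp t = ⊥
      · exact ⟨0, by rw [ht]; exact bot_le⟩
      · obtain ⟨k, hk⟩ := hΦ t ht
        exact ⟨k, by rw [← hk]; exact Submodule.le_comap_map _ _⟩) hg
  refine ⟨k, fun f hf l y hy => ?_⟩
  rw [semilinearConj_apply]
  exact hk hf l (ψ.symm y) (by simpa using hy)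

theorem isGradedIso_semilinearConj [AddCommGroup Γ] [AddCommGroup Γ'] (hφ : IsInvolution φ)
    (hφ' : IsInvolution φ')
    (hfine : IsFinePhiGrading φ 𝒜) (hfine' : IsFinePhiGrading φ' 𝒜')
    (R : Realization φ 𝒜 P) (R' : Realization φ' 𝒜' P') {z : P.Dˣ}
    {Φ : P.D ≃ₐ[F] P'.D} {ψ : R.V ≃ₗ[F] R'.V} (hz : ∃ g, (z : P.D) ∈ P.comp g)
    (hΦ : IsGradedIso P.comp P'.comp Φ) (hψ : ∀ a x, ψ (op a • x) = op (Φ a) • ψ x)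
    (hform : ∀ x y, R'.B (ψ x) (ψ y) = Φ (z * R.B x y))
    (hb : ∀ i, ∃ k, ψ (R.basis i) ∈ R'.grading k)
    (hb' : ∀ i, ∃ g, ψ.symm (R'.basis i) ∈ R.grading g) :
    IsGradedIso 𝒜 𝒜' ((R.iso.trans (semilinearConj Φ ψ hψ)).trans R'.iso.symm) := by
  have := P.division.nontrivial
  refine InvPair.isGradedIso_trans (InvPair.isGradedIso_trans R.iso_graded
    (isGradedIso_of_le R.isGrading_induced
      (exists_forall_semilinearConj_mem hφ hfine R R' hz hΦ hψ hform hb) ?_))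
    (InvPair.isGradedIso_symm hfine'.1.isGrading R'.isGrading_induced R'.iso_graded)
  obtain ⟨s, hs⟩ := hz
  have hψ' : ∀ a x, ψ.symm (op a • x) = op (Φ.symm a) • ψ.symm x := fun a y => by
    rw [LinearEquiv.symm_apply_eq, hψ, AlgEquiv.apply_symm_apply, LinearEquiv.apply_symm_apply]
  exact exists_forall_semilinearConj_mem (z := Units.map (Φ : P.D →* P'.D) z⁻¹) (Φ := Φ.symm)
    (ψ := ψ.symm) hφ' hfine' R' R
    (InvPair.exists_mem_comp_of_isGradedIso hΦ (z⁻¹).ne_zero (P.division.isGrading.inv_mem z hs))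
    (InvPair.isGradedIso_symm P.division.isGrading P'.division.isGrading hΦ) hψ'
    (fun x y => by
      obtain ⟨x, rfl⟩ := ψ.surjective x
      obtain ⟨y, rfl⟩ := ψ.surjective y
      rw [hform]
      simp) hb'

/-- The involution that `φ'` induces by means of a similitude, up to the twist `U`. -/
theorem map_mul_twist (R : Realization φ 𝒜 P) (R' : Realization φ' 𝒜' P') {z : P.Dˣ}
    {Φ : P.D ≃ₐ[F] P'.D} {ψ : R.V ≃ₗ[F] R'.V} {U : Module.End P.Dᵐᵒᵖ R.V}
    (hψ : ∀ a x, ψ (op a • x) = op (Φ a) • ψ x)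
    (hform : ∀ x y, R'.B (ψ x) (ψ y) = Φ (z * R.B (U x) y)) {Θ : A ≃ₐ[F] A'}
    (hΘ : Θ = (R.iso.trans (semilinearConj Φ ψ hψ)).trans R'.iso.symm) (r : A) :
    φ r * φ (R.iso.symm U) = φ (R.iso.symm U) * Θ.symm (φ' (Θ r)) := by
  have hΘ' : ∀ r x, R'.iso (Θ r) (ψ x) = ψ (R.iso r x) := fun r x => by
    simp [hΘ, semilinearConj_apply]
  obtain ⟨c, hc⟩ : ∃ c, Θ c = φ' (Θ r) := Θ.surjective _
  rw [← hc, AlgEquiv.symm_apply_apply]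
  apply R.iso.injective
  ext y
  rw [← sub_eq_zero]
  refine R.sesquilinear.nondegenerate_right _ fun x => ?_
  have h1 := R'.iso_adjoint (Θ r) (ψ x) (ψ y)
  have hU : R.iso (R.iso.symm U) = U := R.iso.apply_symm_apply U
  rw [← hc, hΘ', hΘ', hform, hform] at h1
  have h2 := Φ.injective h1
  rw [Units.mul_right_inj, ← hU, R.iso_adjoint, R.iso_adjoint, R.iso_adjoint] at h2
  rw [map_sub, map_mul, map_mul, Module.End.mul_apply, Module.End.mul_apply, h2, sub_self]

end Realization

/-- If `U = 1`, conjugation with the similitude is the required isomorphism. Otherwise the tuple is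
empty, and traces show that the two involutions are of different types. -/
theorem exists_isGradedIso_of_equivalent {F : Type u} [Field F] [IsAlgClosed F] [CharZero F] {n : ℕ}
    (hn : 1 ≤ n) {G₁ : Type*} [AddCommGroup G₁] {G₂ : Type*} [AddCommGroup G₂]
    {φ₁ φ₂ : Matrix (Fin n) (Fin n) F →ₗ[F] Matrix (Fin n) (Fin n) F}
    (hφ₁ : IsInvolution φ₁) (hφ₂ : IsInvolution φ₂)
    {Γ₁ : G₁ → Submodule F (Matrix (Fin n) (Fin n) F)}
    {Γ₂ : G₂ → Submodule F (Matrix (Fin n) (Fin n) F)}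
    (hΓ₁ : IsFinePhiGrading φ₁ Γ₁) (hΓ₂ : IsFinePhiGrading φ₂ Γ₂) {P P' : InvPair F}
    (R : Realization φ₁ Γ₁ P) (R' : Realization φ₂ Γ₂ P') (h : InvPair.Equivalent P P')
    (htype : P.p ≠ 0 ∨ SameType φ₁ φ₂) :
    ∃ Φ : Matrix (Fin n) (Fin n) F ≃ₐ[F] Matrix (Fin n) (Fin n) F,
      IsGradedIso Γ₁ Γ₂ Φ ∧ ∀ x, Φ (φ₁ (Φ.symm x)) = φ₂ x := by
  obtain ⟨z, Φ, ψ, U, hz, hΦ, hψ, hform, hUU, hU, hb, hb'⟩ := R.exists_similitude R' rfl h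
  have htw := R.map_mul_twist R' hψ hform rfl
  generalize hΘ : (R.iso.trans (semilinearConj Φ ψ hψ)).trans R'.iso.symm = Θ at htw
  rcases hU with hU | ⟨hp, hU⟩
  · subst hU
    refine ⟨Θ, ?_, ?_⟩
    · rw [← hΘ]
      exact R.isGradedIso_semilinearConj hφ₁ hφ₂ hΓ₁ hΓ₂ R' hz hΦ hψ hform hb hb'
    · intro x
      have h1 := htw (Θ.symm x)
      rw [map_one, hφ₁.map_one, mul_one, one_mul, AlgEquiv.apply_symm_apply] at h1
      rw [h1, AlgEquiv.apply_symm_apply]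
  · exfalso
    obtain ⟨ε, hε, ⟨S, hS, hSε, hφS⟩, S', hS', hSε', hφS'⟩ :=
      (htype.resolve_left (not_not.2 hp)).exists_sign
    have hv : R.iso.symm U * R.iso.symm U = 1 := by rw [← map_mul, hUU, map_one]
    have hφv : φ₁ (R.iso.symm U) = -R.iso.symm U := by
      apply R.iso.injective
      ext y
      rw [← sub_eq_zero]
      refine R.sesquilinear.nondegenerate_right _ fun x => ?_
      rw [map_sub, ← R.iso_adjoint, AlgEquiv.apply_symm_apply, hU, map_neg,
        AlgEquiv.apply_symm_apply, LinearMap.neg_apply, map_neg, sub_self]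
    generalize R.iso.symm U = v at hv hφv htw
    -- The involution `φ₂`, transported by `Θ`, is `X ↦ vφ₁(X)v`, of trace `-εn`. Being conjugate to
    -- `φ₂`, it also has trace `εn`.
    have h1 := (trace_twist (v := v) (f := Θ.symm.toLinearMap ∘ₗ φ₂ ∘ₗ Θ.toLinearMap) hS hSε hε
      hφS).2 hv hφv (fun X => by
        have h2 := htw X
        rw [hφv, mul_neg, neg_mul, neg_inj] at h2
        rw [mul_assoc, h2, ← mul_assoc, hv, one_mul]
        rfl)
    have h2 : LinearMap.trace F _ (Θ.symm.toLinearMap ∘ₗ φ₂ ∘ₗ Θ.toLinearMap) = ε * n := by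
      rw [← (trace_twist (v := 0) (f := 0) hS' hSε' hε hφS').1]
      exact LinearMap.trace_conj' φ₂ Θ.symm.toLinearEquiv
    rw [h2] at h1
    have h3 : ε * n = 0 := by linear_combination h1 / 2
    have hn0 : (n : F) ≠ 0 := by
      rw [Nat.cast_ne_zero]
      omega
    have hε0 : ε ≠ 0 := by
      rintro rfl
      simp at hε
    exact mul_ne_zero hε0 hn0 h3

/-! ### Homogeneous orthogonal families and bases -/

section OrthogonalFamily

variable {F : Type*} [Field F] {D : Type*} [Ring D] [Algebra F D] {V : Type*} [AddCommGroup V]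
  [Module F V] [Module Dᵐᵒᵖ V] [IsScalarTower F Dᵐᵒᵖ V] {G : Type*} [AddCommGroup G]
  {𝒟 : G → Submodule F D} {τ : D →ₗ[F] D} {𝒱 : G → Submodule F V} {B : V →ₗ[F] V →ₗ[F] D} {ν : F}

/-- The involution of `ι ⊕ (κ ⊕ κ)` that fixes `ι` and interchanges the copies of `κ`. -/
def swapPairs {ι κ : Type*} : ι ⊕ (κ ⊕ κ) → ι ⊕ (κ ⊕ κ) := Sum.map id Sum.swap

theorem swapPairs_swapPairs {ι κ : Type*} (i : ι ⊕ (κ ⊕ κ)) : swapPairs (swapPairs i) = i := by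
  rcases i with i | i | i <;> rfl

/-- A homogeneous family in which the only nonzero values of the form are those that are
prescribed for a distinguished basis. -/
structure IsOrthogonalFamily (𝒱 : G → Submodule F V) (B : V →ₗ[F] V →ₗ[F] D) (ν : F)
    {ι κ : Type*} (b : ι ⊕ (κ ⊕ κ) → V) : Prop where
  homogeneous : ∀ i, ∃ g, b i ∈ 𝒱 g
  form_zero : ∀ i j, i ≠ swapPairs j → B (b i) (b j) = 0
  form_diag : ∀ i, B (b (.inl i)) (b (.inl i)) * B (b (.inl i)) (b (.inl i)) = 1
  form_pair : ∀ j, B (b (.inr (.inl j))) (b (.inr (.inr j))) = algebraMap F D ν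
  form_pair' : ∀ j, B (b (.inr (.inr j))) (b (.inr (.inl j))) = algebraMap F D ν⁻¹

variable {ι κ : Type*} {b : ι ⊕ (κ ⊕ κ) → V}

theorem IsOrthogonalFamily.isUnit (h : IsOrthogonalFamily 𝒱 B ν b) (hν : ν ≠ 0)
    (i : ι ⊕ (κ ⊕ κ)) : IsUnit (B (b (swapPairs i)) (b i)) := by
  rcases i with i | i | i
  · exact ⟨⟨_, _, h.form_diag i, h.form_diag i⟩, rfl⟩
  · exact (h.form_pair' i) ▸ (IsUnit.mk0 _ (inv_ne_zero hν)).map _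
  · exact (h.form_pair i) ▸ (IsUnit.mk0 _ hν).map _

theorem IsOrthogonalFamily.linearIndependent [Fintype ι] [Fintype κ]
    (h : IsOrthogonalFamily 𝒱 B ν b) (hν : ν ≠ 0) (hB : ∀ x y a, B x (op a • y) = B x y * a) :
    LinearIndependent Dᵐᵒᵖ b := by
  rw [Fintype.linearIndependent_iff]
  intro g hg i
  have h1 : B (b (swapPairs i)) (∑ j, g j • b j) = 0 := by rw [hg, map_zero]
  rw [map_sum, Finset.sum_eq_single i] at h1
  · rw [← op_unop (g i), hB] at h1
    obtain ⟨u, hu⟩ := h.isUnit hν i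
    rw [← hu, Units.mul_right_eq_zero] at h1
    rw [← op_unop (g i), h1, op_zero]
  · intro j _ hj
    rw [← op_unop (g j), hB, h.form_zero, zero_mul]
    exact fun h' => hj (by rw [← swapPairs_swapPairs i, h', swapPairs_swapPairs])
  · simp

/-- The orthogonal projection onto the span of the family preserves degrees. -/
theorem IsOrthogonalFamily.exists_dual [Nontrivial D] [Fintype ι] [Fintype κ]
    (h : IsOrthogonalFamily 𝒱 B ν b) (hν : ν ≠ 0) (h𝒟 : IsGrading 𝒟) (hτ : IsInvolution τ)
    (h𝒱 : IsModuleGrading 𝒟 𝒱) (hB : IsSesquilinear 𝒟 τ 𝒱 B) :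
    ∃ b' : ι ⊕ (κ ⊕ κ) → V, ∀ g, ∀ x ∈ 𝒱 g,
      (∑ i, op (B (b' i) x) • b i) ∈ 𝒱 g ∧
      ∀ j, B (b j) (x - ∑ i, op (B (b' i) x) • b i) = 0 := by
  obtain ⟨γ, hγ⟩ := hB.exists_degree
  choose u hu using h.isUnit hν
  have hform : ∀ i x, B (op (τ ((u i)⁻¹ : Dˣ)) • b (swapPairs i)) x =
      ((u i)⁻¹ : Dˣ) * B (b (swapPairs i)) x := fun i x => by rw [hB.smul_left, hτ.invol]
  refine ⟨fun i => op (τ ((u i)⁻¹ : Dˣ)) • b (swapPairs i), fun g x hx => ⟨?_, fun j => ?_⟩⟩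
  · refine sum_mem fun i _ => ?_
    obtain ⟨k, hk⟩ := h.homogeneous i
    obtain ⟨l, hl⟩ := h.homogeneous (swapPairs i)
    have h1 := h𝒟.inv_mem (u i) (hu i ▸ hγ _ _ _ hl _ hk)
    have h2 := h𝒱.smul_mem hk (h𝒟.mul_mem h1 (hγ _ _ _ hl _ hx))
    rw [hform]
    rwa [show k + (-(l + k + γ) + (l + g + γ)) = g by abel] at h2
  · rw [map_sub, map_sum, Finset.sum_eq_single (swapPairs j)]
    · rw [hB.smul_right, hform, swapPairs_swapPairs]
      have h3 := hu (swapPairs j)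
      rw [swapPairs_swapPairs] at h3
      rw [← h3, ← mul_assoc, Units.mul_inv, one_mul, sub_self]
    · intro i _ hi
      rw [hB.smul_right, h.form_zero, zero_mul]
      exact fun h' => hi (by rw [h', swapPairs_swapPairs])
    · simp

variable (hH : ∀ x y, B x y = 0 → B y x = 0)
include hH

theorem IsOrthogonalFamily.insert (h : IsOrthogonalFamily 𝒱 B ν b) {x : V} {g : G} (hx : x ∈ 𝒱 g)
    (hxb : ∀ i, B (b i) x = 0) (hxx : B x x * B x x = 1) :
    IsOrthogonalFamily 𝒱 B ν (ι := Option ι)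
      (Sum.elim (fun o => o.elim x fun i => b (.inl i)) fun j => b (.inr j)) := by
  have hcase : ∀ i : Option ι ⊕ (κ ⊕ κ), i = .inl none ∨ ∃ i', i = Sum.map some id i' := by
    rintro ((_ | i) | j)
    · exact .inl rfl
    · exact .inr ⟨.inl i, rfl⟩
    · exact .inr ⟨.inr j, rfl⟩
  have hb : ∀ i', Sum.elim (fun o : Option ι => o.elim x fun i => b (.inl i))
      (fun j => b (.inr j)) (Sum.map some id i') = b i' := by
    rintro (i | j) <;> rfl
  refine ⟨fun i => ?_, fun i j hij => ?_, ?_, fun j => h.form_pair j, fun j => h.form_pair' j⟩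
  · rcases hcase i with rfl | ⟨i', rfl⟩
    · exact ⟨g, hx⟩
    · rw [hb]
      exact h.homogeneous i'
  · rcases hcase i with rfl | ⟨i', rfl⟩ <;> rcases hcase j with rfl | ⟨j', rfl⟩
    · exact absurd rfl hij
    · rw [hb]
      exact hH _ _ (hxb j')
    · rw [hb]
      exact hxb i'
    · rw [hb, hb]
      refine h.form_zero _ _ ?_
      rintro rfl
      apply hij
      rcases j' with j' | j' | j' <;> rfl
  · rintro (_ | i)
    · exact hxx
    · exact h.form_diag i

theorem IsOrthogonalFamily.insert_pair (h : IsOrthogonalFamily 𝒱 B ν b) {x y : V} {g g' : G}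
    (hx : x ∈ 𝒱 g) (hxb : ∀ i, B (b i) x = 0) (hy : y ∈ 𝒱 g') (hyb : ∀ i, B (b i) y = 0)
    (hxx : B x x = 0) (hyy : B y y = 0) (hxy : B x y = algebraMap F D ν)
    (hyx : B y x = algebraMap F D ν⁻¹) :
    IsOrthogonalFamily 𝒱 B ν (κ := Option κ)
      (Sum.elim (fun i => b (.inl i)) (Sum.elim (fun o => o.elim x fun j => b (.inr (.inl j)))
        fun o => o.elim y fun j => b (.inr (.inr j)))) := by
  set b₁ : ι ⊕ (Option κ ⊕ Option κ) → V := Sum.elim (fun i => b (.inl i))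
    (Sum.elim (fun o => o.elim x fun j => b (.inr (.inl j)))
      fun o => o.elim y fun j => b (.inr (.inr j))) with hb₁
  have hcase : ∀ i : ι ⊕ (Option κ ⊕ Option κ), i = .inr (.inl none) ∨ i = .inr (.inr none) ∨
      ∃ i', i = Sum.map id (Sum.map some some) i' := by
    rintro (i | (_ | i) | (_ | i))
    · exact .inr (.inr ⟨.inl i, rfl⟩)
    · exact .inl rfl
    · exact .inr (.inr ⟨.inr (.inl i), rfl⟩)
    · exact .inr (.inl rfl)
    · exact .inr (.inr ⟨.inr (.inr i), rfl⟩)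
  have hb : ∀ i', b₁ (Sum.map id (Sum.map some some) i') = b i' := by
    rintro (i | j | j) <;> rfl
  refine ⟨fun i => ?_, fun i j hij => ?_, fun i => h.form_diag i, ?_, ?_⟩
  · rcases hcase i with rfl | rfl | ⟨i', rfl⟩
    · exact ⟨g, hx⟩
    · exact ⟨g', hy⟩
    · rw [hb]
      exact h.homogeneous i'
  · rcases hcase i with rfl | rfl | ⟨i', rfl⟩ <;> rcases hcase j with rfl | rfl | ⟨j', rfl⟩
    · exact hxx
    · exact absurd rfl hij
    · rw [hb]
      exact hH _ _ (hxb j')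
    · exact absurd rfl hij
    · exact hyy
    · rw [hb]
      exact hH _ _ (hyb j')
    · rw [hb]
      exact hxb i'
    · rw [hb]
      exact hyb i'
    · rw [hb, hb]
      refine h.form_zero _ _ ?_
      rintro rfl
      apply hij
      rcases j' with j' | j' | j' <;> rfl
  · rintro (_ | i)
    · exact hxy
    · exact h.form_pair i
  · rintro (_ | i)
    · exact hyx
    · exact h.form_pair' i

omit hH in
theorem IsOrthogonalFamily.reindex {ι' κ' : Type*} (h : IsOrthogonalFamily 𝒱 B ν b) (e : ι' ≃ ι)
    (f : κ' ≃ κ) :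
    IsOrthogonalFamily 𝒱 B ν (b ∘ Equiv.sumCongr e (Equiv.sumCongr f f)) := by
  refine ⟨fun i => h.homogeneous _, fun i j hij => h.form_zero _ _ fun h' => hij ?_,
    fun i => h.form_diag _, fun i => h.form_pair _, fun i => h.form_pair' _⟩
  apply (Equiv.sumCongr e (Equiv.sumCongr f f)).injective
  rw [h']
  rcases j with j | j | j <;> rfl

end OrthogonalFamily

section Existence

variable {F : Type*} [Field F] [IsAlgClosed F] {D : Type*} [Ring D] [Algebra F D] {V : Type*}
  [AddCommGroup V]
  [Module F V] [Module Dᵐᵒᵖ V] [IsScalarTower F Dᵐᵒᵖ V] {G : Type*} [AddCommGroup G]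
  {𝒟 : G → Submodule F D} {τ : D →ₗ[F] D} {𝒱 : G → Submodule F V} {B : V →ₗ[F] V →ₗ[F] D}

/-- In a family of maximal length, every homogeneous vector orthogonal to it is isotropic, as
otherwise it could be normalized and adjoined. If the orthogonal complement were nonzero,
nondegeneracy would yield a hyperbolic pair to adjoin. So the family spans. -/
theorem exists_orthogonal_basis [FiniteDimensional F V] (hD : IsCentralGradedDivision 𝒟)
    (hτ : IsInvolution τ) (hgr : ∀ g, (𝒟 g).map τ = 𝒟 g) (h𝒱 : IsModuleGrading 𝒟 𝒱)
    (hB : IsSesquilinear 𝒟 τ 𝒱 B) (hH : IsHermitianOrSkew τ B) :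
    ∃ (ν : F) (p s : ℕ) (b : Module.Basis (Fin p ⊕ (Fin s ⊕ Fin s)) Dᵐᵒᵖ V), ν ≠ 0 ∧
      IsOrthogonalFamily 𝒱 B ν b ∧
      ∃ b' : Fin p ⊕ (Fin s ⊕ Fin s) → V, ∀ x, ∑ i, op (B (b' i) x) • b i = x := by
  classical
  have := hD.nontrivial
  obtain ⟨ε, hε, hεB⟩ := hH.exists_sign
  -- If `B(x, y) = ν`, then `B(y, x) = εν`. The choice `ν² = ε` makes this `ν⁻¹`, as `ε² = 1`.
  obtain ⟨ν, hν⟩ := IsAlgClosed.exists_pow_nat_eq ε (n := 2) (by norm_num)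
  have hν0 : ν ≠ 0 := by
    rintro rfl
    rw [← hν] at hε
    simp at hε
  have hsymm : ∀ x y, B x y = 0 → B y x = 0 := fun x y h => by rw [hεB, h, map_zero, smul_zero]
  have hτF : ∀ c : F, τ (algebraMap F D c) = algebraMap F D c := fun c => by
    rw [Algebra.algebraMap_eq_smul_one, map_smul, hτ.map_one]
  obtain ⟨γ, hγ⟩ := hB.exists_degree
  -- a family of maximal length
  let S : Set ℕ := {N | ∃ (p s : ℕ) (b : Fin p ⊕ (Fin s ⊕ Fin s) → V),
    IsOrthogonalFamily 𝒱 B ν b ∧ N = p + (s + s)}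
  have hS₀ : 0 ∈ S := ⟨0, 0, fun _ => 0, ⟨fun _ => ⟨0, zero_mem _⟩, fun i => by
    rcases i with i | i | i <;> exact i.elim0, fun i => i.elim0, fun i => i.elim0,
    fun i => i.elim0⟩, rfl⟩
  have hSb : ∀ N ∈ S, N ≤ Module.finrank F V := by
    rintro N ⟨p, s, b, hb, rfl⟩
    have h1 : LinearIndependent F b :=
      (hb.linearIndependent hν0 hB.smul_right).restrict_scalars (R := F) (fun c c' h => by
        simpa using h)
    simpa using h1.fintype_card_le_finrank
  obtain ⟨N, ⟨p, s, b, hb, hN⟩, hmax⟩ : ∃ N ∈ S, ∀ M ∈ S, M ≤ N :=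
    ⟨_, Nat.sSup_mem ⟨0, hS₀⟩ ⟨_, hSb⟩, fun M hM => le_csSup ⟨_, hSb⟩ hM⟩
  have hno₁ : ∀ b' : Option (Fin p) ⊕ (Fin s ⊕ Fin s) → V, ¬ IsOrthogonalFamily 𝒱 B ν b' := by
    intro b' hb'
    have h1 := hmax _ ⟨p + 1, s, _, hb'.reindex (finSuccEquiv p) (Equiv.refl _), rfl⟩
    omega
  have hno₂ : ∀ b' : Fin p ⊕ (Option (Fin s) ⊕ Option (Fin s)) → V,
      ¬ IsOrthogonalFamily 𝒱 B ν b' := by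
    intro b' hb'
    have h1 := hmax _ ⟨p, s + 1, _, hb'.reindex (Equiv.refl _) (finSuccEquiv s), rfl⟩
    omega
  have hiso : ∀ g, ∀ x ∈ 𝒱 g, (∀ i, B (b i) x = 0) → B x x = 0 := by
    intro g x hx hxb
    by_contra hxx
    have hmem := hγ _ _ _ hx _ hx
    obtain ⟨c, hc0, hc⟩ := hD.exists_mul_self_eq hτ hgr hmem hxx
    -- Scaling `x` by `r` multiplies `B(x, x)` by `r²` and its square `c` by `r⁴`.
    obtain ⟨r, hr⟩ := IsAlgClosed.exists_pow_nat_eq c⁻¹ (n := 4) (by norm_num)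
    refine hno₁ _ (hb.insert hsymm (Submodule.smul_mem _ r hx)
      (fun i => by rw [map_smul, hxb, smul_zero]) ?_)
    rw [map_smul, map_smul, LinearMap.smul_apply, smul_smul, smul_mul_smul_comm, hc,
      show r * r * (r * r) = c⁻¹ by rw [← hr]; ring, Algebra.algebraMap_eq_smul_one, smul_smul, inv_mul_cancel₀ hc0, one_smul]
  obtain ⟨b', hb'⟩ := hb.exists_dual hν0 hD.isGrading hτ h𝒱 hB
  have hexp : ∀ g, ∀ x ∈ 𝒱 g, ∑ i, op (B (b' i) x) • b i = x := by
    intro g x hx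
    obtain ⟨h1, h2⟩ := hb' g x hx
    by_contra hne
    have hx₁ := sub_mem hx h1
    generalize hx₁' : x - ∑ i, op (B (b' i) x) • b i = x₁ at hx₁ h2
    have hx₁0 : x₁ ≠ 0 := by
      rw [← hx₁']
      exact sub_ne_zero.2 (Ne.symm hne)
    -- a homogeneous vector that is not orthogonal to `x₁`
    obtain ⟨k, y, hy, hxy⟩ : ∃ k, ∃ y ∈ 𝒱 k, B x₁ y ≠ 0 := by
      by_contra hcon
      push Not at hcon
      refine hx₁0 (hB.nondegenerate_left _ fun y => ?_)
      have hy : y ∈ iSup 𝒱 := by rw [h𝒱.iSup_eq]; trivial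
      induction hy using Submodule.iSup_induction' with
      | mem k y hy => exact hcon k y hy
      | zero => simp
      | add y z _ _ hy hz => rw [map_add, hy, hz, add_zero]
    obtain ⟨h3, h4⟩ := hb' k y hy
    have hy₁ := sub_mem hy h3
    have hxy₁ : B x₁ (y - ∑ i, op (B (b' i) y) • b i) = B x₁ y := by
      rw [map_sub, map_sum, sub_eq_self]
      refine Finset.sum_eq_zero fun i _ => ?_
      rw [hB.smul_right, hsymm _ _ (h2 i), zero_mul]
    rw [← hxy₁] at hxy
    generalize y - ∑ i, op (B (b' i) y) • b i = y₁ at hy₁ h4 hxy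
    have hmem := hγ _ _ _ hx₁ _ hy₁
    obtain ⟨u, hu⟩ := hD.isUnit _ _ hmem hxy
    -- The second vector is scaled by `νu⁻¹`, where `u` is the value of the form, so that the
    -- pairing becomes `ν`.
    have hinv := Submodule.smul_mem _ ν (hD.isGrading.inv_mem u (hu ▸ hmem))
    have hpair : B x₁ (op (ν • ((u⁻¹ : Dˣ) : D)) • y₁) = algebraMap F D ν := by
      rw [hB.smul_right, ← hu, mul_smul_comm, Units.mul_inv, Algebra.algebraMap_eq_smul_one]
    have hy₂ := h𝒱.smul_mem hy₁ hinv
    have horth : ∀ i, B (b i) (op (ν • ((u⁻¹ : Dˣ) : D)) • y₁) = 0 := fun i => by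
      rw [hB.smul_right, h4, zero_mul]
    refine hno₂ _ (hb.insert_pair hsymm hx₁ h2 hy₂ horth (hiso _ _ hx₁ h2) (hiso _ _ hy₂ horth)
      hpair ?_)
    rw [hεB, hpair, hτF, Algebra.algebraMap_eq_smul_one, Algebra.algebraMap_eq_smul_one,
      smul_smul]
    congr 1
    refine eq_inv_of_mul_eq_one_left ?_
    rw [← hε, ← hν]
    ring
  have hexp' : ∀ x, ∑ i, op (B (b' i) x) • b i = x := by
    intro x
    have hx : x ∈ iSup 𝒱 := by rw [h𝒱.iSup_eq]; trivial
    induction hx using Submodule.iSup_induction' with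
    | mem g x hx => exact hexp g x hx
    | zero => simp
    | add x y _ _ hx hy =>
      conv_rhs => rw [← hx, ← hy]
      simp [add_smul, Finset.sum_add_distrib]
  have hspan : ⊤ ≤ Submodule.span Dᵐᵒᵖ (Set.range b) := by
    rintro x -
    rw [← hexp' x]
    exact sum_mem fun i _ => Submodule.smul_mem _ _ (Submodule.subset_span ⟨i, rfl⟩)
  refine ⟨ν, p, s, Module.Basis.mk (hb.linearIndependent hν0 hB.smul_right) hspan, hν0, ?_, b', ?_⟩
  · rwa [Module.Basis.coe_mk]
  · rwa [Module.Basis.coe_mk]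

end Existence

/-! ### Simple graded algebras and minimal idempotents -/

section SimpleRing

variable {F : Type*} [Field F] {A : Type*} [Ring A] [Algebra F A] [IsSimpleRing A]

/-- A subset closed under the operations of a two-sided ideal that does not contain `1` is zero. -/
theorem eq_zero_of_mem_ideal {S : Set A} (h0 : 0 ∈ S) (hadd : ∀ x ∈ S, ∀ y ∈ S, x + y ∈ S)
    (hl : ∀ a, ∀ x ∈ S, a * x ∈ S) (hr : ∀ a, ∀ x ∈ S, x * a ∈ S) (h1 : 1 ∉ S) {x : A}
    (hx : x ∈ S) : x = 0 := by
  let I : TwoSidedIdeal A := TwoSidedIdeal.mk' S h0 (fun hx hy => hadd _ hx _ hy)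
    (fun {x} hx => by simpa using hl (-1) x hx) (fun hy => hl _ _ hy) (fun hx => hr _ _ hx)
  have hI : ∀ y, y ∈ I ↔ y ∈ S := fun y => TwoSidedIdeal.mem_mk' _ _ _ _ _ _ _
  rcases eq_bot_or_eq_top I with h | h
  · have h2 := (hI x).2 hx
    rw [h] at h2
    exact (TwoSidedIdeal.mem_bot A).1 h2
  · exact absurd ((hI 1).1 (by rw [h]; trivial)) h1

theorem exists_mul_mul_ne_zero {x y : A} (hx : x ≠ 0) (hy : y ≠ 0) : ∃ a, x * a * y ≠ 0 := by
  by_contra hcon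
  push Not at hcon
  refine hy (eq_zero_of_mem_ideal (S := {y | ∀ a, x * a * y = 0}) ?_ ?_ ?_ ?_ ?_ hcon)
  · simp
  · intro y hy z hz a
    rw [mul_add, hy, hz, add_zero]
  · intro b y hy a
    rw [← mul_assoc, mul_assoc x, hy]
  · intro b y hy a
    rw [← mul_assoc, hy, zero_mul]
  · intro h
    exact hx (by simpa using h 1)

variable [FiniteDimensional F A] [CharZero F]

/-- The trace form of the regular representation is nondegenerate. -/
theorem exists_trace_mulLeft_ne_zero {x : A} (hx : x ≠ 0) :
    ∃ y, LinearMap.trace F A (LinearMap.mulLeft F (x * y)) ≠ 0 := by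
  have hcomm : ∀ a b : A, LinearMap.trace F A (LinearMap.mulLeft F (a * b)) =
      LinearMap.trace F A (LinearMap.mulLeft F (b * a)) := fun a b => by
    rw [LinearMap.mulLeft_mul, LinearMap.mulLeft_mul]
    exact LinearMap.trace_mul_comm F _ _
  have hadd : ∀ a b : A, LinearMap.mulLeft F (a + b) = LinearMap.mulLeft F a +
      LinearMap.mulLeft F b := fun a b => by
    ext
    simp [add_mul]
  by_contra hcon
  push Not at hcon
  refine hx (eq_zero_of_mem_ideal
    (S := {x | ∀ y, LinearMap.trace F A (LinearMap.mulLeft F (x * y)) = 0}) ?_ ?_ ?_ ?_ ?_ hcon)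
  · simp
  · intro a ha b hb y
    rw [add_mul, hadd, map_add, ha, hb, add_zero]
  · intro a b hb y
    rw [mul_assoc, hcomm, mul_assoc, hb]
  · intro a b hb y
    rw [mul_assoc, hb]
  · intro h
    have h1 := h 1
    rw [mul_one, LinearMap.mulLeft_one, LinearMap.trace_id, Nat.cast_eq_zero] at h1
    exact Module.finrank_pos.ne' h1

variable {G : Type*} [AddCommGroup G] {𝒜 : G → Submodule F A}

/-- By nondegeneracy of the trace form, some homogeneous `y` gives `xy` nonzero trace.
Multiplication by an element of nonzero degree shifts components and has trace zero, and so has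
multiplication by a nilpotent element. -/
theorem exists_not_isNilpotent_mul (h𝒜 : IsGrading 𝒜) {g : G} {x : A} (hx : x ∈ 𝒜 g)
    (hx0 : x ≠ 0) : ∃ y ∈ 𝒜 (-g), ¬ IsNilpotent (x * y) := by
  classical
  obtain ⟨y, hy⟩ := exists_trace_mulLeft_ne_zero (F := F) hx0
  obtain ⟨h, y, hy, hxy⟩ : ∃ h, ∃ y ∈ 𝒜 h,
      LinearMap.trace F A (LinearMap.mulLeft F (x * y)) ≠ 0 := by
    by_contra hcon
    push Not at hcon
    apply hy
    have hmem : y ∈ iSup 𝒜 := by rw [h𝒜.iSup_eq]; trivial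
    clear hy
    induction hmem using Submodule.iSup_induction' with
    | mem h y hy => exact hcon h y hy
    | zero => simp
    | add y z _ _ hy hz =>
      have : LinearMap.mulLeft F (x * (y + z)) = LinearMap.mulLeft F (x * y) +
          LinearMap.mulLeft F (x * z) := by
        ext
        simp [mul_add, add_mul, mul_assoc]
      rw [this, map_add, hy, hz, add_zero]
  have hgh : h = -g := by
    by_contra hne
    refine hxy (LinearMap.trace_eq_zero_of_mapsTo_ne (isInternal_iff.2 (isGrading_iff.1 h𝒜).1)
      (fun k => g + h + k) (fun k hk => hne ?_) (fun k a ha => ?_))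
    · exact eq_neg_of_add_eq_zero_right (by simpa using hk)
    · exact h𝒜.mul_mem (h𝒜.mul_mem hx hy) ha
  subst hgh
  refine ⟨y, hy, fun hnil => hxy ?_⟩
  refine IsNilpotent.eq_zero (LinearMap.isNilpotent_trace_of_isNilpotent ?_)
  obtain ⟨k, hk⟩ := hnil
  exact ⟨k, by rw [LinearMap.pow_mulLeft, hk, LinearMap.mulLeft_zero_eq_zero]⟩

end SimpleRing

section Idempotents

variable {F : Type*} [Field F] {A : Type*} [Ring A] [Algebra F A]
  {G : Type*} [AddCommGroup G] {𝒜 : G → Submodule F A}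

/-- `e` is a minimal idempotent of the component of degree `0`. -/
structure IsMinimalIdempotent (𝒜 : G → Submodule F A) (e : A) : Prop where
  mem : e ∈ 𝒜 0
  idem : e * e = e
  ne_zero : e ≠ 0
  eq_of : ∀ f ∈ 𝒜 0, f * f = f → f ≠ 0 → e * f = f → f * e = f → f = e

/-- An idempotent `e` for which `eA` has least dimension is minimal. -/
theorem exists_isMinimalIdempotent [FiniteDimensional F A] [Nontrivial A] (h𝒜 : IsGrading 𝒜) :
    ∃ e, IsMinimalIdempotent 𝒜 e := by
  obtain ⟨e, ⟨h1, h2, h3⟩, hmin⟩ := (measure fun e : A =>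
    Module.finrank F (LinearMap.range (LinearMap.mulLeft F e))).wf.has_min
    {e | e ∈ 𝒜 0 ∧ e * e = e ∧ e ≠ 0} ⟨1, h𝒜.one_mem, one_mul 1, one_ne_zero⟩
  refine ⟨e, h1, h2, h3, fun f hf hff hf0 hef hfe => ?_⟩
  have hle : LinearMap.range (LinearMap.mulLeft F f) ≤ LinearMap.range (LinearMap.mulLeft F e) := by
    rintro _ ⟨x, rfl⟩
    exact ⟨f * x, by simp [← mul_assoc, hef]⟩
  have heq := Submodule.eq_of_le_of_finrank_le hle (not_lt.1 (hmin f ⟨hf, hff, hf0⟩))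
  have hmem : e ∈ LinearMap.range (LinearMap.mulLeft F f) := by
    rw [heq]
    exact ⟨e, by simp [h2]⟩
  obtain ⟨c, hc⟩ := hmem
  rw [LinearMap.mulLeft_apply] at hc
  rw [← hfe, ← hc, ← mul_assoc, hff]

theorem IsMinimalIdempotent.map {φ : A →ₗ[F] A} (hφ : IsInvolution φ) (h : IsPhiGrading φ 𝒜)
    {e : A} (he : IsMinimalIdempotent 𝒜 e) : IsMinimalIdempotent 𝒜 (φ e) := by
  have hmem : ∀ x ∈ 𝒜 0, φ x ∈ 𝒜 0 := fun x hx => h.map_eq 0 ▸ Submodule.mem_map_of_mem hx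
  refine ⟨hmem _ he.mem, by rw [← hφ.map_mul, he.idem], fun h0 => he.ne_zero ?_,
    fun f hf hff hf0 hef hfe => ?_⟩
  · rw [← hφ.invol e, h0, map_zero]
  · rw [← hφ.invol f]
    congr 1
    refine he.eq_of _ (hmem _ hf) (by rw [← hφ.map_mul, hff]) (fun h0 => hf0 ?_) ?_ ?_
    · rw [← hφ.invol f, h0, map_zero]
    · conv_lhs => rw [← hφ.invol e, ← hφ.map_mul, hfe]
    · conv_lhs => rw [← hφ.invol e, ← hφ.map_mul, hef]

theorem IsGrading.aeval_mem (h𝒜 : IsGrading 𝒜) {x : A} (hx : x ∈ 𝒜 0) (p : Polynomial F) :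
    Polynomial.aeval x p ∈ 𝒜 0 := by
  have hpow : ∀ k : ℕ, x ^ k ∈ 𝒜 0 := fun k => by
    induction k with
    | zero => rw [pow_zero]; exact h𝒜.one_mem
    | succ k ih =>
      have := h𝒜.mul_mem ih hx
      rwa [add_zero, ← pow_succ] at this
  rw [Polynomial.aeval_eq_sum_range]
  exact sum_mem fun i _ => Submodule.smul_mem _ _ (hpow i)

/-- This is Fitting's lemma: a polynomial in `x` without constant term is a nonzero idempotent below
`e`, hence `e` itself. -/
theorem IsMinimalIdempotent.exists_mul_eq [FiniteDimensional F A] (h𝒜 : IsGrading 𝒜) {e : A}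
    (he : IsMinimalIdempotent 𝒜 e) {x : A} (hx : x ∈ 𝒜 0) (hex : e * x = x) (hxe : x * e = x)
    (hnil : ¬ IsNilpotent x) : ∃ y ∈ 𝒜 0, e * y = y ∧ y * e = y ∧ x * y = e := by
  obtain ⟨p, hp, hpx⟩ := Algebra.IsIntegral.isIntegral (R := F) x
  rw [← Polynomial.aeval_def] at hpx
  obtain ⟨q, hq, hXq⟩ := Polynomial.exists_eq_pow_rootMultiplicity_mul_and_not_dvd p hp.ne_zero 0
  rw [Polynomial.C_0, sub_zero] at hq hXq
  generalize p.rootMultiplicity 0 = k at hq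
  obtain ⟨s, t, hst⟩ := ((Polynomial.irreducible_X (R := F)).coprime_iff_not_dvd.2 hXq).pow_left
    (m := k + 1)
  set w := Polynomial.aeval x s with hw
  have hwx : Commute w x := by
    simpa [hw] using ((Polynomial.commute_X s).map (Polynomial.aeval x)).symm
  have h1 : x ^ k = w * x ^ (2 * k + 1) := by
    -- The Bézout identity `s X^(k+1) + t q = 1`, multiplied by `X^k`. As `p = X^k q` annihilates
    -- `x`, it yields `x^k = w x^(2k+1)`, and `w x^(k+1)` is idempotent.
    have h2 : (Polynomial.X : Polynomial F) ^ k = s * Polynomial.X ^ (2 * k + 1) + t * p := by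
      rw [hq]
      linear_combination (-(Polynomial.X : Polynomial F) ^ k) * hst
    have h3 := congrArg (Polynomial.aeval x) h2
    simpa [hpx] using h3
  have hf : x ^ (k + 1) = w * x ^ (k + 1) * x ^ (k + 1) := by
    rw [mul_assoc, ← pow_add, pow_succ, h1, mul_assoc, ← pow_succ]
    congr 2
    ring
  have hcomm : Commute w (x ^ (k + 1)) := hwx.pow_right _
  have hmem : w * x ^ (k + 1) ∈ 𝒜 0 := by
    have h2 := h𝒜.aeval_mem hx (s * Polynomial.X ^ (k + 1))
    simpa using h2
  have hexk : e * x ^ (k + 1) = x ^ (k + 1) := by rw [pow_succ', ← mul_assoc, hex]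
  have hxke : x ^ (k + 1) * e = x ^ (k + 1) := by rw [pow_succ, mul_assoc, hxe]
  have hfe : w * x ^ (k + 1) = e := by
    refine he.eq_of _ hmem ?_ ?_ ?_ ?_
    · rw [mul_assoc, ← mul_assoc (x ^ (k + 1)), ← hcomm.eq, ← hf]
    · intro h0
      rw [h0, zero_mul] at hf
      exact hnil ⟨_, hf⟩
    · rw [hcomm.eq, ← mul_assoc, hexk]
    · rw [mul_assoc, hxke]
  have hwk : x ^ k * w ∈ 𝒜 0 := by
    have h2 := h𝒜.aeval_mem hx (Polynomial.X ^ k * s)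
    simpa using h2
  refine ⟨e * (x ^ k * w) * e, ?_, ?_, ?_, ?_⟩
  · have := h𝒜.mul_mem (h𝒜.mul_mem he.mem hwk) he.mem
    simpa using this
  · rw [← mul_assoc, ← mul_assoc, he.idem]
  · rw [mul_assoc, he.idem]
  · rw [← mul_assoc, ← mul_assoc, hxe, ← mul_assoc, ← pow_succ', ← hcomm.eq, hfe, he.idem]

/-- Nonzero homogeneous elements of `eAe'` are invertible. -/
theorem IsMinimalIdempotent.exists_inverse [IsSimpleRing A] [FiniteDimensional F A] [CharZero F]
    (h𝒜 : IsGrading 𝒜) {e e' : A} (he : IsMinimalIdempotent 𝒜 e) (he' : IsMinimalIdempotent 𝒜 e')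
    {g : G} {x : A} (hx : x ∈ 𝒜 g) (hx0 : x ≠ 0) (hex : e * x = x) (hxe : x * e' = x) :
    ∃ y ∈ 𝒜 (-g), e' * y = y ∧ y * e = y ∧ x * y = e ∧ y * x = e' := by
  obtain ⟨y, hy, hnil⟩ := exists_not_isNilpotent_mul h𝒜 hx hx0
  have hxy : x * (e' * y * e) = x * y * e := by rw [← mul_assoc, ← mul_assoc, hxe]
  have hmem : x * y * e ∈ 𝒜 0 := by
    have := h𝒜.mul_mem (h𝒜.mul_mem hx hy) he.mem
    simpa using this
  have hea : e * (x * y) = x * y := by rw [← mul_assoc, hex]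
  -- This transfers non-nilpotency from `xy` to its compression `xye`, which lies in `eA₀e`.
  have hpow : ∀ k : ℕ, (x * y) ^ (k + 1) = (x * y * e) ^ k * (x * y) := by
    generalize x * y = a at hea
    intro k
    induction k with
    | zero => simp
    | succ k ih =>
      rw [pow_succ a (k + 1), ih, pow_succ (a * e) k, mul_assoc _ a a, mul_assoc _ (a * e) a,
        mul_assoc a e a, hea]
  obtain ⟨w, hw, hew, hwe, hxyw⟩ := he.exists_mul_eq h𝒜 hmem
    (by rw [← mul_assoc, hea]) (by rw [mul_assoc, he.idem])
    (by
      rintro ⟨k, hk⟩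
      exact hnil ⟨k + 1, by rw [hpow, hk, zero_mul]⟩)
  have hinv : x * (e' * y * e * w) = e := by rw [← mul_assoc, hxy, hxyw]
  have hymem : e' * y * e * w ∈ 𝒜 (-g) := by
    have := h𝒜.mul_mem (h𝒜.mul_mem (h𝒜.mul_mem he'.mem hy) he.mem) hw
    simpa using this
  have hey : e' * (e' * y * e * w) = e' * y * e * w := by
    simp only [← mul_assoc, he'.idem]
  have hye : e' * y * e * w * e = e' * y * e * w := by rw [mul_assoc, hwe]
  generalize e' * y * e * w = v at hinv hymem hey hye
  -- A right inverse is two-sided: `vx` is a nonzero idempotent below `e'`, hence equal to it.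
  refine ⟨v, hymem, hey, hye, hinv, he'.eq_of _ ?_ ?_ ?_ ?_ ?_⟩
  · have := h𝒜.mul_mem hymem hx
    simpa using this
  · rw [mul_assoc, ← mul_assoc x, hinv, hex]
  · intro h0
    apply hx0
    rw [← hex, ← hinv, mul_assoc, h0, mul_zero]
  · rw [← mul_assoc, hey]
  · rw [mul_assoc, hxe]

end Idempotents

section Retract

variable {F : Type*} [Field F] {M N : Type*} [AddCommGroup M] [Module F M] [AddCommGroup N]
  [Module F N] {G : Type*} {𝒱 : G → Submodule F N}

theorem iSupIndep_comap_of_retract (h : iSupIndep 𝒱 ∧ iSup 𝒱 = ⊤) {f : M →ₗ[F] N} {q : N →ₗ[F] M}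
    (hq : ∀ x, q (f x) = x) (hqf : ∀ g, ∀ a ∈ 𝒱 g, f (q a) ∈ 𝒱 g) :
    iSupIndep (fun g => (𝒱 g).comap f) ∧ ⨆ g, (𝒱 g).comap f = ⊤ := by
  refine ⟨fun g => ?_, ?_⟩
  · rw [Submodule.disjoint_def]
    intro x hx hx'
    have hle : (⨆ (j) (_ : j ≠ g), (𝒱 j).comap f) ≤ (⨆ (j) (_ : j ≠ g), 𝒱 j).comap f :=
      iSup₂_le fun j hj => Submodule.comap_mono (le_iSup₂_of_le j hj le_rfl)
    rw [← hq x, Submodule.disjoint_def.1 (h.1 g) (f x) hx (hle hx'), map_zero]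
  · have hle : iSup 𝒱 ≤ (⨆ g, (𝒱 g).comap f).comap q :=
      iSup_le fun g a ha => Submodule.mem_iSup_of_mem g (hqf g a ha)
    rw [eq_top_iff]
    rintro x -
    rw [← hq x]
    exact hle (by rw [h.2]; trivial)

end Retract

/-! ### The algebra `eAe` and the module `Ae` -/

section Corner

variable (F : Type*) [Field F] {A : Type*} [Ring A] [Algebra F A] {e : A}
  (hi : IsIdempotentElem e)

theorem corner_mul_left (x : hi.Corner) : e * x.1 = x.1 :=
  ((Subsemigroup.mem_corner_iff hi).1 x.2).1

theorem corner_mul_right (x : hi.Corner) : x.1 * e = x.1 :=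
  ((Subsemigroup.mem_corner_iff hi).1 x.2).2

theorem coe_corner_mul (x y : hi.Corner) : (x * y).1 = x.1 * y.1 := rfl

theorem coe_corner_one : (1 : hi.Corner).1 = e := rfl

/-- The element of `eAe` given by an element `x = ex = xe` of `A`. -/
def cornerMk (x : A) (h₁ : e * x = x) (h₂ : x * e = x) : hi.Corner :=
  ⟨x, (Subsemigroup.mem_corner_iff hi).2 ⟨h₁, h₂⟩⟩

/-- The inclusion of `eAe` in `A`, as an additive homomorphism. -/
def cornerAddVal : hi.Corner →+ A where
  toFun := Subtype.val
  map_zero' := rfl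
  map_add' _ _ := rfl

instance cornerAlgebra : Algebra F hi.Corner :=
  letI : SMul F hi.Corner :=
    ⟨fun c x => cornerMk hi (c • x.1) (by rw [mul_smul_comm, corner_mul_left])
      (by rw [smul_mul_assoc, corner_mul_right])⟩
  letI : Module F hi.Corner :=
    Function.Injective.module F (cornerAddVal hi) Subtype.val_injective fun _ _ => rfl
  Algebra.ofModule (fun c x y => Subtype.ext (smul_mul_assoc c x.1 y.1))
    fun c x y => Subtype.ext (mul_smul_comm c x.1 y.1)

/-- The inclusion of `eAe` in `A`. -/
def cornerVal : hi.Corner →ₗ[F] A where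
  toFun := Subtype.val
  map_add' _ _ := rfl
  map_smul' _ _ := rfl

/-- The projection `x ↦ exe` of `A` onto `eAe`. -/
def cornerProj : A →ₗ[F] hi.Corner where
  toFun x := ⟨e * x * e, x, rfl⟩
  map_add' x y := Subtype.ext (by
    change e * (x + y) * e = e * x * e + e * y * e
    rw [mul_add, add_mul])
  map_smul' c x := Subtype.ext (by
    change e * (c • x) * e = c • (e * x * e)
    rw [mul_smul_comm, smul_mul_assoc])

theorem cornerProj_cornerVal (x : hi.Corner) : cornerProj F hi (cornerVal F hi x) = x :=
  Subtype.ext (by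
    change e * x.1 * e = x.1
    rw [corner_mul_left, corner_mul_right])

/-- The left ideal `Ae`. -/
def leftPart (_ : IsIdempotentElem e) : Submodule F A where
  carrier := {x | x * e = x}
  add_mem' {x y} hx hy := by
    change (x + y) * e = x + y
    rw [add_mul, hx, hy]
  zero_mem' := zero_mul e
  smul_mem' c x hx := by
    change c • x * e = c • x
    rw [smul_mul_assoc, hx]

variable {F} in
theorem leftPart_mul (x : leftPart F hi) : x.1 * e = x.1 := x.2

instance leftPartModule : Module hi.Cornerᵐᵒᵖ (leftPart F hi) where
  smul d x := ⟨x.1 * (unop d).1, by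
    change x.1 * (unop d).1 * e = _
    rw [mul_assoc, corner_mul_right]⟩
  one_smul x := Subtype.ext (leftPart_mul hi x)
  mul_smul d d' x := Subtype.ext (mul_assoc x.1 (unop d').1 (unop d).1).symm
  smul_zero d := Subtype.ext (zero_mul _)
  smul_add d x y := Subtype.ext (add_mul _ _ _)
  add_smul d d' x := Subtype.ext (mul_add _ _ _)
  zero_smul x := Subtype.ext (mul_zero _)

variable {F} in
theorem coe_op_smul (a : hi.Corner) (x : leftPart F hi) : (op a • x).1 = x.1 * a.1 := rfl

instance : IsScalarTower F hi.Cornerᵐᵒᵖ (leftPart F hi) :=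
  ⟨fun c d x => Subtype.ext (mul_smul_comm c x.1 (unop d).1)⟩

/-- The projection `x ↦ xe` of `A` onto `Ae`. -/
def leftPartProj : A →ₗ[F] leftPart F hi where
  toFun x := ⟨x * e, by
    change x * e * e = x * e
    rw [mul_assoc, hi.eq]⟩
  map_add' x y := Subtype.ext (add_mul x y e)
  map_smul' c x := Subtype.ext (smul_mul_assoc c x e)

/-- The action of `A` on `Ae`. -/
def leftPartAction : A →ₐ[F] Module.End hi.Cornerᵐᵒᵖ (leftPart F hi) where
  toFun a :=
    { toFun := fun x => ⟨a * x.1, by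
        change a * x.1 * e = _
        rw [mul_assoc, leftPart_mul]⟩
      map_add' := fun x y => Subtype.ext (mul_add a x.1 y.1)
      map_smul' := fun d x => Subtype.ext (mul_assoc a x.1 (unop d).1).symm }
  map_one' := LinearMap.ext fun x => Subtype.ext (one_mul x.1)
  map_mul' a b := LinearMap.ext fun x => Subtype.ext (mul_assoc a b x.1)
  map_zero' := LinearMap.ext fun x => Subtype.ext (zero_mul x.1)
  map_add' a b := LinearMap.ext fun x => Subtype.ext (add_mul a b x.1)
  commutes' c := LinearMap.ext fun x => Subtype.ext (Algebra.smul_def c x.1).symm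

variable {F} in
theorem coe_leftPartAction (a : A) (x : leftPart F hi) :
    (leftPartAction F hi a x).1 = a * x.1 := rfl

variable {G : Type*} [AddCommGroup G]

/-- The grading of `eAe`. -/
def cornerGrading (𝒜 : G → Submodule F A) (g : G) : Submodule F hi.Corner :=
  (𝒜 g).comap (cornerVal F hi)

/-- The grading of `Ae`. -/
def leftPartGrading (𝒜 : G → Submodule F A) (g : G) : Submodule F (leftPart F hi) :=
  (𝒜 g).comap (leftPart F hi).subtype

variable {F} {𝒜 : G → Submodule F A}

theorem isGrading_cornerGrading (h𝒜 : IsGrading 𝒜) (he : e ∈ 𝒜 0) :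
    IsGrading (cornerGrading F hi 𝒜) := by
  refine isGrading_iff.2 ⟨iSupIndep_comap_of_retract (isGrading_iff.1 h𝒜).1
    (cornerProj_cornerVal F hi) fun g a ha => ?_, ?_⟩
  · have := h𝒜.mul_mem (h𝒜.mul_mem he ha) he
    rwa [zero_add, add_zero] at this
  · exact
      { one_mem := he
        mul_mem := fun _ _ x y hx hy => h𝒜.mul_mem hx hy }

theorem isModuleGrading_leftPartGrading (h𝒜 : IsGrading 𝒜) (he : e ∈ 𝒜 0) :
    IsModuleGrading (cornerGrading F hi 𝒜) (leftPartGrading F hi 𝒜) := by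
  refine isModuleGrading_iff.2 ⟨iSupIndep_comap_of_retract (q := leftPartProj F hi)
    (isGrading_iff.1 h𝒜).1 (fun x => Subtype.ext (leftPart_mul hi x)) fun g a ha => ?_, ?_⟩
  · have := h𝒜.mul_mem ha he
    rwa [add_zero] at this
  · intro g h x hx a ha
    exact h𝒜.mul_mem hx ha

/-- For a central `c` with eigenvalue `t`, the element `N = t - c` kills some `v ≠ 0`. Then `NAv =
0`, because `N` commutes with `eAe`, and simplicity of `A` gives `N = 0`. Invertibility of
homogeneous elements is `exists_inverse` with `e' = e`. -/
theorem isCentralGradedDivision_corner [IsAlgClosed F] [CharZero F] [IsSimpleRing A]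
    [FiniteDimensional F A] (h𝒜 : IsGrading 𝒜) (he : IsMinimalIdempotent 𝒜 e) :
    IsCentralGradedDivision (cornerGrading F hi 𝒜) := by
  have hfin : FiniteDimensional F hi.Corner :=
    Module.Finite.of_injective (cornerVal F hi) Subtype.val_injective
  have hnt : Nontrivial hi.Corner := ⟨1, 0, fun h => he.ne_zero (congrArg Subtype.val h)⟩
  refine ⟨hfin, hnt, ⟨fun c hc => ?_⟩, isGrading_cornerGrading hi h𝒜 he.mem, fun g x hx hx0 => ?_⟩
  · obtain ⟨t, ht⟩ := spectrum.nonempty_of_isAlgClosed_of_finiteDimensional F c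
    rw [spectrum.mem_iff] at ht
    refine Algebra.mem_bot.2 ⟨t, ?_⟩
    rw [← sub_eq_zero]
    have hcomm : ∀ b, b * (algebraMap F hi.Corner t - c) = (algebraMap F hi.Corner t - c) * b :=
      fun b => by rw [mul_sub, sub_mul, Algebra.commutes, Subalgebra.mem_center_iff.1 hc b]
    generalize algebraMap F hi.Corner t - c = N at ht hcomm
    by_contra hN
    obtain ⟨v, hv, hv0⟩ : ∃ v, N * v = 0 ∧ v ≠ 0 := by
      by_contra hcon
      push Not at hcon
      have hinj : Function.Injective (LinearMap.mulLeft F N) := by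
        rw [injective_iff_map_eq_zero]
        exact hcon
      obtain ⟨y, hy⟩ := LinearMap.injective_iff_surjective.1 hinj 1
      exact ht ⟨⟨N, y, hy, (hcomm y).trans hy⟩, rfl⟩
    obtain ⟨a, ha⟩ := exists_mul_mul_ne_zero (x := N.1) (y := v.1)
      (fun h => hN (Subtype.ext h)) (fun h => hv0 (Subtype.ext h))
    apply ha
    have h1 : (N * cornerProj F hi a * v).1 = N.1 * a * v.1 := by
      change N.1 * (e * a * e) * v.1 = _
      rw [mul_assoc e, ← mul_assoc N.1, corner_mul_right, ← mul_assoc, mul_assoc _ e,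
        corner_mul_left]
    rw [← h1, ← hcomm, mul_assoc, hv, mul_zero]
    rfl
  · obtain ⟨y, -, hy, hy', hxy, hyx⟩ := he.exists_inverse h𝒜 he hx (fun h => hx0 (Subtype.ext h))
      (corner_mul_left hi x) (corner_mul_right hi x)
    exact ⟨⟨x, cornerMk hi y hy hy', Subtype.ext hxy, Subtype.ext hyx⟩, rfl⟩

end Corner

/-! ### The involution of `eAe` and the form on `Ae` -/

section Link

variable {F : Type*} [Field F] {A : Type*} [Ring A] [Algebra F A] {G : Type*} [AddCommGroup G]
  {φ : A →ₗ[F] A} {𝒜 : G → Submodule F A} {e w w' : A} {γ : G} {ε : F}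

/-- `w ∈ eAφ(e)` is a homogeneous isomorphism between the idempotents `φ(e)` and `e`, with inverse
`w'`, and `φ(w) = εw` for a sign `ε`. -/
structure IsLink (φ : A →ₗ[F] A) (𝒜 : G → Submodule F A) (e w w' : A) (γ : G) (ε : F) : Prop where
  mem : w ∈ 𝒜 γ
  mem' : w' ∈ 𝒜 (-γ)
  left_mul : e * w = w
  mul_right : w * φ e = w
  left_mul' : φ e * w' = w'
  mul_right' : w' * e = w'
  mul_eq : w * w' = e
  mul_eq' : w' * w = φ e
  map_eq : φ w = ε • w
  sign : ε = 1 ∨ ε = -1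

theorem IsPhiGrading.map_mem (h : IsPhiGrading φ 𝒜) {g : G} {x : A} (hx : x ∈ 𝒜 g) : φ x ∈ 𝒜 g :=
  h.map_eq g ▸ Submodule.mem_map_of_mem hx

theorem exists_mem_mul_mul_ne_zero [IsSimpleRing A] (h𝒜 : IsGrading 𝒜) {x y : A} (hx : x ≠ 0)
    (hy : y ≠ 0) : ∃ g, ∃ a ∈ 𝒜 g, x * a * y ≠ 0 := by
  by_contra hcon
  push Not at hcon
  obtain ⟨a, ha⟩ := exists_mul_mul_ne_zero hx hy
  have hle : iSup 𝒜 ≤ LinearMap.ker (LinearMap.mulLeftRight F (x, y)) :=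
    iSup_le fun g a ha => hcon g a ha
  rw [h𝒜.iSup_eq] at hle
  exact ha (hle (x := a) trivial)

/-- Simplicity gives a nonzero homogeneous `w ∈ eAφ(e)`, which is invertible between the
idempotents. Its image `φ(w)` lies in the same homogeneous piece, so `φ(w)w'` has degree 0 in `eAe`
and is a scalar multiple `εe`. -/
theorem exists_isLink [IsAlgClosed F] [CharZero F] [IsSimpleRing A] [FiniteDimensional F A]
    (hφ : IsInvolution φ) (h : IsPhiGrading φ 𝒜) (he : IsMinimalIdempotent 𝒜 e) :
    ∃ w w' γ ε, IsLink φ 𝒜 e w w' γ ε := by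
  have he' := he.map hφ h
  have hi : IsIdempotentElem e := he.idem
  obtain ⟨γ, a, ha, hne⟩ := exists_mem_mul_mul_ne_zero h.isGrading he.ne_zero he'.ne_zero
  have hw : e * a * φ e ∈ 𝒜 γ := by
    simpa using h.isGrading.mul_mem (h.isGrading.mul_mem he.mem ha) he'.mem
  have h1 : e * (e * a * φ e) = e * a * φ e := by simp only [← mul_assoc, he.idem]
  have h2 : e * a * φ e * φ e = e * a * φ e := by rw [mul_assoc, he'.idem]
  generalize e * a * φ e = w at hne hw h1 h2
  obtain ⟨w', hw', h3, h4, h5, h6⟩ := he.exists_inverse h.isGrading he' hw hne h1 h2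
  have h7 : e * φ w = φ w := by
    conv_lhs => rw [← hφ.invol e, ← hφ.map_mul, h2]
  have h8 : φ w * φ e = φ w := by rw [← hφ.map_mul, h1]
  have h9 : φ w * w' ∈ 𝒜 0 := by
    simpa using h.isGrading.mul_mem (h.map_mem hw) hw'
  obtain ⟨ε, hε⟩ := (isCentralGradedDivision_corner hi h.isGrading he).exists_algebraMap_eq
    (x := cornerMk hi (φ w * w') (by rw [← mul_assoc, h7]) (by rw [mul_assoc, h4])) h9
  have h10 : φ w * w' = ε • e := by
    rw [Algebra.algebraMap_eq_smul_one] at hε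
    exact congrArg Subtype.val hε
  have h11 : φ w = ε • w := by
    rw [← h8, ← h6, ← mul_assoc, h10, smul_mul_assoc, h1]
  refine ⟨w, w', γ, ε, hw, hw', h1, h2, h3, h4, h5, h6, h11, ?_⟩
  have h12 := hφ.invol w
  rw [h11, map_smul, h11, smul_smul] at h12
  have h13 : (ε * ε - 1) • w = 0 := by rw [sub_smul, h12, one_smul, sub_self]
  rcases smul_eq_zero.1 h13 with h14 | h14
  · exact mul_self_eq_one_iff.1 (sub_eq_zero.1 h14)
  · exact absurd h14 hne

namespace IsLink

theorem map_eq'' (hφ : IsInvolution φ) (h : IsLink φ 𝒜 e w w' γ ε) : φ w' = ε • w' := by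
  have h1 : φ w' * e = φ w' := by
    conv_lhs => rw [← hφ.invol e, ← hφ.map_mul, h.left_mul']
  have h2 : ε • (φ w' * w) = φ e := by rw [← mul_smul_comm, ← h.map_eq, ← hφ.map_mul, h.mul_eq]
  have h3 : ε • φ w' = w' := by
    rw [← h1, ← h.mul_eq, ← mul_assoc, ← smul_mul_assoc, h2, h.left_mul']
  have h4 : ε * ε = 1 := by rcases h.sign with h | h <;> rw [h] <;> ring
  rw [← one_smul F (φ w'), ← h4, mul_smul, h3]

variable (hi : IsIdempotentElem e)

/-- The involution `a ↦ wφ(a)w'` of `eAe`. -/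
def cornerInvolution (h : IsLink φ 𝒜 e w w' γ ε) : hi.Corner →ₗ[F] hi.Corner where
  toFun a := cornerMk hi (w * φ a.1 * w') (by rw [← mul_assoc, ← mul_assoc, h.left_mul])
    (by rw [mul_assoc, h.mul_right'])
  map_add' a b := Subtype.ext (by
    change w * φ (a.1 + b.1) * w' = w * φ a.1 * w' + w * φ b.1 * w'
    rw [map_add, mul_add, add_mul])
  map_smul' c a := Subtype.ext (by
    change w * φ (c • a.1) * w' = c • (w * φ a.1 * w')
    rw [map_smul, mul_smul_comm, smul_mul_assoc])

/-- The form `(x, y) ↦ wφ(x)y` on `Ae`. -/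
def form (h : IsLink φ 𝒜 e w w' γ ε) : leftPart F hi →ₗ[F] leftPart F hi →ₗ[F] hi.Corner :=
  LinearMap.mk₂ F
    (fun x y => cornerMk hi (w * φ x.1 * y.1) (by rw [← mul_assoc, ← mul_assoc, h.left_mul])
      (by rw [mul_assoc, leftPart_mul]))
    (fun x x' y => Subtype.ext (by
      change w * φ (x.1 + x'.1) * y.1 = w * φ x.1 * y.1 + w * φ x'.1 * y.1
      rw [map_add, mul_add, add_mul]))
    (fun c x y => Subtype.ext (by
      change w * φ (c • x.1) * y.1 = c • (w * φ x.1 * y.1)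
      rw [map_smul, mul_smul_comm, smul_mul_assoc]))
    (fun x y y' => Subtype.ext (mul_add _ _ _))
    (fun c x y => Subtype.ext (mul_smul_comm _ _ _))

theorem coe_cornerInvolution (h : IsLink φ 𝒜 e w w' γ ε) (a : hi.Corner) :
    (h.cornerInvolution hi a).1 = w * φ a.1 * w' := rfl

theorem coe_form (h : IsLink φ 𝒜 e w w' γ ε) (x y : leftPart F hi) :
    (h.form hi x y).1 = w * φ x.1 * y.1 := rfl

theorem cornerInvolution_cornerInvolution (hφ : IsInvolution φ) (h : IsLink φ 𝒜 e w w' γ ε)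
    (a : hi.Corner) : h.cornerInvolution hi (h.cornerInvolution hi a) = a := by
  have h4 : ε * ε = 1 := by rcases h.sign with h | h <;> rw [h] <;> ring
  refine Subtype.ext ?_
  rw [coe_cornerInvolution, coe_cornerInvolution, hφ.map_mul, hφ.map_mul, hφ.invol, h.map_eq,
    h.map_eq'' hφ]
  simp only [smul_mul_assoc, mul_smul_comm, smul_smul, h4, one_smul]
  rw [← mul_assoc w, h.mul_eq, ← mul_assoc, corner_mul_left, mul_assoc, h.mul_eq,
    corner_mul_right]

theorem isInvolution_cornerInvolution (hφ : IsInvolution φ) (h : IsLink φ 𝒜 e w w' γ ε) :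
    IsInvolution (h.cornerInvolution hi) where
  bijective := Function.Involutive.bijective (h.cornerInvolution_cornerInvolution hi hφ)
  map_one := Subtype.ext (by
    rw [coe_cornerInvolution, coe_corner_one, h.mul_right, h.mul_eq])
  map_mul a b := Subtype.ext (by
    rw [coe_corner_mul, coe_cornerInvolution, coe_cornerInvolution, coe_cornerInvolution,
      coe_corner_mul, hφ.map_mul]
    have h1 : φ e * φ a.1 = φ a.1 := by rw [← hφ.map_mul, corner_mul_right]
    simp only [mul_assoc]
    rw [← mul_assoc w' w, h.mul_eq', ← mul_assoc (φ e), h1])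
  invol := h.cornerInvolution_cornerInvolution hi hφ

theorem map_cornerInvolution (hφ : IsInvolution φ) (hgr : IsPhiGrading φ 𝒜)
    (h : IsLink φ 𝒜 e w w' γ ε) (g : G) :
    (cornerGrading F hi 𝒜 g).map (h.cornerInvolution hi) = cornerGrading F hi 𝒜 g := by
  have hle : ∀ a ∈ cornerGrading F hi 𝒜 g, h.cornerInvolution hi a ∈ cornerGrading F hi 𝒜 g := by
    intro a ha
    have := hgr.isGrading.mul_mem (hgr.isGrading.mul_mem h.mem (hgr.map_mem ha)) h.mem'
    rwa [add_neg_cancel_comm] at this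
  refine le_antisymm ?_ fun a ha => ⟨_, hle a ha, h.cornerInvolution_cornerInvolution hi hφ a⟩
  rintro _ ⟨a, ha, rfl⟩
  exact hle a ha

theorem cornerInvolution_form (hφ : IsInvolution φ) (h : IsLink φ 𝒜 e w w' γ ε)
    (x y : leftPart F hi) : h.cornerInvolution hi (h.form hi x y) = ε • h.form hi y x := by
  refine Subtype.ext ?_
  change _ = ε • (h.form hi y x).1
  rw [coe_cornerInvolution, coe_form, coe_form, hφ.map_mul, hφ.map_mul, hφ.invol, h.map_eq,
    mul_smul_comm, mul_smul_comm, mul_smul_comm, smul_mul_assoc]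
  simp only [mul_assoc]
  rw [h.mul_eq, leftPart_mul]

theorem isHermitianOrSkew_form (hφ : IsInvolution φ) (h : IsLink φ 𝒜 e w w' γ ε) :
    IsHermitianOrSkew (h.cornerInvolution hi) (h.form hi) := by
  rcases h.sign with rfl | rfl
  · exact .inl fun x y => by rw [h.cornerInvolution_form hi hφ, one_smul]
  · exact .inr fun x y => by rw [h.cornerInvolution_form hi hφ, neg_smul, one_smul, neg_neg]

theorem isSesquilinear_form [IsSimpleRing A] (hφ : IsInvolution φ) (hgr : IsPhiGrading φ 𝒜)
    (h : IsLink φ 𝒜 e w w' γ ε) (he : e ≠ 0) :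
    IsSesquilinear (cornerGrading F hi 𝒜) (h.cornerInvolution hi) (leftPartGrading F hi 𝒜)
      (h.form hi) := by
  have hleft : ∀ x, (∀ y, h.form hi x y = 0) → x = 0 := by
    intro x hx
    have h1 : w * φ x.1 = 0 := by
      by_contra hne
      obtain ⟨a, ha⟩ := exists_mul_mul_ne_zero hne he
      apply ha
      rw [mul_assoc]
      exact congrArg Subtype.val (hx (leftPartProj F hi a))
    have h2 : φ x.1 = 0 := by
      rw [← leftPart_mul hi x, hφ.map_mul, ← h.mul_eq', mul_assoc, h1, mul_zero]
    exact Subtype.ext (hφ.bijective.1 (by rw [h2]; exact (map_zero φ).symm))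
  refine ⟨⟨γ, fun g₁ g₂ x hx y hy => ?_⟩, fun x y a => Subtype.ext ?_, fun x y a => Subtype.ext ?_,
    hleft, fun y hy => hleft y fun x => ?_⟩
  · have := hgr.isGrading.mul_mem (hgr.isGrading.mul_mem h.mem (hgr.map_mem hx)) hy
    rw [show g₁ + g₂ + γ = γ + g₁ + g₂ by abel]
    exact this
  · have h1 : φ a.1 * φ e = φ a.1 := by rw [← hφ.map_mul, corner_mul_left]
    rw [coe_corner_mul, coe_form, coe_form, coe_op_smul, hφ.map_mul, coe_cornerInvolution]
    simp only [mul_assoc]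
    rw [← mul_assoc w' w, h.mul_eq', ← mul_assoc (φ a.1) (φ e), h1]
  · rw [coe_corner_mul, coe_form, coe_form, coe_op_smul, mul_assoc, mul_assoc, mul_assoc]
  · have h1 := h.cornerInvolution_form hi hφ x y
    rw [hy, map_zero] at h1
    rcases h.sign with rfl | rfl
    · rw [one_smul] at h1
      exact h1.symm
    · rw [neg_smul, one_smul] at h1
      exact neg_eq_zero.1 h1.symm

end IsLink

end Link

/-! ### Existence of realizations and the main theorem -/

section Existence

theorem isGradedIso_of_map_le {F : Type*} [Field F] {A A' : Type*} [Ring A] [Algebra F A] [Ring A']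
    [Algebra F A'] {G : Type*} {𝒜 : G → Submodule F A} {ℬ : G → Submodule F A'}
    {Φ : A ≃ₐ[F] A'} (h𝒜 : iSup 𝒜 = ⊤) (hℬ : iSupIndep ℬ) (h : ∀ g, ∀ x ∈ 𝒜 g, Φ x ∈ ℬ g) :
    IsGradedIso 𝒜 ℬ Φ := by
  intro g _
  refine ⟨g, le_antisymm (by rintro _ ⟨x, hx, rfl⟩; exact h g x hx) fun y hy => ?_⟩
  have h1 : Φ.symm y ∈ 𝒜 g ⊔ ⨆ (j) (_ : j ≠ g), 𝒜 j := by
    refine (?_ : (⊤ : Submodule F A) ≤ _) trivial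
    rw [← h𝒜]
    refine iSup_le fun j => ?_
    by_cases hj : j = g
    · exact hj ▸ le_sup_left
    · exact le_sup_of_le_right (le_iSup₂_of_le (f := fun j (_ : j ≠ g) => 𝒜 j) j hj le_rfl)
  obtain ⟨a, ha, b, hb, hab⟩ := Submodule.mem_sup.1 h1
  have h2 : (⨆ (j) (_ : j ≠ g), 𝒜 j) ≤ (⨆ (j) (_ : j ≠ g), ℬ j).comap Φ.toLinearMap :=
    iSup₂_le fun j hj x hx => Submodule.mem_iSup_of_mem j (Submodule.mem_iSup_of_mem hj (h j x hx))
  have h3 : y = Φ a + Φ b := by rw [← map_add, hab, AlgEquiv.apply_symm_apply]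
  have h4 : Φ b = 0 := by
    refine Submodule.disjoint_def.1 (hℬ g) _ ?_ (h2 hb)
    rw [eq_sub_of_add_eq' h3.symm]
    exact sub_mem hy (h g a ha)
  exact ⟨a, ha, by rw [h3, h4, add_zero]; rfl⟩

variable {F : Type u} [Field F] [IsAlgClosed F] [CharZero F] {A : Type u} [Ring A] [Algebra F A]
  [IsSimpleRing A] [FiniteDimensional F A] {φ : A →ₗ[F] A}

theorem exists_realization {G : Type} [AddCommGroup G] {𝒜 : G → Submodule F A}
    (hφ : IsInvolution φ) (h : IsPhiGrading φ 𝒜) :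
    ∃ P : InvPair F, Nonempty (Realization φ 𝒜 P) := by
  obtain ⟨e, he⟩ := exists_isMinimalIdempotent h.isGrading
  have hi : IsIdempotentElem e := he.idem
  obtain ⟨w, w', γ, ε, hl⟩ := exists_isLink hφ h he
  have hD := isCentralGradedDivision_corner hi h.isGrading he
  have hV := isModuleGrading_leftPartGrading hi h.isGrading he.mem
  have hτ := hl.isInvolution_cornerInvolution hi hφ
  have hB := hl.isSesquilinear_form hi hφ h he.ne_zero
  have hH := hl.isHermitianOrSkew_form hi hφ
  obtain ⟨ν, p, s, b, hν, hb, b', hb'⟩ := exists_orthogonal_basis hD hτ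
    (hl.map_cornerInvolution hi hφ h) hV hB hH
  have hinj : Function.Injective (leftPartAction F hi) := by
    rw [injective_iff_map_eq_zero]
    intro a ha
    by_contra hne
    obtain ⟨c, hc⟩ := exists_mul_mul_ne_zero hne he.ne_zero
    apply hc
    rw [mul_assoc]
    exact congrArg Subtype.val (LinearMap.congr_fun ha (leftPartProj F hi c))
  have hsurj : Function.Surjective (leftPartAction F hi) := by
    intro f
    -- An endomorphism is the sum of the rank one operators `f(bᵢ)B(b'ᵢ, ·)`, and `B(b'ᵢ, ·)` is
    -- left multiplication by `wφ(b'ᵢ)`.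
    refine ⟨∑ i, (f (b i)).1 * (w * φ (b' i).1), LinearMap.ext fun x => ?_⟩
    conv_rhs => rw [← hb' x, map_sum]
    simp only [map_smul]
    refine Subtype.ext ?_
    rw [coe_leftPartAction, Finset.sum_mul, AddSubmonoidClass.coe_finsetSum]
    refine Finset.sum_congr rfl fun i _ => ?_
    rw [coe_op_smul, hl.coe_form, mul_assoc]
  let Φ := AlgEquiv.ofBijective (leftPartAction F hi) ⟨hinj, hsurj⟩
  have hnt := hD.nontrivial
  let P : InvPair F :=
    { D := hi.Corner
      G := G
      comp := cornerGrading F hi 𝒜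
      division := hD
      τ := hl.cornerInvolution hi
      isInvolution := hτ
      graded := hl.map_cornerInvolution hi hφ h
      p := p
      d := fun i => hl.form hi (b (.inl i)) (b (.inl i))
      d_ne_zero := fun i h0 => by
        have := hb.form_diag i
        rw [h0, zero_mul] at this
        exact zero_ne_one this
      d_homogeneous := fun i => by
        obtain ⟨k, hk⟩ := hB.homogeneous
        obtain ⟨g, hg⟩ := hb.homogeneous (.inl i)
        exact ⟨_, hk g g _ hg _ hg⟩
      d_sign := hH.imp (fun h i => (h _ _).symm) fun h i => (neg_eq_iff_eq_neg.2 (h _ _)).symm }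
  have hz : ∀ {i j}, i ≠ swapPairs j → hl.form hi (b i) (b j) = 0 := fun {i j} => hb.form_zero i j
  exact ⟨P, ⟨{
    V := leftPart F hi
    grading := leftPartGrading F hi 𝒜
    isModuleGrading := hV
    B := hl.form hi
    sesquilinear := hB
    hermitian := hH
    iso := Φ
    iso_graded := isGradedIso_of_map_le h.isGrading.iSup_eq
      (iSupIndep_inducedGrading (isModuleGrading_iff.1 hV).1)
      fun g a ha g' x hx => h.isGrading.mul_mem ha hx
    iso_adjoint := fun r x y => Subtype.ext (by
      change w * φ (r * x.1) * y.1 = w * φ x.1 * (φ r * y.1)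
      rw [hφ.map_mul, mul_assoc, mul_assoc, mul_assoc])
    s := s
    basis := b
    basis_homogeneous := hb.homogeneous
    ν := fun _ => ν
    ν_ne_zero := fun _ => hν
    d_sq := hb.form_diag
    form_diag := fun _ => rfl
    form_xy := hb.form_pair
    form_yx := hb.form_pair'
    form_inl_inl := fun i i' hne => hz (by simpa [swapPairs] using hne)
    form_inl_inr := fun i j => hz (by rcases j with j | j <;> simp [swapPairs])
    form_inr_inl := fun i j => hz (by simp [swapPairs])
    form_xx := fun j j' => hz (by simp [swapPairs])
    form_yy := fun j j' => hz (by simp [swapPairs])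
    form_xy_ne := fun j j' hne => hz (by simpa [swapPairs] using hne)
    form_yx_ne := fun j j' hne => hz (by simpa [swapPairs] using hne) }⟩⟩

end Existence

/-- The support is finite, so the subgroup that it generates is a quotient of some `ℤᵐ` and has a
copy in `Type`, where the grading group of an `InvPair` must lie. -/
theorem exists_smallGroup {F : Type*} [Field F] {A : Type*} [Ring A] [Algebra F A]
    [FiniteDimensional F A] {φ : A →ₗ[F] A} {G : Type*} [AddCommGroup G] {𝒜 : G → Submodule F A}
    (h : IsPhiGrading φ 𝒜) :
    ∃ (H : Type) (_ : AddCommGroup H) (ι : H → G), IsPhiGrading φ (fun k => 𝒜 (ι k)) ∧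
      ∀ g, 𝒜 g ≠ ⊥ → ∃ k, 𝒜 g = 𝒜 (ι k) := by
  have hfin : {g | 𝒜 g ≠ ⊥}.Finite := WellFoundedGT.finite_ne_bot_of_iSupIndep h.isGrading.indep
  obtain ⟨m, s, hs⟩ := hfin.fin_embedding
  let f : (Fin m → ℤ) →+ G :=
    { toFun := fun x => ∑ i, x i • s i
      map_zero' := by simp
      map_add' := fun x y => by simp [add_smul, Finset.sum_add_distrib] }
  let ι := QuotientAddGroup.kerLift f
  have hι : Function.Injective ι := QuotientAddGroup.kerLift_injective f
  have hsupp : ∀ g, 𝒜 g ≠ ⊥ → ∃ k, 𝒜 g = 𝒜 (ι k) := by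
    intro g hg
    obtain ⟨i, rfl⟩ : g ∈ Set.range s := hs ▸ hg
    refine ⟨QuotientAddGroup.mk (Pi.single i 1), ?_⟩
    have : ι (QuotientAddGroup.mk (Pi.single i 1)) = f (Pi.single i 1) := rfl
    rw [this]
    simp [f, Pi.single_apply, ite_smul]
  refine ⟨(Fin m → ℤ) ⧸ f.ker, inferInstance, ι, ⟨isGrading_iff.2 ⟨⟨h.isGrading.indep.comp hι, ?_⟩,
    ?_⟩, fun k => h.map_eq _, fun k => h.sq_scalar _, ?_⟩, hsupp⟩
  · rw [eq_top_iff, ← h.isGrading.iSup_eq]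
    refine iSup_le fun g => ?_
    by_cases hg : 𝒜 g = ⊥
    · exact hg.le.trans bot_le
    · obtain ⟨k, hk⟩ := hsupp g hg
      exact hk.le.trans (le_iSup (fun k => 𝒜 (ι k)) k)
  · exact
      { one_mem := by
          rw [map_zero ι]
          exact h.isGrading.one_mem
        mul_mem := fun j k x y hx hy => by
          rw [map_add ι]
          exact h.isGrading.mul_mem hx hy }
  · rw [map_zero ι]
    exact h.sq_zero

/-- A realization, composed with a graded isomorphism of algebras with involution. -/
def Realization.ofIso {F : Type u} [Field F] {A A' : Type*} [Ring A] [Algebra F A] [Ring A']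
    [Algebra F A'] {G G' : Type*} {φ : A →ₗ[F] A} {𝒜 : G → Submodule F A} {φ' : A' →ₗ[F] A'}
    {𝒜' : G' → Submodule F A'} {P : InvPair F} (R : Realization φ' 𝒜' P) (Φ : A ≃ₐ[F] A')
    (hΦ : IsGradedIso 𝒜 𝒜' Φ) (hφ : ∀ x, Φ (φ x) = φ' (Φ x)) : Realization φ 𝒜 P :=
  { R with
    iso := Φ.trans R.iso
    iso_graded := InvPair.isGradedIso_trans hΦ R.iso_graded
    iso_adjoint := fun r x y => by
      rw [AlgEquiv.trans_apply, AlgEquiv.trans_apply, hφ]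
      exact R.iso_adjoint _ _ _ }

theorem exists_invariantValues_eq {F : Type u} [Field F] [IsAlgClosed F] [CharZero F] {A : Type u}
    [Ring A] [Algebra F A] [IsSimpleRing A] [FiniteDimensional F A] {φ : A →ₗ[F] A} {G : Type*}
    [AddCommGroup G] {𝒜 : G → Submodule F A} (hφ : IsInvolution φ) (h : IsFinePhiGrading φ 𝒜) :
    ∃ P : InvPair F, Nonempty (Realization φ 𝒜 P) ∧
      invariantValues φ 𝒜 = {(Quotient.mk _ P : PairClass F)} := by
  obtain ⟨H, _, ι, hι, hsupp⟩ := exists_smallGroup h.1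
  obtain ⟨P, ⟨R⟩⟩ := exists_realization hφ hι
  have R' : Realization φ 𝒜 P := R.ofIso AlgEquiv.refl (fun g hg => by
    obtain ⟨k, hk⟩ := hsupp g hg
    exact ⟨k, (Submodule.map_id _).trans hk⟩) fun _ => rfl
  refine ⟨P, ⟨R'⟩, Set.eq_singleton_iff_unique_mem.2 ⟨⟨P, ⟨R'⟩, rfl⟩, ?_⟩⟩
  rintro _ ⟨P', ⟨R''⟩, rfl⟩
  exact Quotient.sound (R''.equivalent hφ h R')

end GradedInvolutions

theorem mainTheorem4 {F : Type u} [Field F] [IsAlgClosed F] [CharZero F] (n : ℕ) (hn : 1 ≤ n)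
    {G₁ : Type v} [AddCommGroup G₁] {G₂ : Type w} [AddCommGroup G₂]
    (φ₁ φ₂ : Matrix (Fin n) (Fin n) F →ₗ[F] Matrix (Fin n) (Fin n) F)
    (hφ₁ : GradedInvolutions.IsInvolution φ₁) (hφ₂ : GradedInvolutions.IsInvolution φ₂)
    (Γ₁ : G₁ → Submodule F (Matrix (Fin n) (Fin n) F))
    (Γ₂ : G₂ → Submodule F (Matrix (Fin n) (Fin n) F))
    (hΓ₁ : GradedInvolutions.IsFinePhiGrading φ₁ Γ₁)
    (hΓ₂ : GradedInvolutions.IsFinePhiGrading φ₂ Γ₂) :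
    ∃ c₁ c₂ : GradedInvolutions.PairClass F,
      GradedInvolutions.invariantValues φ₁ Γ₁ = {c₁} ∧
      GradedInvolutions.invariantValues φ₂ Γ₂ = {c₂} ∧
      ((∃ Φ : Matrix (Fin n) (Fin n) F ≃ₐ[F] Matrix (Fin n) (Fin n) F,
          GradedInvolutions.IsGradedIso Γ₁ Γ₂ Φ ∧ ∀ x, Φ (φ₁ (Φ.symm x)) = φ₂ x) → c₁ = c₂) ∧
      (c₁.length ≠ 0 ∨ GradedInvolutions.SameType φ₁ φ₂ → c₁ = c₂ →
        ∃ Φ : Matrix (Fin n) (Fin n) F ≃ₐ[F] Matrix (Fin n) (Fin n) F,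
          GradedInvolutions.IsGradedIso Γ₁ Γ₂ Φ ∧ ∀ x, Φ (φ₁ (Φ.symm x)) = φ₂ x) := by
  have : Nonempty (Fin n) := ⟨⟨0, hn⟩⟩
  obtain ⟨P₁, ⟨R₁⟩, h₁⟩ := GradedInvolutions.exists_invariantValues_eq hφ₁ hΓ₁
  obtain ⟨P₂, ⟨R₂⟩, h₂⟩ := GradedInvolutions.exists_invariantValues_eq hφ₂ hΓ₂
  refine ⟨_, _, h₁, h₂, ?_, fun htype heq => ?_⟩
  · rintro ⟨Φ, hΦ, hΦφ⟩
    -- Composing with `Φ` makes the realization of the second grading one of the first, whose set of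
    -- values is a singleton.
    have hmem : Quotient.mk _ P₂ ∈ GradedInvolutions.invariantValues φ₁ Γ₁ :=
      ⟨P₂, ⟨R₂.ofIso Φ hΦ fun x => by rw [← hΦφ, AlgEquiv.symm_apply_apply]⟩, rfl⟩
    rw [h₁] at hmem
    exact (Set.mem_singleton_iff.1 hmem).symm
  · exact GradedInvolutions.exists_isGradedIso_of_equivalent hn hφ₁ hφ₂ hΓ₁ hΓ₂ R₁ R₂
      (Quotient.exact heq) htype
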